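/- **Lemma (Correspondence).** Fix sets of strings $s$, numbers, addresses $a$, variables $x$, labels $\ell$ and primitive operations $\mathit{op}$. *Constants* are strings, numbers, addresses, $\mathtt{true},\mathtt{false},\mathtt{undef},\mathtt{null}$. *Expressions* are $$e ::= x \mid k \mid \mathtt{func}(\vec x)\{e\} \mid \{\overrightarrow{s{:}e}\} \mid \mathtt{let}\,(x=e)\,e \mid e(\vec e) \mid e[e] \mid e[e]=e \mid \mathtt{delete}\,e[e] \mid e=e \mid \mathtt{ref}\,e \mid \mathtt{deref}\,e \mid \mathtt{if}(e)\{e\}\{e\} \mid e;e \mid \mathtt{while}(e)\{e\} \mid \ell{:}\{e\} \mid \mathtt{break}\,\ell\,e \mid \mathtt{try}\{e\}\mathtt{catch}(x)\{e\} \mid \mathtt{try}\{e\}\mathtt{finally}\{e\} \mid \mathtt{throw}\,e \mid \mathit{op}(\vec e)$$ with $k$ a constant; a *program* is an expression without free variables. *Syntactic values* are constants, functions and records of syntactic values. *Closures* $c$ are generated by pairs $(e,\rho)$, constants, and all the forms above other than variables and functions with closures in place of expressions, where an *environment* $\rho$ is a finite map from variables to values; *values* $v$ are constants, pairs $(\mathtt{func}(\vec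 x)\{e\},\rho)$ and records of values. A *store* $\sigma$ is a finite map from addresses to values; an *answer* is $\langle\sigma,v\rangle$ or $\langle\sigma,\mathtt{err}\,v\rangle$ (over syntactic values for $\lambda_{JS}$, over values for $\lambda\rho_{JS}$). *Contexts* (the same for expressions and closures): $\mathcal C ::= [\,] \mid \mathtt{let}(x=\mathcal C)c \mid \mathcal C(\vec c) \mid v(\vec v,\mathcal C,\vec c) \mid \{\overrightarrow{s{:}v},s{:}\mathcal C,\overrightarrow{s{:}c}\} \mid \mathit{op}(\vec v,\mathcal C,\vec c) \mid \mathcal C[c] \mid v[\mathcal C] \mid \mathcal C[c]=c \mid v[\mathcal C]=c \mid v[v]=\mathcal C \mid \mathtt{delete}\,\mathcal C[c] \mid \mathtt{delete}\,v[\mathcal C] \mid \mathtt{ref}\,\mathcal C \mid \mathtt{deref}\,\mathcal C \mid \mathcal C=c \mid v=\mathcal C \mid \mathtt{if}(\mathcal C)\{c\}\{c\} \mid \mathcal C;c \mid \mathtt{throw}\,\mathcal C \mid \mathtt{break}\,\ell\,\mathcal C$; $\mathcal D ::= [\,] \mid \mathtt{try}\{\mathcal C[\mathcal D]\}\mathtt{finally}\{c\}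 \mid \ell{:}\{\mathcal C[\mathcal D]\} \mid \mathtt{try}\{\mathcal C[\mathcal D]\}\mathtt{catch}(x)\{c\}$; $\mathcal E ::= \mathcal C[\mathcal D]$; $\mathcal F ::= \mathcal C \mid \mathcal C[\ell{:}\{\mathcal F\}]$; $\mathcal G ::= \mathcal C \mid \mathcal C[\mathtt{try}\{\mathcal G\}\mathtt{catch}(x)\{c\}]$. *Rules common to both calculi*, applied inside any $\mathcal E$ (with $c$ an expression in $\lambda_{JS}$, a closure in $\lambda\rho_{JS}$): $\{\ldots,s{:}v,\ldots\}[s]\to v$; $\{\overrightarrow{s{:}v}\}[s']\to\mathtt{undef}$ if $s'\notin\vec s$; $(\{\ldots,s{:}u,\ldots\}[s]=v)\to\{\ldots,s{:}v,\ldots\}$; $(\{\overrightarrow{s{:}v}\}[s']=v)\to\{s'{:}v,\overrightarrow{s{:}v}\}$ if $s'\notin\vec s$; $\mathtt{delete}\,\{\ldots,s{:}u,\ldots\}[s]$ removes that field, and leaves the record unchanged if $s$ is not a key; $\mathtt{if}(\mathtt{true})\{c_1\}\{c_2\}\to c_1$, $\mathtt{if}(\mathtt{false})\{c_1\}\{c_2\}\to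 c_2$; $v;c\to c$; $\mathtt{while}(c_1)\{c_2\}\to\mathtt{if}(c_1)\{c_2;\mathtt{while}(c_1)\{c_2\}\}\{\mathtt{undef}\}$; $\mathtt{try}\{v\}\mathtt{catch}(x)\{c\}\to v$; $\mathtt{try}\{v\}\mathtt{finally}\{c\}\to c;v$; $\ell{:}\{v\}\to v$; $\mathit{op}(\vec v)\to\delta(\mathit{op},\vec v)$ where defined; $\langle\sigma,\mathcal E[\mathtt{ref}\,v]\rangle\to\langle\sigma[a\mapsto v],\mathcal E[a]\rangle$ for any $a\notin\mathrm{dom}\,\sigma$; $\langle\sigma,\mathcal E[\mathtt{deref}\,a]\rangle\to\langle\sigma,\mathcal E[\sigma(a)]\rangle$; $\langle\sigma,\mathcal E[a=v]\rangle\to\langle\sigma[a\mapsto v],\mathcal E[v]\rangle$. Moreover, run-time errors (calling a non-function or with the wrong number of arguments; indexing, updating or deleting in a non-record or with a non-string key; branching on a non-boolean; dereferencing a non-address or an unallocated address; assigning to a non-address; an undefined primitive application) reduce in place to $\mathtt{throw}\,k$ with a fixed constant $k$ for each kind of error. *$\lambda_{JS}$* (on expressions) adds, inside any $\mathcal E$: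 $\mathtt{let}(x=v)e\to[v/x]e$; $(\mathtt{func}(\vec x)\{e\})(\vec v)\to[\vec v/\vec x]e$ if $|\vec x|=|\vec v|$; $\mathtt{try}\{\mathcal F[\mathtt{throw}\,v]\}\mathtt{catch}(x)\{e\}\to[v/x]e$; $\mathtt{try}\{\mathcal F[\mathtt{throw}\,v]\}\mathtt{finally}\{e\}\to e;\mathtt{throw}\,v$; $\mathtt{try}\{\mathcal G[\mathtt{break}\,\ell\,v]\}\mathtt{finally}\{e\}\to e;\mathtt{break}\,\ell\,v$; $\ell'{:}\{\mathcal G[\mathtt{break}\,\ell\,v]\}\to v$ if $\ell'=\ell$, and $\to\mathtt{break}\,\ell\,v$ otherwise; and at top level $\langle\sigma,\mathcal F[\mathtt{throw}\,v]\rangle\to\langle\sigma,\mathtt{err}\,v\rangle$ and $\langle\sigma,\mathcal G[\mathtt{break}\,\ell\,v]\rangle\to\langle\sigma,\mathtt{throw}\,k\rangle$ (run-time error: unbound label). *$\lambda\rho_{JS}$* (on closures) adds, inside any $\mathcal E$: $(x,\rho)\to\rho(x)$; $\mathtt{let}(x=v)(e,\rho)\to(e,\rho[x\mapsto v])$; $(\mathtt{func}(\vec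 x)\{e\},\rho)(\vec v)\to(e,\rho[\vec x\mapsto\vec v])$ if $|\vec x|=|\vec v|$; the propagation of $\rho$ from $(e,\rho)$ to the immediate subexpressions of $e$ when $e$ is neither a variable nor a function (in particular $(k,\rho)\to k$); $\mathtt{try}\{\mathcal C[\mathtt{throw}\,v]\}\mathtt{catch}(x)\{(e,\rho)\}\to(e,\rho[x\mapsto v])$; $\mathtt{try}\{\mathcal C[\mathtt{throw}\,v]\}\mathtt{finally}\{c\}\to c;\mathtt{throw}\,v$; $\ell{:}\{\mathcal C[\mathtt{throw}\,v]\}\to\mathtt{throw}\,v$; $\mathtt{try}\{\mathcal C[\mathtt{break}\,\ell\,v]\}\mathtt{catch}(x)\{c\}\to\mathtt{break}\,\ell\,v$; $\mathtt{try}\{\mathcal C[\mathtt{break}\,\ell\,v]\}\mathtt{finally}\{c\}\to c;\mathtt{break}\,\ell\,v$; $\ell'{:}\{\mathcal C[\mathtt{break}\,\ell\,v]\}\to v$ if $\ell'=\ell$, and $\to\mathtt{break}\,\ell\,v$ otherwise; and at top level $\langle\sigma,\mathcal C[\mathtt{throw}\,v]\rangle\to\langle\sigma,\mathtt{err}\,v\rangle$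 and $\langle\sigma,\mathcal C[\mathtt{break}\,\ell\,v]\rangle\to\langle\sigma,\mathtt{throw}\,k\rangle$. Let $\mathcal U$ map values to syntactic values by $\mathcal U(k)=k$, $\mathcal U(\mathtt{func}(\vec x)\{e\},\{(x_0,v_0),\dots,(x_n,v_n)\})=[\mathcal U(v_0)/x_0,\dots,\mathcal U(v_n)/x_n](\mathtt{func}(\vec x)\{e\})$ and fieldwise on records, and answers to answers by applying it to the result (the value $v$, or the $v$ of $\mathtt{err}\,v$) and to every value in the store. The partial functions $\delta$ of the two calculi are arbitrary, subject to: on closed values they agree up to $\mathcal U$ (including where they are undefined), and their results on closed values are closed values. Then for every program $e$ and every $\lambda_{JS}$ answer $A$, $$\langle\emptyset,e\rangle\longrightarrow^*_{\lambda_{JS}}A\iff\text{there is an answer }A'\text{ with }\langle\emptyset,(e,\emptyset)\rangle\longrightarrow^*_{\lambda\rho_{JS}}A'\text{ and }A=\mathcal U(A').$$ -/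

import Mathlib

/-! # The substitution calculus `λ_JS` and the explicit-substitution calculus `λρ_JS` -/

namespace LambdaJS

/-- The run-time errors for which the calculi raise an exception. -/
inductive RuntimeError : Type
  | badCall
  | badIndex
  | badUpdate
  | badDelete
  | badCondition
  | badDeref
  | badAssign
  | badPrim
  | unboundLabel

/-- Syntactic constants over given sets of strings, numbers and addresses. -/
inductive ConstOf (Str Num Addr : Type) : Type
  | str (s : Str)
  | num (n : Num)
  | addr (a : Addr)
  | bool (b : Bool)
  | undef
  | null

/-- The basic sets over which the syntax is built, together with the constant that is thrown
for each kind of run-time error. -/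
structure Domains where
  Str : Type
  Num : Type
  Addr : Type
  Var : Type
  Label : Type
  Op : Type
  decVar : DecidableEq Var
  decAddr : DecidableEq Addr
  errConst : RuntimeError → ConstOf Str Num Addr

attribute [instance] Domains.decVar Domains.decAddr

variable (S : Domains)

abbrev Domains.Const : Type := ConstOf S.Str S.Num S.Addr

/-! ## Expressions -/

/-- Expressions `e`. -/
inductive Expr : Type
  | var (x : S.Var)
  | const (k : S.Const)
  | func (xs : List S.Var) (body : Expr)
  | record (fs : List (S.Str × Expr))
  | letin (x : S.Var) (e body : Expr)
  | app (f : Expr) (args : List Expr)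
  | get (o key : Expr)
  | put (o key e : Expr)
  | del (o key : Expr)
  | assign (l e : Expr)
  | alloc (e : Expr)
  | deref (e : Expr)
  | ite (c t f : Expr)
  | seq (a b : Expr)
  | whl (c body : Expr)
  | label (l : S.Label) (e : Expr)
  | brk (l : S.Label) (e : Expr)
  | tryc (e : Expr) (x : S.Var) (h : Expr)
  | tryf (e f : Expr)
  | throw (e : Expr)
  | prim (op : S.Op) (args : List Expr)

/-- Closures `c`. Bare constants are closures as well, since every value is a closure; a function
value is the closure `clos (func xs e) ρ`, a record value is a `record` of values.
An environment is a finite map given as an association list, in which the first entry for a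
variable counts. -/
inductive Clo : Type
  | const (k : S.Const)
  | clos (e : Expr S) (ρ : List (S.Var × Clo))
  | record (fs : List (S.Str × Clo))
  | letin (x : S.Var) (c body : Clo)
  | app (f : Clo) (args : List Clo)
  | get (o key : Clo)
  | put (o key c : Clo)
  | del (o key : Clo)
  | assign (l c : Clo)
  | alloc (c : Clo)
  | deref (c : Clo)
  | ite (c t f : Clo)
  | seq (a b : Clo)
  | whl (c body : Clo)
  | label (l : S.Label) (c : Clo)
  | brk (l : S.Label) (c : Clo)
  | tryc (c : Clo) (x : S.Var) (h : Clo)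
  | tryf (c f : Clo)
  | throw (c : Clo)
  | prim (op : S.Op) (args : List Clo)

abbrev Env : Type := List (S.Var × Clo S)

variable {S}

/-- Syntactic values. -/
inductive Expr.IsValue : Expr S → Prop
  | const (k : S.Const) : Expr.IsValue (.const k)
  | func (xs : List S.Var) (e : Expr S) : Expr.IsValue (.func xs e)
  | record (fs : List (S.Str × Expr S)) (h : ∀ p ∈ fs, Expr.IsValue p.2) :
      Expr.IsValue (.record fs)

/-- Values `v` of the calculus of explicit substitutions. -/
inductive Clo.IsValue : Clo S → Prop
  | const (k : S.Const) : Clo.IsValue (.const k)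
  | func (xs : List S.Var) (e : Expr S) (ρ : Env S) (h : ∀ p ∈ ρ, Clo.IsValue p.2) :
      Clo.IsValue (.clos (.func xs e) ρ)
  | record (fs : List (S.Str × Clo S)) (h : ∀ p ∈ fs, Clo.IsValue p.2) :
      Clo.IsValue (.record fs)

mutual
/-- Free variables. -/
def Expr.fv : Expr S → Set S.Var
  | .var x => {x}
  | .const _ => ∅
  | .func xs e => e.fv \ {x | x ∈ xs}
  | .record fs => Expr.fvFields fs
  | .letin x e b => e.fv ∪ (b.fv \ {x})
  | .app f as => f.fv ∪ Expr.fvList as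
  | .get o k => o.fv ∪ k.fv
  | .put o k e => o.fv ∪ k.fv ∪ e.fv
  | .del o k => o.fv ∪ k.fv
  | .assign l e => l.fv ∪ e.fv
  | .alloc e => e.fv
  | .deref e => e.fv
  | .ite c t f => c.fv ∪ t.fv ∪ f.fv
  | .seq a b => a.fv ∪ b.fv
  | .whl c b => c.fv ∪ b.fv
  | .label _ e => e.fv
  | .brk _ e => e.fv
  | .tryc e x h => e.fv ∪ (h.fv \ {x})
  | .tryf e f => e.fv ∪ f.fv
  | .throw e => e.fv
  | .prim _ as => Expr.fvList as
def Expr.fvList : List (Expr S) → Set S.Var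
  | [] => ∅
  | e :: es => e.fv ∪ Expr.fvList es
def Expr.fvFields : List (S.Str × Expr S) → Set S.Var
  | [] => ∅
  | (_, e) :: fs => e.fv ∪ Expr.fvFields fs
end

/-- A program is a closed expression. -/
def Expr.Closed (e : Expr S) : Prop := e.fv = ∅

/-- Closed values: every free variable of a function is bound by its environment, whose values
are closed in turn. -/
inductive Clo.IsClosedValue : Clo S → Prop
  | const (k : S.Const) : Clo.IsClosedValue (.const k)
  | func (xs : List S.Var) (e : Expr S) (ρ : Env S)
      (hdom : ∀ x ∈ (Expr.func xs e).fv, ∃ p ∈ ρ, p.1 = x)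
      (h : ∀ p ∈ ρ, Clo.IsClosedValue p.2) : Clo.IsClosedValue (.clos (.func xs e) ρ)
  | record (fs : List (S.Str × Clo S)) (h : ∀ p ∈ fs, Clo.IsClosedValue p.2) :
      Clo.IsClosedValue (.record fs)

/-! ## Substitution -/

/-- The substitution `θ` with the variables `xs` removed from its domain. -/
def hide (θ : S.Var → Option (Expr S)) (xs : List S.Var) : S.Var → Option (Expr S) :=
  fun y => if y ∈ xs then none else θ y

mutual
/-- Simultaneous replacement of the free occurrences of variables. No bound variable is renamed:
in the reduction of programs only closed values are substituted. -/
def Expr.subst (θ : S.Var → Option (Expr S)) : Expr S → Expr S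
  | .var x => (θ x).getD (.var x)
  | .const k => .const k
  | .func xs e => .func xs (e.subst (hide θ xs))
  | .record fs => .record (Expr.substFields θ fs)
  | .letin x e b => .letin x (e.subst θ) (b.subst (hide θ [x]))
  | .app f as => .app (f.subst θ) (Expr.substList θ as)
  | .get o k => .get (o.subst θ) (k.subst θ)
  | .put o k e => .put (o.subst θ) (k.subst θ) (e.subst θ)
  | .del o k => .del (o.subst θ) (k.subst θ)
  | .assign l e => .assign (l.subst θ) (e.subst θ)
  | .alloc e => .alloc (e.subst θ)
  | .deref e => .deref (e.subst θ)
  | .ite c t f => .ite (c.subst θ) (t.subst θ) (f.subst θ)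
  | .seq a b => .seq (a.subst θ) (b.subst θ)
  | .whl c b => .whl (c.subst θ) (b.subst θ)
  | .label l e => .label l (e.subst θ)
  | .brk l e => .brk l (e.subst θ)
  | .tryc e x h => .tryc (e.subst θ) x (h.subst (hide θ [x]))
  | .tryf e f => .tryf (e.subst θ) (f.subst θ)
  | .throw e => .throw (e.subst θ)
  | .prim op as => .prim op (Expr.substList θ as)
def Expr.substList (θ : S.Var → Option (Expr S)) : List (Expr S) → List (Expr S)
  | [] => []
  | e :: es => e.subst θ :: Expr.substList θ es
def Expr.substFields (θ : S.Var → Option (Expr S)) :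
    List (S.Str × Expr S) → List (S.Str × Expr S)
  | [] => []
  | (s, e) :: fs => (s, e.subst θ) :: Expr.substFields θ fs
end

/-- The simultaneous substitution `[v₀/x₀, …, vₙ/xₙ]` given by an association list. -/
def assoc (l : List (S.Var × Expr S)) : S.Var → Option (Expr S) := fun y => l.lookup y

/-! ## States and answers -/

/-- The second component of a state: a term under evaluation, or an uncaught exception `err v`. -/
inductive Outcome (T : Type) : Type
  | run (t : T)
  | err (v : T)

/-- Stores: partial maps from addresses to terms. -/
abbrev Store (S : Domains) (T : Type) : Type := S.Addr → Option T

abbrev State (S : Domains) (T : Type) : Type := Store S T × Outcome T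

def emptyStore {T : Type} : Store S T := fun _ => none

/-- Answers `⟨σ, v⟩` and `⟨σ, err v⟩`, where `σ` is a finite map from addresses to values and
`IsVal` says what the values are. -/
def IsAnswer {T : Type} (IsVal : T → Prop) (A : State S T) : Prop :=
  {a | A.1 a ≠ none}.Finite ∧ (∀ a v, A.1 a = some v → IsVal v) ∧
    ∃ v, IsVal v ∧ (A.2 = .run v ∨ A.2 = .err v)

/-! ## The substitution calculus `λ_JS` -/

namespace JS

/-- Local evaluation contexts `C`, with break contexts. -/
inductive LocalCtx : (Expr S → Expr S) → Prop
  | hole : LocalCtx (fun t => t)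
  | letin {C} (x : S.Var) (b : Expr S) : LocalCtx C → LocalCtx (fun t => .letin x (C t) b)
  | appFun {C} (as : List (Expr S)) : LocalCtx C → LocalCtx (fun t => .app (C t) as)
  | appArg {C} (f : Expr S) (vs es : List (Expr S)) (hf : f.IsValue) (hvs : ∀ v ∈ vs, v.IsValue) :
      LocalCtx C → LocalCtx (fun t => .app f (vs ++ C t :: es))
  | record {C} (fs : List (S.Str × Expr S)) (s : S.Str) (gs : List (S.Str × Expr S))
      (hfs : ∀ p ∈ fs, p.2.IsValue) :
      LocalCtx C → LocalCtx (fun t => .record (fs ++ (s, C t) :: gs))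
  | prim {C} (op : S.Op) (vs es : List (Expr S)) (hvs : ∀ v ∈ vs, v.IsValue) :
      LocalCtx C → LocalCtx (fun t => .prim op (vs ++ C t :: es))
  | getObj {C} (k : Expr S) : LocalCtx C → LocalCtx (fun t => .get (C t) k)
  | getKey {C} (o : Expr S) (ho : o.IsValue) : LocalCtx C → LocalCtx (fun t => .get o (C t))
  | putObj {C} (k e : Expr S) : LocalCtx C → LocalCtx (fun t => .put (C t) k e)
  | putKey {C} (o e : Expr S) (ho : o.IsValue) : LocalCtx C → LocalCtx (fun t => .put o (C t) e)
  | putVal {C} (o k : Expr S) (ho : o.IsValue) (hk : k.IsValue) :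
      LocalCtx C → LocalCtx (fun t => .put o k (C t))
  | delObj {C} (k : Expr S) : LocalCtx C → LocalCtx (fun t => .del (C t) k)
  | delKey {C} (o : Expr S) (ho : o.IsValue) : LocalCtx C → LocalCtx (fun t => .del o (C t))
  | alloc {C} : LocalCtx C → LocalCtx (fun t => .alloc (C t))
  | deref {C} : LocalCtx C → LocalCtx (fun t => .deref (C t))
  | assignLoc {C} (e : Expr S) : LocalCtx C → LocalCtx (fun t => .assign (C t) e)
  | assignVal {C} (l : Expr S) (hl : l.IsValue) : LocalCtx C → LocalCtx (fun t => .assign l (C t))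
  | ite {C} (a b : Expr S) : LocalCtx C → LocalCtx (fun t => .ite (C t) a b)
  | seq {C} (e : Expr S) : LocalCtx C → LocalCtx (fun t => .seq (C t) e)
  | throw {C} : LocalCtx C → LocalCtx (fun t => .throw (C t))
  | brk {C} (l : S.Label) : LocalCtx C → LocalCtx (fun t => .brk l (C t))

/-- Control contexts `D`. -/
inductive ControlCtx : (Expr S → Expr S) → Prop
  | hole : ControlCtx (fun t => t)
  | tryf {C D} (f : Expr S) : LocalCtx C → ControlCtx D → ControlCtx (fun t => .tryf (C (D t)) f)
  | label {C D} (l : S.Label) :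
      LocalCtx C → ControlCtx D → ControlCtx (fun t => .label l (C (D t)))
  | tryc {C D} (x : S.Var) (h : Expr S) :
      LocalCtx C → ControlCtx D → ControlCtx (fun t => .tryc (C (D t)) x h)

/-- General evaluation contexts `E ::= C[D]`. -/
inductive EvalCtx : (Expr S → Expr S) → Prop
  | mk {C D} : LocalCtx C → ControlCtx D → EvalCtx (fun t => C (D t))

/-- Local contexts including labels, `F ::= C | C[label l F]`. -/
inductive LabelCtx : (Expr S → Expr S) → Prop
  | loc {C} : LocalCtx C → LabelCtx C
  | label {C F} (l : S.Label) : LocalCtx C → LabelCtx F → LabelCtx (fun t => C (.label l (F t)))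

/-- Local contexts including exception handlers, `G ::= C | C[try G catch x e]`. -/
inductive HandlerCtx : (Expr S → Expr S) → Prop
  | loc {C} : LocalCtx C → HandlerCtx C
  | tryc {C G} (x : S.Var) (h : Expr S) :
      LocalCtx C → HandlerCtx G → HandlerCtx (fun t => C (.tryc (G t) x h))

/-- The exception raised by a run-time error. -/
def raise (r : RuntimeError) : Expr S := .throw (.const (S.errConst r))

/-- Context-insensitive, store-insensitive reductions, including those that raise run-time
errors; `δ` interprets the primitive operations. -/
inductive Red (δ : S.Op → List (Expr S) → Option (Expr S)) : Expr S → Expr S → Prop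
  | letin (x : S.Var) (v e : Expr S) (hv : v.IsValue) :
      Red δ (.letin x v e) (e.subst (assoc [(x, v)]))
  | app (xs : List S.Var) (e : Expr S) (vs : List (Expr S)) (hvs : ∀ v ∈ vs, v.IsValue)
      (hlen : xs.length = vs.length) :
      Red δ (.app (.func xs e) vs) (e.subst (assoc (xs.zip vs)))
  | getHit (fs gs : List (S.Str × Expr S)) (s : S.Str) (v : Expr S)
      (hr : (Expr.record (fs ++ (s, v) :: gs)).IsValue) :
      Red δ (.get (.record (fs ++ (s, v) :: gs)) (.const (.str s))) v
  | getMiss (fs : List (S.Str × Expr S)) (s : S.Str) (hr : (Expr.record fs).IsValue)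
      (hs : s ∉ fs.map Prod.fst) :
      Red δ (.get (.record fs) (.const (.str s))) (.const .undef)
  | putHit (fs gs : List (S.Str × Expr S)) (s : S.Str) (u v : Expr S)
      (hr : (Expr.record (fs ++ (s, u) :: gs)).IsValue) (hv : v.IsValue) :
      Red δ (.put (.record (fs ++ (s, u) :: gs)) (.const (.str s)) v)
        (.record (fs ++ (s, v) :: gs))
  | putMiss (fs : List (S.Str × Expr S)) (s : S.Str) (v : Expr S)
      (hr : (Expr.record fs).IsValue) (hv : v.IsValue) (hs : s ∉ fs.map Prod.fst) :
      Red δ (.put (.record fs) (.const (.str s)) v) (.record ((s, v) :: fs))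
  | delHit (fs gs : List (S.Str × Expr S)) (s : S.Str) (u : Expr S)
      (hr : (Expr.record (fs ++ (s, u) :: gs)).IsValue) :
      Red δ (.del (.record (fs ++ (s, u) :: gs)) (.const (.str s))) (.record (fs ++ gs))
  | delMiss (fs : List (S.Str × Expr S)) (s : S.Str) (hr : (Expr.record fs).IsValue)
      (hs : s ∉ fs.map Prod.fst) :
      Red δ (.del (.record fs) (.const (.str s))) (.record fs)
  | iteTrue (a b : Expr S) : Red δ (.ite (.const (.bool true)) a b) a
  | iteFalse (a b : Expr S) : Red δ (.ite (.const (.bool false)) a b) b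
  | seq (v e : Expr S) (hv : v.IsValue) : Red δ (.seq v e) e
  | whl (a b : Expr S) : Red δ (.whl a b) (.ite a (.seq b (.whl a b)) (.const .undef))
  | tryc (v : Expr S) (x : S.Var) (h : Expr S) (hv : v.IsValue) : Red δ (.tryc v x h) v
  | tryf (v e : Expr S) (hv : v.IsValue) : Red δ (.tryf v e) (.seq e v)
  | label (l : S.Label) (v : Expr S) (hv : v.IsValue) : Red δ (.label l v) v
  | prim (op : S.Op) (vs : List (Expr S)) (v : Expr S) (hvs : ∀ v ∈ vs, v.IsValue)
      (hδ : δ op vs = some v) : Red δ (.prim op vs) v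
  -- run-time errors
  | badCall (f : Expr S) (vs : List (Expr S)) (hf : f.IsValue) (hvs : ∀ v ∈ vs, v.IsValue)
      (hbad : ¬ ∃ xs e, f = .func xs e ∧ xs.length = vs.length) :
      Red δ (.app f vs) (raise .badCall)
  | badIndex (o k : Expr S) (ho : o.IsValue) (hk : k.IsValue)
      (hbad : ¬ ∃ fs s, o = .record fs ∧ k = .const (.str s)) :
      Red δ (.get o k) (raise .badIndex)
  | badUpdate (o k v : Expr S) (ho : o.IsValue) (hk : k.IsValue) (hv : v.IsValue)
      (hbad : ¬ ∃ fs s, o = .record fs ∧ k = .const (.str s)) :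
      Red δ (.put o k v) (raise .badUpdate)
  | badDelete (o k : Expr S) (ho : o.IsValue) (hk : k.IsValue)
      (hbad : ¬ ∃ fs s, o = .record fs ∧ k = .const (.str s)) :
      Red δ (.del o k) (raise .badDelete)
  | badCondition (v a b : Expr S) (hv : v.IsValue) (hbad : ¬ ∃ t, v = .const (.bool t)) :
      Red δ (.ite v a b) (raise .badCondition)
  | badDeref (v : Expr S) (hv : v.IsValue) (hbad : ¬ ∃ a, v = .const (.addr a)) :
      Red δ (.deref v) (raise .badDeref)
  | badAssign (u v : Expr S) (hu : u.IsValue) (hv : v.IsValue)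
      (hbad : ¬ ∃ a, u = .const (.addr a)) :
      Red δ (.assign u v) (raise .badAssign)
  | badPrim (op : S.Op) (vs : List (Expr S)) (hvs : ∀ v ∈ vs, v.IsValue) (hδ : δ op vs = none) :
      Red δ (.prim op vs) (raise .badPrim)

/-- One-step reduction of `λ_JS`. -/
inductive Step (δ : S.Op → List (Expr S) → Option (Expr S)) :
    State S (Expr S) → State S (Expr S) → Prop
  | ctx (σ : Store S (Expr S)) {E} (hE : EvalCtx E) {e e' : Expr S} (h : Red δ e e') :
      Step δ (σ, .run (E e)) (σ, .run (E e'))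
  | alloc (σ : Store S (Expr S)) {E} (hE : EvalCtx E) (v : Expr S) (hv : v.IsValue) (a : S.Addr)
      (ha : σ a = none) :
      Step δ (σ, .run (E (.alloc v))) (Function.update σ a (some v), .run (E (.const (.addr a))))
  | deref (σ : Store S (Expr S)) {E} (hE : EvalCtx E) (a : S.Addr) (v : Expr S)
      (ha : σ a = some v) :
      Step δ (σ, .run (E (.deref (.const (.addr a))))) (σ, .run (E v))
  | derefDangling (σ : Store S (Expr S)) {E} (hE : EvalCtx E) (a : S.Addr) (ha : σ a = none) :
      Step δ (σ, .run (E (.deref (.const (.addr a))))) (σ, .run (E (raise .badDeref)))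
  | assign (σ : Store S (Expr S)) {E} (hE : EvalCtx E) (a : S.Addr) (v : Expr S)
      (hv : v.IsValue) :
      Step δ (σ, .run (E (.assign (.const (.addr a)) v)))
        (Function.update σ a (some v), .run (E v))
  | uncaught (σ : Store S (Expr S)) {F} (hF : LabelCtx F) (v : Expr S) (hv : v.IsValue) :
      Step δ (σ, .run (F (.throw v))) (σ, .err v)
  | throwCatch (σ : Store S (Expr S)) {E F} (hE : EvalCtx E) (hF : LabelCtx F) (v : Expr S)
      (hv : v.IsValue) (x : S.Var) (e : Expr S) :
      Step δ (σ, .run (E (.tryc (F (.throw v)) x e)))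
        (σ, .run (E (e.subst (assoc [(x, v)]))))
  | throwFinally (σ : Store S (Expr S)) {E F} (hE : EvalCtx E) (hF : LabelCtx F) (v : Expr S)
      (hv : v.IsValue) (e : Expr S) :
      Step δ (σ, .run (E (.tryf (F (.throw v)) e))) (σ, .run (E (.seq e (.throw v))))
  | breakFinally (σ : Store S (Expr S)) {E G} (hE : EvalCtx E) (hG : HandlerCtx G) (l : S.Label)
      (v : Expr S) (hv : v.IsValue) (e : Expr S) :
      Step δ (σ, .run (E (.tryf (G (.brk l v)) e))) (σ, .run (E (.seq e (.brk l v))))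
  | breakLabel (σ : Store S (Expr S)) {E G} (hE : EvalCtx E) (hG : HandlerCtx G) (l : S.Label)
      (v : Expr S) (hv : v.IsValue) :
      Step δ (σ, .run (E (.label l (G (.brk l v))))) (σ, .run (E v))
  | breakOther (σ : Store S (Expr S)) {E G} (hE : EvalCtx E) (hG : HandlerCtx G)
      (l l' : S.Label) (hl : l' ≠ l) (v : Expr S) (hv : v.IsValue) :
      Step δ (σ, .run (E (.label l' (G (.brk l v))))) (σ, .run (E (.brk l v)))
  | breakUnbound (σ : Store S (Expr S)) {G} (hG : HandlerCtx G) (l : S.Label) (v : Expr S)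
      (hv : v.IsValue) :
      Step δ (σ, .run (G (.brk l v))) (σ, .run (raise .unboundLabel))

end JS

/-! ## The calculus of explicit substitutions `λρ_JS` -/

namespace Rho

/-- Local evaluation contexts `C`. -/
inductive LocalCtx : (Clo S → Clo S) → Prop
  | hole : LocalCtx (fun t => t)
  | letin {C} (x : S.Var) (b : Clo S) : LocalCtx C → LocalCtx (fun t => .letin x (C t) b)
  | appFun {C} (as : List (Clo S)) : LocalCtx C → LocalCtx (fun t => .app (C t) as)
  | appArg {C} (f : Clo S) (vs cs : List (Clo S)) (hf : f.IsValue) (hvs : ∀ v ∈ vs, v.IsValue) :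
      LocalCtx C → LocalCtx (fun t => .app f (vs ++ C t :: cs))
  | record {C} (fs : List (S.Str × Clo S)) (s : S.Str) (gs : List (S.Str × Clo S))
      (hfs : ∀ p ∈ fs, p.2.IsValue) :
      LocalCtx C → LocalCtx (fun t => .record (fs ++ (s, C t) :: gs))
  | prim {C} (op : S.Op) (vs cs : List (Clo S)) (hvs : ∀ v ∈ vs, v.IsValue) :
      LocalCtx C → LocalCtx (fun t => .prim op (vs ++ C t :: cs))
  | getObj {C} (k : Clo S) : LocalCtx C → LocalCtx (fun t => .get (C t) k)
  | getKey {C} (o : Clo S) (ho : o.IsValue) : LocalCtx C → LocalCtx (fun t => .get o (C t))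
  | putObj {C} (k c : Clo S) : LocalCtx C → LocalCtx (fun t => .put (C t) k c)
  | putKey {C} (o c : Clo S) (ho : o.IsValue) : LocalCtx C → LocalCtx (fun t => .put o (C t) c)
  | putVal {C} (o k : Clo S) (ho : o.IsValue) (hk : k.IsValue) :
      LocalCtx C → LocalCtx (fun t => .put o k (C t))
  | delObj {C} (k : Clo S) : LocalCtx C → LocalCtx (fun t => .del (C t) k)
  | delKey {C} (o : Clo S) (ho : o.IsValue) : LocalCtx C → LocalCtx (fun t => .del o (C t))
  | alloc {C} : LocalCtx C → LocalCtx (fun t => .alloc (C t))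
  | deref {C} : LocalCtx C → LocalCtx (fun t => .deref (C t))
  | assignLoc {C} (c : Clo S) : LocalCtx C → LocalCtx (fun t => .assign (C t) c)
  | assignVal {C} (l : Clo S) (hl : l.IsValue) : LocalCtx C → LocalCtx (fun t => .assign l (C t))
  | ite {C} (a b : Clo S) : LocalCtx C → LocalCtx (fun t => .ite (C t) a b)
  | seq {C} (c : Clo S) : LocalCtx C → LocalCtx (fun t => .seq (C t) c)
  | throw {C} : LocalCtx C → LocalCtx (fun t => .throw (C t))
  | brk {C} (l : S.Label) : LocalCtx C → LocalCtx (fun t => .brk l (C t))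

/-- Control contexts `D`. -/
inductive ControlCtx : (Clo S → Clo S) → Prop
  | hole : ControlCtx (fun t => t)
  | tryf {C D} (f : Clo S) : LocalCtx C → ControlCtx D → ControlCtx (fun t => .tryf (C (D t)) f)
  | label {C D} (l : S.Label) :
      LocalCtx C → ControlCtx D → ControlCtx (fun t => .label l (C (D t)))
  | tryc {C D} (x : S.Var) (h : Clo S) :
      LocalCtx C → ControlCtx D → ControlCtx (fun t => .tryc (C (D t)) x h)

/-- General evaluation contexts `E ::= C[D]`. -/
inductive EvalCtx : (Clo S → Clo S) → Prop
  | mk {C D} : LocalCtx C → ControlCtx D → EvalCtx (fun t => C (D t))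

/-- The exception raised by a run-time error. -/
def raise (r : RuntimeError) : Clo S := .throw (.const (S.errConst r))

/-- Context-insensitive, store-insensitive reductions, including those that raise run-time
errors; `δ` interprets the primitive operations. -/
inductive Red (δ : S.Op → List (Clo S) → Option (Clo S)) : Clo S → Clo S → Prop
  | var (x : S.Var) (ρ : Env S) (v : Clo S) (hx : ρ.lookup x = some v) : Red δ (.clos (.var x) ρ) v
  | letin (x : S.Var) (v : Clo S) (e : Expr S) (ρ : Env S) (hv : v.IsValue) :
      Red δ (.letin x v (.clos e ρ)) (.clos e ((x, v) :: ρ))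
  | app (xs : List S.Var) (e : Expr S) (ρ : Env S) (vs : List (Clo S))
      (hvs : ∀ v ∈ vs, v.IsValue) (hlen : xs.length = vs.length) :
      Red δ (.app (.clos (.func xs e) ρ) vs) (.clos e (xs.zip vs ++ ρ))
  | getHit (fs gs : List (S.Str × Clo S)) (s : S.Str) (v : Clo S)
      (hr : (Clo.record (fs ++ (s, v) :: gs)).IsValue) :
      Red δ (.get (.record (fs ++ (s, v) :: gs)) (.const (.str s))) v
  | getMiss (fs : List (S.Str × Clo S)) (s : S.Str) (hr : (Clo.record fs).IsValue)
      (hs : s ∉ fs.map Prod.fst) :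
      Red δ (.get (.record fs) (.const (.str s))) (.const .undef)
  | putHit (fs gs : List (S.Str × Clo S)) (s : S.Str) (u v : Clo S)
      (hr : (Clo.record (fs ++ (s, u) :: gs)).IsValue) (hv : v.IsValue) :
      Red δ (.put (.record (fs ++ (s, u) :: gs)) (.const (.str s)) v)
        (.record (fs ++ (s, v) :: gs))
  | putMiss (fs : List (S.Str × Clo S)) (s : S.Str) (v : Clo S)
      (hr : (Clo.record fs).IsValue) (hv : v.IsValue) (hs : s ∉ fs.map Prod.fst) :
      Red δ (.put (.record fs) (.const (.str s)) v) (.record ((s, v) :: fs))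
  | delHit (fs gs : List (S.Str × Clo S)) (s : S.Str) (u : Clo S)
      (hr : (Clo.record (fs ++ (s, u) :: gs)).IsValue) :
      Red δ (.del (.record (fs ++ (s, u) :: gs)) (.const (.str s))) (.record (fs ++ gs))
  | delMiss (fs : List (S.Str × Clo S)) (s : S.Str) (hr : (Clo.record fs).IsValue)
      (hs : s ∉ fs.map Prod.fst) :
      Red δ (.del (.record fs) (.const (.str s))) (.record fs)
  | iteTrue (a b : Clo S) : Red δ (.ite (.const (.bool true)) a b) a
  | iteFalse (a b : Clo S) : Red δ (.ite (.const (.bool false)) a b) b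
  | seq (v c : Clo S) (hv : v.IsValue) : Red δ (.seq v c) c
  | whl (a b : Clo S) : Red δ (.whl a b) (.ite a (.seq b (.whl a b)) (.const .undef))
  | tryc (v : Clo S) (x : S.Var) (h : Clo S) (hv : v.IsValue) : Red δ (.tryc v x h) v
  | tryf (v c : Clo S) (hv : v.IsValue) : Red δ (.tryf v c) (.seq c v)
  | label (l : S.Label) (v : Clo S) (hv : v.IsValue) : Red δ (.label l v) v
  | prim (op : S.Op) (vs : List (Clo S)) (v : Clo S) (hvs : ∀ v ∈ vs, v.IsValue)
      (hδ : δ op vs = some v) : Red δ (.prim op vs) v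
  -- run-time errors
  | badCall (f : Clo S) (vs : List (Clo S)) (hf : f.IsValue) (hvs : ∀ v ∈ vs, v.IsValue)
      (hbad : ¬ ∃ xs e ρ, f = .clos (.func xs e) ρ ∧ xs.length = vs.length) :
      Red δ (.app f vs) (raise .badCall)
  | badIndex (o k : Clo S) (ho : o.IsValue) (hk : k.IsValue)
      (hbad : ¬ ∃ fs s, o = .record fs ∧ k = .const (.str s)) :
      Red δ (.get o k) (raise .badIndex)
  | badUpdate (o k v : Clo S) (ho : o.IsValue) (hk : k.IsValue) (hv : v.IsValue)
      (hbad : ¬ ∃ fs s, o = .record fs ∧ k = .const (.str s)) :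
      Red δ (.put o k v) (raise .badUpdate)
  | badDelete (o k : Clo S) (ho : o.IsValue) (hk : k.IsValue)
      (hbad : ¬ ∃ fs s, o = .record fs ∧ k = .const (.str s)) :
      Red δ (.del o k) (raise .badDelete)
  | badCondition (v a b : Clo S) (hv : v.IsValue) (hbad : ¬ ∃ t, v = .const (.bool t)) :
      Red δ (.ite v a b) (raise .badCondition)
  | badDeref (v : Clo S) (hv : v.IsValue) (hbad : ¬ ∃ a, v = .const (.addr a)) :
      Red δ (.deref v) (raise .badDeref)
  | badAssign (u v : Clo S) (hu : u.IsValue) (hv : v.IsValue)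
      (hbad : ¬ ∃ a, u = .const (.addr a)) :
      Red δ (.assign u v) (raise .badAssign)
  | badPrim (op : S.Op) (vs : List (Clo S)) (hvs : ∀ v ∈ vs, v.IsValue) (hδ : δ op vs = none) :
      Red δ (.prim op vs) (raise .badPrim)

/-- Reductions that propagate an environment from a closure to the inner expressions. A closed
function `(func xs e, ρ)` is a value and a variable is looked up, so neither is propagated. -/
inductive Propagate : Clo S → Clo S → Prop
  | const (k : S.Const) (ρ : Env S) : Propagate (.clos (.const k) ρ) (.const k)
  | record (fs : List (S.Str × Expr S)) (ρ : Env S) :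
      Propagate (.clos (.record fs) ρ) (.record (fs.map fun p => (p.1, .clos p.2 ρ)))
  | letin (x : S.Var) (e b : Expr S) (ρ : Env S) :
      Propagate (.clos (.letin x e b) ρ) (.letin x (.clos e ρ) (.clos b ρ))
  | app (f : Expr S) (as : List (Expr S)) (ρ : Env S) :
      Propagate (.clos (.app f as) ρ) (.app (.clos f ρ) (as.map fun e => .clos e ρ))
  | get (o k : Expr S) (ρ : Env S) :
      Propagate (.clos (.get o k) ρ) (.get (.clos o ρ) (.clos k ρ))
  | put (o k e : Expr S) (ρ : Env S) :
      Propagate (.clos (.put o k e) ρ) (.put (.clos o ρ) (.clos k ρ) (.clos e ρ))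
  | del (o k : Expr S) (ρ : Env S) :
      Propagate (.clos (.del o k) ρ) (.del (.clos o ρ) (.clos k ρ))
  | assign (l e : Expr S) (ρ : Env S) :
      Propagate (.clos (.assign l e) ρ) (.assign (.clos l ρ) (.clos e ρ))
  | alloc (e : Expr S) (ρ : Env S) : Propagate (.clos (.alloc e) ρ) (.alloc (.clos e ρ))
  | deref (e : Expr S) (ρ : Env S) : Propagate (.clos (.deref e) ρ) (.deref (.clos e ρ))
  | ite (c t f : Expr S) (ρ : Env S) :
      Propagate (.clos (.ite c t f) ρ) (.ite (.clos c ρ) (.clos t ρ) (.clos f ρ))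
  | seq (a b : Expr S) (ρ : Env S) : Propagate (.clos (.seq a b) ρ) (.seq (.clos a ρ) (.clos b ρ))
  | whl (a b : Expr S) (ρ : Env S) : Propagate (.clos (.whl a b) ρ) (.whl (.clos a ρ) (.clos b ρ))
  | label (l : S.Label) (e : Expr S) (ρ : Env S) :
      Propagate (.clos (.label l e) ρ) (.label l (.clos e ρ))
  | brk (l : S.Label) (e : Expr S) (ρ : Env S) :
      Propagate (.clos (.brk l e) ρ) (.brk l (.clos e ρ))
  | tryc (e : Expr S) (x : S.Var) (h : Expr S) (ρ : Env S) :
      Propagate (.clos (.tryc e x h) ρ) (.tryc (.clos e ρ) x (.clos h ρ))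
  | tryf (e f : Expr S) (ρ : Env S) :
      Propagate (.clos (.tryf e f) ρ) (.tryf (.clos e ρ) (.clos f ρ))
  | throw (e : Expr S) (ρ : Env S) : Propagate (.clos (.throw e) ρ) (.throw (.clos e ρ))
  | prim (op : S.Op) (as : List (Expr S)) (ρ : Env S) :
      Propagate (.clos (.prim op as) ρ) (.prim op (as.map fun e => .clos e ρ))

/-- One-step reduction of `λρ_JS`. -/
inductive Step (δ : S.Op → List (Clo S) → Option (Clo S)) :
    State S (Clo S) → State S (Clo S) → Prop
  | ctx (σ : Store S (Clo S)) {E} (hE : EvalCtx E) {c c' : Clo S} (h : Red δ c c') :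
      Step δ (σ, .run (E c)) (σ, .run (E c'))
  | propagate (σ : Store S (Clo S)) {E} (hE : EvalCtx E) {c c' : Clo S} (h : Propagate c c') :
      Step δ (σ, .run (E c)) (σ, .run (E c'))
  | alloc (σ : Store S (Clo S)) {E} (hE : EvalCtx E) (v : Clo S) (hv : v.IsValue) (a : S.Addr)
      (ha : σ a = none) :
      Step δ (σ, .run (E (.alloc v))) (Function.update σ a (some v), .run (E (.const (.addr a))))
  | deref (σ : Store S (Clo S)) {E} (hE : EvalCtx E) (a : S.Addr) (v : Clo S)
      (ha : σ a = some v) :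
      Step δ (σ, .run (E (.deref (.const (.addr a))))) (σ, .run (E v))
  | derefDangling (σ : Store S (Clo S)) {E} (hE : EvalCtx E) (a : S.Addr) (ha : σ a = none) :
      Step δ (σ, .run (E (.deref (.const (.addr a))))) (σ, .run (E (raise .badDeref)))
  | assign (σ : Store S (Clo S)) {E} (hE : EvalCtx E) (a : S.Addr) (v : Clo S)
      (hv : v.IsValue) :
      Step δ (σ, .run (E (.assign (.const (.addr a)) v)))
        (Function.update σ a (some v), .run (E v))
  | uncaught (σ : Store S (Clo S)) {C} (hC : LocalCtx C) (v : Clo S) (hv : v.IsValue) :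
      Step δ (σ, .run (C (.throw v))) (σ, .err v)
  | throwCatch (σ : Store S (Clo S)) {E C} (hE : EvalCtx E) (hC : LocalCtx C) (v : Clo S)
      (hv : v.IsValue) (x : S.Var) (e : Expr S) (ρ : Env S) :
      Step δ (σ, .run (E (.tryc (C (.throw v)) x (.clos e ρ))))
        (σ, .run (E (.clos e ((x, v) :: ρ))))
  | throwFinally (σ : Store S (Clo S)) {E C} (hE : EvalCtx E) (hC : LocalCtx C) (v : Clo S)
      (hv : v.IsValue) (c : Clo S) :
      Step δ (σ, .run (E (.tryf (C (.throw v)) c))) (σ, .run (E (.seq c (.throw v))))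
  | throwLabel (σ : Store S (Clo S)) {E C} (hE : EvalCtx E) (hC : LocalCtx C) (v : Clo S)
      (hv : v.IsValue) (l : S.Label) :
      Step δ (σ, .run (E (.label l (C (.throw v))))) (σ, .run (E (.throw v)))
  | breakCatch (σ : Store S (Clo S)) {E C} (hE : EvalCtx E) (hC : LocalCtx C) (l : S.Label)
      (v : Clo S) (hv : v.IsValue) (x : S.Var) (c : Clo S) :
      Step δ (σ, .run (E (.tryc (C (.brk l v)) x c))) (σ, .run (E (.brk l v)))
  | breakFinally (σ : Store S (Clo S)) {E C} (hE : EvalCtx E) (hC : LocalCtx C) (l : S.Label)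
      (v : Clo S) (hv : v.IsValue) (c : Clo S) :
      Step δ (σ, .run (E (.tryf (C (.brk l v)) c))) (σ, .run (E (.seq c (.brk l v))))
  | breakLabel (σ : Store S (Clo S)) {E C} (hE : EvalCtx E) (hC : LocalCtx C) (l : S.Label)
      (v : Clo S) (hv : v.IsValue) :
      Step δ (σ, .run (E (.label l (C (.brk l v))))) (σ, .run (E v))
  | breakOther (σ : Store S (Clo S)) {E C} (hE : EvalCtx E) (hC : LocalCtx C)
      (l l' : S.Label) (hl : l' ≠ l) (v : Clo S) (hv : v.IsValue) :
      Step δ (σ, .run (E (.label l' (C (.brk l v))))) (σ, .run (E (.brk l v)))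
  | breakUnbound (σ : Store S (Clo S)) {C} (hC : LocalCtx C) (l : S.Label) (v : Clo S)
      (hv : v.IsValue) :
      Step δ (σ, .run (C (.brk l v))) (σ, .run (raise .unboundLabel))

/-- The initial state `⟨∅, (e, ∅)⟩`. -/
def inj (e : Expr S) : State S (Clo S) := (emptyStore, .run (.clos e []))

end Rho

/-! ## Forcing delayed substitutions -/

mutual
/-- The map `U` on values: it carries out the substitutions delayed in environments. It is only
meant for values; closures that are neither constants, nor pairs `(e, ρ)`, nor records are sent to
a dummy. -/
def Clo.force : Clo S → Expr S
  | .const k => .const k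
  | .clos e ρ => e.subst (assoc (Clo.forceEnv ρ))
  | .record fs => .record (Clo.forceFields fs)
  | _ => .const .undef
def Clo.forceEnv : List (S.Var × Clo S) → List (S.Var × Expr S)
  | [] => []
  | (x, c) :: ρ => (x, c.force) :: Clo.forceEnv ρ
def Clo.forceFields : List (S.Str × Clo S) → List (S.Str × Expr S)
  | [] => []
  | (s, c) :: fs => (s, c.force) :: Clo.forceFields fs
end

/-- The map `U` on answers: it forces the result and all values in the store. -/
def forceState (A : State S (Clo S)) : State S (Expr S) :=
  (fun a => (A.1 a).map Clo.force,
    match A.2 with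
    | .run c => .run c.force
    | .err c => .err c.force)

end LambdaJS

/-!
Both calculi are read through one lens: a compound term consists of a head, the subterms that have
to be evaluated, and the subterms that are not. Contexts are then iterated frames, and the three
kinds of contexts of the two calculi differ only in the heads that they may pass.

A closure `c` denotes an expression `e` if carrying out the delayed substitutions of `c` yields `e`.
Each step of `λρ_JS` is matched by at most one step of `λ_JS`, except that an exception or a break
leaves one handler at a time where `λ_JS` leaves several at once: discarding a handler that does not
respond is no step of `λ_JS`, but it changes no answer that is reachable. Conversely, if `c` denotes
a redex inside a context, then `c` first reduces, by propagating environments, looking up variables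
and discarding handlers, to a redex of the same kind that denotes it.
-/

namespace LambdaJS

/-! ## Compound terms -/

section Compound

variable {S : Domains} {T : Type}

/-- The outermost operator of a compound expression or closure, with everything but its subterms. -/
inductive Head (S : Domains) : Type
  | record (ss : List S.Str)
  | letin (x : S.Var)
  | app
  | get
  | put
  | del
  | assign
  | alloc
  | deref
  | ite
  | seq
  | whl
  | label (l : S.Label)
  | brk (l : S.Label)
  | tryc (x : S.Var)
  | tryf
  | throw
  | prim (op : S.Op)

/-- The variables that an operator binds in its delayed subterms. -/
def Head.binder : Head S → List S.Var
  | .letin x => [x]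
  | .tryc x => [x]
  | _ => []

/-- The operators whose compounds are values as soon as their strict subterms are. -/
def Head.IsRecord : Head S → Prop
  | .record _ => True
  | _ => False

/-- The operators allowed around the hole of a local context. -/
def Head.IsLocal : Head S → Prop
  | .label _ => False
  | .tryc _ => False
  | .tryf => False
  | _ => True

/-- `h.Arity m n`: the operator `h` takes `m` strict and `n` delayed subterms. -/
def Head.Arity : Head S → ℕ → ℕ → Prop
  | .record ss, m, n => m = ss.length ∧ n = 0
  | .app, m, n => 0 < m ∧ n = 0
  | .prim _, _, n => n = 0
  | .letin _, m, n | .seq, m, n | .tryc _, m, n | .tryf, m, n => m = 1 ∧ n = 1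
  | .get, m, n | .del, m, n | .assign, m, n => m = 2 ∧ n = 0
  | .put, m, n => m = 3 ∧ n = 0
  | .alloc, m, n | .deref, m, n | .label _, m, n | .brk _, m, n | .throw, m, n => m = 1 ∧ n = 0
  | .ite, m, n => m = 1 ∧ n = 2
  | .whl, m, n => m = 0 ∧ n = 2

/-- Compound terms of both calculi, seen uniformly: an operator, the subterms that are evaluated
in place from left to right, and the subterms whose evaluation is delayed. -/
@[ext]
structure Parts (S : Domains) (T : Type) : Type where
  head : Head S
  strict : List T
  delayed : List T

/-- The numbers of subterms fit the operator, so that the parts are those of a term. -/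
def Parts.Fits (p : Parts S T) : Prop := p.head.Arity p.strict.length p.delayed.length

/-- What the expressions and the closures have in common: terms that are either atomic or composed
of parts, with the values among them. -/
class Term (S : outParam Domains) (T : Type) where
  parts : T → Option (Parts S T)
  ofParts : Parts S T → T
  IsValue : T → Prop
  parts_eq_some_iff {t : T} {p : Parts S T} : parts t = some p ↔ p.Fits ∧ ofParts p = t
  isValue_iff_of_parts {t : T} {p : Parts S T} : parts t = some p →
    (IsValue t ↔ p.head.IsRecord ∧ ∀ v ∈ p.strict, IsValue v)

/-- The parts of a compound expression; variables, constants and functions count as atomic. -/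
def Expr.parts : Expr S → Option (Parts S (Expr S))
  | .var _ => none
  | .const _ => none
  | .func _ _ => none
  | .record fs => some ⟨.record (fs.map Prod.fst), fs.map Prod.snd, []⟩
  | .letin x e b => some ⟨.letin x, [e], [b]⟩
  | .app f as => some ⟨.app, f :: as, []⟩
  | .get o k => some ⟨.get, [o, k], []⟩
  | .put o k e => some ⟨.put, [o, k, e], []⟩
  | .del o k => some ⟨.del, [o, k], []⟩
  | .assign l e => some ⟨.assign, [l, e], []⟩
  | .alloc e => some ⟨.alloc, [e], []⟩
  | .deref e => some ⟨.deref, [e], []⟩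
  | .ite c t f => some ⟨.ite, [c], [t, f]⟩
  | .seq a b => some ⟨.seq, [a], [b]⟩
  | .whl c b => some ⟨.whl, [], [c, b]⟩
  | .label l e => some ⟨.label l, [e], []⟩
  | .brk l e => some ⟨.brk l, [e], []⟩
  | .tryc e x h => some ⟨.tryc x, [e], [h]⟩
  | .tryf e f => some ⟨.tryf, [e], [f]⟩
  | .throw e => some ⟨.throw, [e], []⟩
  | .prim op as => some ⟨.prim op, as, []⟩

/-- The compound expression with given parts; `undef` if their numbers do not fit the operator. -/
def Expr.ofParts : Parts S (Expr S) → Expr S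
  | ⟨.record ss, as, _⟩ => .record (ss.zip as)
  | ⟨.letin x, [e], [b]⟩ => .letin x e b
  | ⟨.app, f :: as, _⟩ => .app f as
  | ⟨.get, [o, k], _⟩ => .get o k
  | ⟨.put, [o, k, e], _⟩ => .put o k e
  | ⟨.del, [o, k], _⟩ => .del o k
  | ⟨.assign, [l, e], _⟩ => .assign l e
  | ⟨.alloc, [e], _⟩ => .alloc e
  | ⟨.deref, [e], _⟩ => .deref e
  | ⟨.ite, [c], [t, f]⟩ => .ite c t f
  | ⟨.seq, [a], [b]⟩ => .seq a b
  | ⟨.whl, _, [c, b]⟩ => .whl c b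
  | ⟨.label l, [e], _⟩ => .label l e
  | ⟨.brk l, [e], _⟩ => .brk l e
  | ⟨.tryc x, [e], [h]⟩ => .tryc e x h
  | ⟨.tryf, [e], [f]⟩ => .tryf e f
  | ⟨.throw, [e], _⟩ => .throw e
  | ⟨.prim op, as, _⟩ => .prim op as
  | _ => .const .undef

/-- The parts of a compound closure; constants and pairs `(e, ρ)` count as atomic. -/
def Clo.parts : Clo S → Option (Parts S (Clo S))
  | .const _ => none
  | .clos _ _ => none
  | .record fs => some ⟨.record (fs.map Prod.fst), fs.map Prod.snd, []⟩
  | .letin x c b => some ⟨.letin x, [c], [b]⟩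
  | .app f as => some ⟨.app, f :: as, []⟩
  | .get o k => some ⟨.get, [o, k], []⟩
  | .put o k c => some ⟨.put, [o, k, c], []⟩
  | .del o k => some ⟨.del, [o, k], []⟩
  | .assign l c => some ⟨.assign, [l, c], []⟩
  | .alloc c => some ⟨.alloc, [c], []⟩
  | .deref c => some ⟨.deref, [c], []⟩
  | .ite c t f => some ⟨.ite, [c], [t, f]⟩
  | .seq a b => some ⟨.seq, [a], [b]⟩
  | .whl c b => some ⟨.whl, [], [c, b]⟩
  | .label l c => some ⟨.label l, [c], []⟩
  | .brk l c => some ⟨.brk l, [c], []⟩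
  | .tryc c x h => some ⟨.tryc x, [c], [h]⟩
  | .tryf c f => some ⟨.tryf, [c], [f]⟩
  | .throw c => some ⟨.throw, [c], []⟩
  | .prim op as => some ⟨.prim op, as, []⟩

/-- The compound closure with given parts; `undef` if their numbers do not fit the operator. -/
def Clo.ofParts : Parts S (Clo S) → Clo S
  | ⟨.record ss, as, _⟩ => .record (ss.zip as)
  | ⟨.letin x, [c], [b]⟩ => .letin x c b
  | ⟨.app, f :: as, _⟩ => .app f as
  | ⟨.get, [o, k], _⟩ => .get o k
  | ⟨.put, [o, k, c], _⟩ => .put o k c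
  | ⟨.del, [o, k], _⟩ => .del o k
  | ⟨.assign, [l, c], _⟩ => .assign l c
  | ⟨.alloc, [c], _⟩ => .alloc c
  | ⟨.deref, [c], _⟩ => .deref c
  | ⟨.ite, [c], [t, f]⟩ => .ite c t f
  | ⟨.seq, [a], [b]⟩ => .seq a b
  | ⟨.whl, _, [c, b]⟩ => .whl c b
  | ⟨.label l, [c], _⟩ => .label l c
  | ⟨.brk l, [c], _⟩ => .brk l c
  | ⟨.tryc x, [c], [h]⟩ => .tryc c x h
  | ⟨.tryf, [c], [f]⟩ => .tryf c f
  | ⟨.throw, [c], _⟩ => .throw c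
  | ⟨.prim op, as, _⟩ => .prim op as
  | _ => .const .undef

theorem Term.parts_inj [Term S T] {t u : T} {p : Parts S T} (ht : parts t = some p)
    (hu : parts u = some p) : t = u :=
  (parts_eq_some_iff.1 ht).2.symm.trans (parts_eq_some_iff.1 hu).2

theorem Expr.parts_eq_some_iff {e : Expr S} {p : Parts S (Expr S)} :
    e.parts = some p ↔ p.Fits ∧ Expr.ofParts p = e := by
  constructor
  · intro h
    cases e <;> cases h <;> simp [Parts.Fits, Head.Arity, Expr.ofParts, List.zip_map']
  · obtain ⟨h, as, ds⟩ := p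
    rintro ⟨hfits, rfl⟩
    cases h <;> simp only [Parts.Fits, Head.Arity, List.length_eq_zero_iff, List.length_eq_one_iff,
      List.length_eq_two, List.length_eq_three, List.length_pos_iff_exists_cons] at hfits
    case record => simp [Expr.ofParts, Expr.parts, List.map_fst_zip, List.map_snd_zip, hfits]
    case prim => subst hfits; rfl
    case whl => obtain ⟨rfl, _, _, rfl⟩ := hfits; rfl
    case ite => obtain ⟨⟨_, rfl⟩, _, _, rfl⟩ := hfits; rfl
    case put => obtain ⟨⟨_, _, _, rfl⟩, rfl⟩ := hfits; rfl
    case get | del | assign | app => obtain ⟨⟨_, _, rfl⟩, rfl⟩ := hfits; rfl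
    case letin | seq | tryc | tryf => obtain ⟨⟨_, rfl⟩, _, rfl⟩ := hfits; rfl
    all_goals obtain ⟨⟨_, rfl⟩, rfl⟩ := hfits; rfl

theorem Expr.isValue_iff_of_parts {e : Expr S} {p : Parts S (Expr S)} (h : e.parts = some p) :
    e.IsValue ↔ p.head.IsRecord ∧ ∀ v ∈ p.strict, v.IsValue := by
  constructor
  · rintro (_ | _ | ⟨fs, hfs⟩) <;> cases h
    exact ⟨trivial, List.forall_mem_map.2 hfs⟩
  · cases e <;> cases h <;> simp only [Head.IsRecord, false_and, false_implies, true_and]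
    exact fun hfs => .record _ (List.forall_mem_map.1 hfs)

instance : Term S (Expr S) where
  parts := Expr.parts
  ofParts := Expr.ofParts
  IsValue := Expr.IsValue
  parts_eq_some_iff := Expr.parts_eq_some_iff
  isValue_iff_of_parts := Expr.isValue_iff_of_parts

theorem Clo.parts_eq_some_iff {c : Clo S} {p : Parts S (Clo S)} :
    c.parts = some p ↔ p.Fits ∧ Clo.ofParts p = c := by
  constructor
  · intro h
    cases c <;> cases h <;> simp [Parts.Fits, Head.Arity, Clo.ofParts, List.zip_map']
  · obtain ⟨h, as, ds⟩ := p
    rintro ⟨hfits, rfl⟩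
    cases h <;> simp only [Parts.Fits, Head.Arity, List.length_eq_zero_iff, List.length_eq_one_iff,
      List.length_eq_two, List.length_eq_three, List.length_pos_iff_exists_cons] at hfits
    case record => simp [Clo.ofParts, Clo.parts, List.map_fst_zip, List.map_snd_zip, hfits]
    case prim => subst hfits; rfl
    case whl => obtain ⟨rfl, _, _, rfl⟩ := hfits; rfl
    case ite => obtain ⟨⟨_, rfl⟩, _, _, rfl⟩ := hfits; rfl
    case put => obtain ⟨⟨_, _, _, rfl⟩, rfl⟩ := hfits; rfl
    case get | del | assign | app => obtain ⟨⟨_, _, rfl⟩, rfl⟩ := hfits; rfl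
    case letin | seq | tryc | tryf => obtain ⟨⟨_, rfl⟩, _, rfl⟩ := hfits; rfl
    all_goals obtain ⟨⟨_, rfl⟩, rfl⟩ := hfits; rfl

theorem Clo.isValue_iff_of_parts {c : Clo S} {p : Parts S (Clo S)} (h : c.parts = some p) :
    c.IsValue ↔ p.head.IsRecord ∧ ∀ v ∈ p.strict, v.IsValue := by
  constructor
  · rintro (_ | _ | ⟨fs, hfs⟩) <;> cases h
    exact ⟨trivial, List.forall_mem_map.2 hfs⟩
  · cases c <;> cases h <;> simp only [Head.IsRecord, false_and, false_implies, true_and]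
    exact fun hfs => .record _ (List.forall_mem_map.1 hfs)

instance : Term S (Clo S) where
  parts := Clo.parts
  ofParts := Clo.ofParts
  IsValue := Clo.IsValue
  parts_eq_some_iff := Clo.parts_eq_some_iff
  isValue_iff_of_parts := Clo.isValue_iff_of_parts

end Compound

/-! ## Contexts -/

section Contexts

variable {S : Domains} {T : Type} [Term S T]

open Term

/-- A compound term with a hole at a strict position, all strict subterms to the left of the hole
being values. -/
@[ext]
structure Frame (T : Type) {S : Domains} [Term S T] : Type where
  head : Head S
  before : List T
  after : List T
  delayed : List T
  isValue_before : ∀ v ∈ before, IsValue v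
  arity : head.Arity (before.length + after.length + 1) delayed.length

namespace Frame

/-- Fills the hole of a frame. -/
def plug (f : Frame T) (t : T) : T := ofParts ⟨f.head, f.before ++ t :: f.after, f.delayed⟩

theorem parts_plug (f : Frame T) (t : T) :
    parts (f.plug t) = some ⟨f.head, f.before ++ t :: f.after, f.delayed⟩ :=
  parts_eq_some_iff.2 ⟨by simpa [Parts.Fits, add_assoc] using f.arity, rfl⟩

theorem exists_plug_eq {t : T} {h : Head S} {vs as ds : List T} {a : T}
    (ht : parts t = some ⟨h, vs ++ a :: as, ds⟩) (hvs : ∀ v ∈ vs, IsValue v) :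
    ∃ f : Frame T, f.head = h ∧ f.before = vs ∧ f.after = as ∧ f.delayed = ds ∧ f.plug a = t := by
  obtain ⟨hfits, rfl⟩ := parts_eq_some_iff.1 ht
  exact ⟨⟨h, vs, as, ds, hvs, by simpa [Parts.Fits, add_assoc] using hfits⟩, rfl, rfl, rfl, rfl,
    rfl⟩

theorem plug_eq_of_not_isLocal {f : Frame T} (hf : ¬ f.head.IsLocal) :
    (∃ l, f.head = .label l ∧ f.plug = fun t => ofParts ⟨.label l, [t], []⟩) ∨
    (∃ x h, f.head = .tryc x ∧ f.plug = fun t => ofParts ⟨.tryc x, [t], [h]⟩) ∨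
    ∃ g, f.head = .tryf ∧ f.plug = fun t => ofParts ⟨.tryf, [t], [g]⟩ := by
  obtain ⟨h, vs, as, ds, hvs, harity⟩ := f
  have hfits := harity
  cases h <;> first | exact absurd trivial hf | skip
  all_goals
    simp only [Head.Arity, Nat.add_eq_right, Nat.add_eq_zero_iff, List.length_eq_zero_iff,
      List.length_eq_one_iff] at hfits
  case label l => obtain ⟨⟨rfl, rfl⟩, rfl⟩ := hfits; exact .inl ⟨l, rfl, rfl⟩
  case tryc x => obtain ⟨⟨rfl, rfl⟩, h, rfl⟩ := hfits; exact .inr (.inl ⟨x, h, rfl, rfl⟩)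
  case tryf => obtain ⟨⟨rfl, rfl⟩, g, rfl⟩ := hfits; exact .inr (.inr ⟨g, rfl, rfl⟩)

end Frame

/-- Fills the hole of a nest of frames, of which the first one is outermost. -/
def plug (K : List (Frame T)) (t : T) : T := K.foldr Frame.plug t

theorem plug_append (K L : List (Frame T)) (t : T) : plug (K ++ L) t = plug K (plug L t) :=
  List.foldr_append

theorem not_isValue_plug {K : List (Frame T)} {t : T} (ht : ¬ IsValue t) :
    ¬ IsValue (plug K t) := by
  induction K with
  | nil => exact ht
  | cons f K ih =>
    intro h
    exact ih (((isValue_iff_of_parts (f.parts_plug _)).1 h).2 _ (List.mem_append_cons_self))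

/-- A term that does not decompose further: no value, while all its strict subterms are values. -/
def IsCore (t : T) : Prop :=
  ¬ IsValue t ∧ ∀ p ∈ parts t, ∀ v ∈ p.strict, IsValue v

theorem exists_eq_append_cons_of_length_eq {α : Type*} {l : List α} {m n : ℕ}
    (h : m + n + 1 = l.length) : ∃ l₁ a l₂, l = l₁ ++ a :: l₂ ∧ l₁.length = m :=
  ⟨l.take m, l[m], l.drop (m + 1), by simp, by simp; lia⟩

theorem append_cons_inj_of_first_not {α : Type*} {P : α → Prop} {l₁ l₂ r₁ r₂ : List α} {a₁ a₂ : α}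
    (h : l₁ ++ a₁ :: r₁ = l₂ ++ a₂ :: r₂) (hl₁ : ∀ x ∈ l₁, P x) (ha₁ : ¬ P a₁)
    (hl₂ : ∀ x ∈ l₂, P x) (ha₂ : ¬ P a₂) : l₁ = l₂ ∧ a₁ = a₂ ∧ r₁ = r₂ := by
  induction l₁ generalizing l₂ with
  | nil => cases l₂ <;> simp_all
  | cons x l₁ ih => cases l₂ <;> grind

theorem Frame.plug_inj {f g : Frame T} {t u : T} (h : f.plug t = g.plug u) (ht : ¬ IsValue t)
    (hu : ¬ IsValue u) : f = g ∧ t = u := by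
  have hparts := f.parts_plug t
  rw [h, g.parts_plug] at hparts
  simp only [Option.some.injEq, Parts.mk.injEq] at hparts
  obtain ⟨hhead, hstrict, hdelayed⟩ := hparts
  obtain ⟨hbefore, rfl, hafter⟩ :=
    append_cons_inj_of_first_not hstrict g.isValue_before hu f.isValue_before ht
  exact ⟨Frame.ext hhead.symm hbefore.symm hafter.symm hdelayed.symm, rfl⟩

theorem IsCore.ne_plug {f : Frame T} {t u : T} (ht : IsCore t) (hu : ¬ IsValue u) :
    t ≠ f.plug u := by
  rintro rfl
  exact hu (ht.2 _ (f.parts_plug u) u (by simp))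

theorem IsCore.plug_inj {K L : List (Frame T)} {t u : T} (ht : IsCore t) (hu : IsCore u)
    (h : plug K t = plug L u) : K = L ∧ t = u := by
  induction K generalizing L with
  | nil =>
    cases L with
    | nil => exact ⟨rfl, h⟩
    | cons g L => exact absurd h (ht.ne_plug (not_isValue_plug hu.1))
  | cons f K ih =>
    cases L with
    | nil => exact absurd h.symm (hu.ne_plug (not_isValue_plug ht.1))
    | cons g L =>
      obtain ⟨rfl, h'⟩ := Frame.plug_inj h (not_isValue_plug ht.1) (not_isValue_plug hu.1)
      obtain ⟨rfl, rfl⟩ := ih h'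
      exact ⟨rfl, rfl⟩

/-- Contexts whose hole is under operators from `P` only; the context grammars of both calculi are
of this form. -/
def IsCtx (P : Head S → Prop) (E : T → T) : Prop :=
  ∃ K : List (Frame T), (∀ f ∈ K, P f.head) ∧ E = plug K

namespace IsCtx

variable {P Q : Head S → Prop} {E E' : T → T}

theorem hole : IsCtx P (fun t : T => t) := ⟨[], by simp, rfl⟩

theorem mono (hPQ : ∀ h, P h → Q h) : IsCtx P E → IsCtx Q E := by
  rintro ⟨K, hK, rfl⟩
  exact ⟨K, fun f hf => hPQ _ (hK f hf), rfl⟩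

theorem comp : IsCtx P E → IsCtx P E' → IsCtx P (fun t => E (E' t)) := by
  rintro ⟨K, hK, rfl⟩ ⟨L, hL, rfl⟩
  refine ⟨K ++ L, fun f hf => (List.mem_append.1 hf).elim (hK f) (hL f), ?_⟩
  exact funext fun t => (plug_append K L t).symm

theorem cons (hE : IsCtx P E) (h : Head S) (vs as ds : List T) (hh : P h := by trivial)
    (hvs : ∀ v ∈ vs, IsValue v := by simp)
    (harity : h.Arity (vs.length + as.length + 1) ds.length := by simp [Head.Arity]) :
    IsCtx P (fun t => ofParts ⟨h, vs ++ E t :: as, ds⟩) := by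
  obtain ⟨K, hK, rfl⟩ := hE
  exact ⟨⟨h, vs, as, ds, hvs, harity⟩ :: K, by simpa using ⟨hh, hK⟩, rfl⟩

theorem plug_frame {f : Frame T} (hf : P f.head) (hE : IsCtx P E) :
    IsCtx P (fun t => f.plug (E t)) :=
  hE.cons f.head f.before f.after f.delayed hf f.isValue_before f.arity

@[elab_as_elim]
theorem induction {motive : ∀ E : T → T, IsCtx P E → Prop} (hole : motive (fun t => t) hole)
    (plug : ∀ {f : Frame T} {E : T → T} (hf : P f.head) (hE : IsCtx P E), motive E hE →
      motive (fun t => f.plug (E t)) (hE.plug_frame hf)) {E : T → T} (hE : IsCtx P E) :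
    motive E hE := by
  obtain ⟨K, hK, rfl⟩ := hE
  induction K with
  | nil => exact hole
  | cons f K ih =>
    obtain ⟨hf, hK⟩ := List.forall_mem_cons.1 hK
    exact plug hf ⟨K, hK, rfl⟩ (ih hK)

end IsCtx

end Contexts

section Signals

variable {S : Domains} {T : Type} [Term S T]

/-- What interrupts an evaluation: an exception, or a break to a label. -/
inductive Signal (S : Domains) : Type
  | throw
  | brk (l : S.Label)

/-- The operator that raises a signal. -/
def Signal.head : Signal S → Head S
  | .throw => .throw
  | .brk l => .brk l

/-- The operators that the `λ_JS` rules for a signal skip, giving rise to the contexts `F` (for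
exceptions) and `G` (for breaks). -/
def Signal.Passes : Signal S → Head S → Prop
  | .throw, .label _ => True
  | .brk _, .tryc _ => True
  | _, h => h.IsLocal

/-- The redex that raises a signal with a given operand. -/
def Signal.raised (s : Signal S) (v : T) : T := Term.ofParts ⟨s.head, [v], []⟩

theorem Head.IsLocal.passes {h : Head S} (hh : h.IsLocal) (s : Signal S) : s.Passes h := by
  cases s <;> cases h <;> trivial

end Signals

section ContextGrammars

variable {S : Domains}

namespace JS

theorem LocalCtx.isCtx {C : Expr S → Expr S} (hC : LocalCtx C) :
    IsCtx Head.IsLocal C := by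
  induction hC with
  | hole => exact .hole
  | letin x b _ ih => exact ih.cons (.letin x) [] [] [b]
  | appFun as _ ih => exact ih.cons .app [] as []
  | appArg f vs es hf hvs _ ih =>
    exact ih.cons .app (f :: vs) es [] (hvs := List.forall_mem_cons.2 ⟨hf, hvs⟩)
  | @record C fs s gs hfs _ ih =>
    convert ih.cons (.record ((fs ++ (s, C (.const .undef)) :: gs).map Prod.fst))
      (fs.map Prod.snd) (gs.map Prod.snd) [] (hvs := List.forall_mem_map.2 hfs)
      (harity := by simp [Head.Arity, add_assoc]) using 2
    simp [Term.ofParts, Expr.ofParts, List.zip_append, List.zip_map']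
  | prim op vs es hvs _ ih => exact ih.cons (.prim op) vs es [] (hvs := hvs)
  | getObj k _ ih => exact ih.cons .get [] [k] []
  | getKey o ho _ ih => exact ih.cons .get [o] [] [] (hvs := List.forall_mem_singleton.2 ho)
  | putObj k e _ ih => exact ih.cons .put [] [k, e] []
  | putKey o e ho _ ih => exact ih.cons .put [o] [e] [] (hvs := List.forall_mem_singleton.2 ho)
  | putVal o k ho hk _ ih =>
    exact ih.cons .put [o, k] [] []
      (hvs := List.forall_mem_cons.2 ⟨ho, List.forall_mem_singleton.2 hk⟩)
  | delObj k _ ih => exact ih.cons .del [] [k] []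
  | delKey o ho _ ih => exact ih.cons .del [o] [] [] (hvs := List.forall_mem_singleton.2 ho)
  | alloc _ ih => exact ih.cons .alloc [] [] []
  | deref _ ih => exact ih.cons .deref [] [] []
  | assignLoc e _ ih => exact ih.cons .assign [] [e] []
  | assignVal l hl _ ih => exact ih.cons .assign [l] [] [] (hvs := List.forall_mem_singleton.2 hl)
  | ite a b _ ih => exact ih.cons .ite [] [] [a, b]
  | seq e _ ih => exact ih.cons .seq [] [] [e]
  | throw _ ih => exact ih.cons .throw [] [] []
  | brk l _ ih => exact ih.cons (.brk l) [] [] []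

theorem LocalCtx.plug_frame {f : Frame (Expr S)} (hf : f.head.IsLocal) {C : Expr S → Expr S}
    (hC : LocalCtx C) : LocalCtx (fun t => f.plug (C t)) := by
  obtain ⟨h, vs, as, ds, hvs, harity⟩ := f
  have hfits := harity
  cases h <;> try exact hf.elim
  all_goals
    simp only [Head.Arity, Nat.add_eq_right, Nat.reduceEqDiff, Nat.add_one_ne_zero, false_and]
      at hfits
    try simp only [Nat.add_eq_zero_iff, Nat.add_eq_one_iff, Nat.add_eq_two_iff,
      List.length_eq_zero_iff, List.length_eq_one_iff, List.length_eq_two] at hfits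
  case record ss =>
    obtain ⟨hlen, -⟩ := hfits
    obtain ⟨ss₁, s, ss₂, rfl, hlen₁⟩ := exists_eq_append_cons_of_length_eq hlen
    convert hC.record (ss₁.zip vs) s (ss₂.zip as) (fun p hp => hvs _ (List.of_mem_zip hp).2)
    simp [Frame.plug, Term.ofParts, Expr.ofParts, List.zip_append, hlen₁]
  case app =>
    cases vs with
    | nil => exact hC.appFun as
    | cons f vs => exact hC.appArg f vs as (hvs f (by simp)) fun v hv => hvs v (by simp [hv])
  case prim op => exact hC.prim op vs as hvs
  case letin x => obtain ⟨⟨rfl, rfl⟩, b, rfl⟩ := hfits; exact hC.letin x b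
  case seq => obtain ⟨⟨rfl, rfl⟩, b, rfl⟩ := hfits; exact hC.seq b
  case ite => obtain ⟨⟨rfl, rfl⟩, a, b, rfl⟩ := hfits; exact hC.ite a b
  case alloc => obtain ⟨⟨rfl, rfl⟩, rfl⟩ := hfits; exact hC.alloc
  case deref => obtain ⟨⟨rfl, rfl⟩, rfl⟩ := hfits; exact hC.deref
  case brk l => obtain ⟨⟨rfl, rfl⟩, rfl⟩ := hfits; exact hC.brk l
  case throw => obtain ⟨⟨rfl, rfl⟩, rfl⟩ := hfits; exact hC.throw
  case get =>
    obtain ⟨⟨rfl, k, rfl⟩ | ⟨⟨o, rfl⟩, rfl⟩, rfl⟩ := hfits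
    exacts [hC.getObj k, hC.getKey o (hvs o (by simp))]
  case del =>
    obtain ⟨⟨rfl, k, rfl⟩ | ⟨⟨o, rfl⟩, rfl⟩, rfl⟩ := hfits
    exacts [hC.delObj k, hC.delKey o (hvs o (by simp))]
  case assign =>
    obtain ⟨⟨rfl, e, rfl⟩ | ⟨⟨l, rfl⟩, rfl⟩, rfl⟩ := hfits
    exacts [hC.assignLoc e, hC.assignVal l (hvs l (by simp))]
  case put =>
    obtain ⟨⟨rfl, k, e, rfl⟩ | ⟨⟨o, rfl⟩, e, rfl⟩ | ⟨⟨o, k, rfl⟩, rfl⟩, rfl⟩ := hfits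
    exacts [hC.putObj k e, hC.putKey o e (hvs o (by simp)),
      hC.putVal o k (hvs o (by simp)) (hvs k (by simp))]

theorem ControlCtx.isCtx {D : Expr S → Expr S} (hD : ControlCtx D) :
    IsCtx (fun _ => True) D := by
  induction hD with
  | hole => exact .hole
  | tryf f hC _ ih => exact ((hC.isCtx.mono fun _ _ => trivial).comp ih).cons .tryf [] [] [f]
  | label l hC _ ih => exact ((hC.isCtx.mono fun _ _ => trivial).comp ih).cons (.label l) [] [] []
  | tryc x h hC _ ih => exact ((hC.isCtx.mono fun _ _ => trivial).comp ih).cons (.tryc x) [] [] [h]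

theorem localCtx_iff {C : Expr S → Expr S} : LocalCtx C ↔ IsCtx Head.IsLocal C :=
  ⟨LocalCtx.isCtx, IsCtx.induction .hole fun hf _ hC => hC.plug_frame hf⟩

theorem EvalCtx.plug_frame {E : Expr S → Expr S} (hE : EvalCtx E) (f : Frame (Expr S)) :
    EvalCtx (fun t => f.plug (E t)) := by
  obtain @⟨C, D, hC, hD⟩ := hE
  by_cases hf : f.head.IsLocal
  · exact .mk (C := fun t => f.plug (C t)) (hC.plug_frame hf) hD
  · obtain ⟨l, -, hf⟩ | ⟨x, h, -, hf⟩ | ⟨g, -, hf⟩ := Frame.plug_eq_of_not_isLocal hf <;> rw [hf]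
    · exact .mk (C := fun t => t) .hole (.label l hC hD)
    · exact .mk .hole (.tryc x h hC hD)
    · exact .mk .hole (.tryf g hC hD)

theorem EvalCtx.isCtx {E : Expr S → Expr S} (hE : EvalCtx E) : IsCtx (fun _ => True) E := by
  obtain ⟨hC, hD⟩ := hE
  exact (hC.isCtx.mono fun _ _ => trivial).comp hD.isCtx

theorem evalCtx_iff {E : Expr S → Expr S} : EvalCtx E ↔ IsCtx (fun _ => True) E :=
  ⟨EvalCtx.isCtx, IsCtx.induction (.mk .hole .hole) fun _ _ hE => hE.plug_frame _⟩

theorem LabelCtx.isCtx {F : Expr S → Expr S} (hF : LabelCtx F) :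
    IsCtx Signal.throw.Passes F := by
  induction hF with
  | loc hC => exact hC.isCtx.mono fun _ hh => hh.passes _
  | label l hC _ ih =>
    exact (hC.isCtx.mono fun _ hh => hh.passes _).comp (ih.cons (.label l) [] [] [])

theorem LabelCtx.plug_frame {f : Frame (Expr S)} (hf : Signal.throw.Passes f.head)
    {F : Expr S → Expr S} (hF : LabelCtx F) : LabelCtx (fun t => f.plug (F t)) := by
  by_cases hloc : f.head.IsLocal
  · cases hF with
    | loc hC => exact .loc (hC.plug_frame hloc)
    | @label C _ l hC hF => exact .label (C := fun t => f.plug (C t)) l (hC.plug_frame hloc) hF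
  · obtain ⟨l, -, hfl⟩ | ⟨x, h, hx, -⟩ | ⟨g, hg, -⟩ := Frame.plug_eq_of_not_isLocal hloc
    · rw [hfl]; exact .label l .hole hF
    · rw [hx] at hf; exact hf.elim
    · rw [hg] at hf; exact hf.elim

theorem labelCtx_iff {F : Expr S → Expr S} :
    LabelCtx F ↔ IsCtx Signal.throw.Passes F :=
  ⟨LabelCtx.isCtx, IsCtx.induction (.loc .hole) fun hf _ hF => hF.plug_frame hf⟩

theorem HandlerCtx.isCtx {G : Expr S → Expr S} (hG : HandlerCtx G) (l : S.Label) :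
    IsCtx (Signal.brk l).Passes G := by
  induction hG with
  | loc hC => exact hC.isCtx.mono fun _ hh => hh.passes _
  | tryc x h hC _ ih =>
    exact (hC.isCtx.mono fun _ hh => hh.passes _).comp (ih.cons (.tryc x) [] [] [h])

theorem HandlerCtx.plug_frame {f : Frame (Expr S)} {l : S.Label}
    (hf : (Signal.brk l).Passes f.head) {G : Expr S → Expr S} (hG : HandlerCtx G) :
    HandlerCtx (fun t => f.plug (G t)) := by
  by_cases hloc : f.head.IsLocal
  · cases hG with
    | loc hC => exact .loc (hC.plug_frame hloc)
    | @tryc C _ x h hC hG => exact .tryc (C := fun t => f.plug (C t)) x h (hC.plug_frame hloc) hG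
  · obtain ⟨l', hl, -⟩ | ⟨x, h, -, hfx⟩ | ⟨g, hg, -⟩ := Frame.plug_eq_of_not_isLocal hloc
    · rw [hl] at hf; exact hf.elim
    · rw [hfx]; exact .tryc x h .hole hG
    · rw [hg] at hf; exact hf.elim

theorem handlerCtx_iff {G : Expr S → Expr S} (l : S.Label) :
    HandlerCtx G ↔ IsCtx (Signal.brk l).Passes G :=
  ⟨fun h => h.isCtx l, IsCtx.induction (.loc .hole) fun hf _ hG => hG.plug_frame hf⟩

end JS

namespace Rho

theorem LocalCtx.isCtx {C : Clo S → Clo S} (hC : LocalCtx C) :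
    IsCtx Head.IsLocal C := by
  induction hC with
  | hole => exact .hole
  | letin x b _ ih => exact ih.cons (.letin x) [] [] [b]
  | appFun as _ ih => exact ih.cons .app [] as []
  | appArg f vs es hf hvs _ ih =>
    exact ih.cons .app (f :: vs) es [] (hvs := List.forall_mem_cons.2 ⟨hf, hvs⟩)
  | @record C fs s gs hfs _ ih =>
    convert ih.cons (.record ((fs ++ (s, C (.const .undef)) :: gs).map Prod.fst))
      (fs.map Prod.snd) (gs.map Prod.snd) [] (hvs := List.forall_mem_map.2 hfs)
      (harity := by simp [Head.Arity, add_assoc]) using 2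
    simp [Term.ofParts, Clo.ofParts, List.zip_append, List.zip_map']
  | prim op vs es hvs _ ih => exact ih.cons (.prim op) vs es [] (hvs := hvs)
  | getObj k _ ih => exact ih.cons .get [] [k] []
  | getKey o ho _ ih => exact ih.cons .get [o] [] [] (hvs := List.forall_mem_singleton.2 ho)
  | putObj k e _ ih => exact ih.cons .put [] [k, e] []
  | putKey o e ho _ ih => exact ih.cons .put [o] [e] [] (hvs := List.forall_mem_singleton.2 ho)
  | putVal o k ho hk _ ih =>
    exact ih.cons .put [o, k] [] []
      (hvs := List.forall_mem_cons.2 ⟨ho, List.forall_mem_singleton.2 hk⟩)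
  | delObj k _ ih => exact ih.cons .del [] [k] []
  | delKey o ho _ ih => exact ih.cons .del [o] [] [] (hvs := List.forall_mem_singleton.2 ho)
  | alloc _ ih => exact ih.cons .alloc [] [] []
  | deref _ ih => exact ih.cons .deref [] [] []
  | assignLoc e _ ih => exact ih.cons .assign [] [e] []
  | assignVal l hl _ ih => exact ih.cons .assign [l] [] [] (hvs := List.forall_mem_singleton.2 hl)
  | ite a b _ ih => exact ih.cons .ite [] [] [a, b]
  | seq e _ ih => exact ih.cons .seq [] [] [e]
  | throw _ ih => exact ih.cons .throw [] [] []
  | brk l _ ih => exact ih.cons (.brk l) [] [] []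

theorem LocalCtx.plug_frame {f : Frame (Clo S)} (hf : f.head.IsLocal) {C : Clo S → Clo S}
    (hC : LocalCtx C) : LocalCtx (fun t => f.plug (C t)) := by
  obtain ⟨h, vs, as, ds, hvs, harity⟩ := f
  have hfits := harity
  cases h <;> try exact hf.elim
  all_goals
    simp only [Head.Arity, Nat.add_eq_right, Nat.reduceEqDiff, Nat.add_one_ne_zero, false_and]
      at hfits
    try simp only [Nat.add_eq_zero_iff, Nat.add_eq_one_iff, Nat.add_eq_two_iff,
      List.length_eq_zero_iff, List.length_eq_one_iff, List.length_eq_two] at hfits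
  case record ss =>
    obtain ⟨hlen, -⟩ := hfits
    obtain ⟨ss₁, s, ss₂, rfl, hlen₁⟩ := exists_eq_append_cons_of_length_eq hlen
    convert hC.record (ss₁.zip vs) s (ss₂.zip as) (fun p hp => hvs _ (List.of_mem_zip hp).2)
    simp [Frame.plug, Term.ofParts, Clo.ofParts, List.zip_append, hlen₁]
  case app =>
    cases vs with
    | nil => exact hC.appFun as
    | cons f vs => exact hC.appArg f vs as (hvs f (by simp)) fun v hv => hvs v (by simp [hv])
  case prim op => exact hC.prim op vs as hvs
  case letin x => obtain ⟨⟨rfl, rfl⟩, b, rfl⟩ := hfits; exact hC.letin x b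
  case seq => obtain ⟨⟨rfl, rfl⟩, b, rfl⟩ := hfits; exact hC.seq b
  case ite => obtain ⟨⟨rfl, rfl⟩, a, b, rfl⟩ := hfits; exact hC.ite a b
  case alloc => obtain ⟨⟨rfl, rfl⟩, rfl⟩ := hfits; exact hC.alloc
  case deref => obtain ⟨⟨rfl, rfl⟩, rfl⟩ := hfits; exact hC.deref
  case brk l => obtain ⟨⟨rfl, rfl⟩, rfl⟩ := hfits; exact hC.brk l
  case throw => obtain ⟨⟨rfl, rfl⟩, rfl⟩ := hfits; exact hC.throw
  case get =>
    obtain ⟨⟨rfl, k, rfl⟩ | ⟨⟨o, rfl⟩, rfl⟩, rfl⟩ := hfits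
    exacts [hC.getObj k, hC.getKey o (hvs o (by simp))]
  case del =>
    obtain ⟨⟨rfl, k, rfl⟩ | ⟨⟨o, rfl⟩, rfl⟩, rfl⟩ := hfits
    exacts [hC.delObj k, hC.delKey o (hvs o (by simp))]
  case assign =>
    obtain ⟨⟨rfl, e, rfl⟩ | ⟨⟨l, rfl⟩, rfl⟩, rfl⟩ := hfits
    exacts [hC.assignLoc e, hC.assignVal l (hvs l (by simp))]
  case put =>
    obtain ⟨⟨rfl, k, e, rfl⟩ | ⟨⟨o, rfl⟩, e, rfl⟩ | ⟨⟨o, k, rfl⟩, rfl⟩, rfl⟩ := hfits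
    exacts [hC.putObj k e, hC.putKey o e (hvs o (by simp)),
      hC.putVal o k (hvs o (by simp)) (hvs k (by simp))]

theorem ControlCtx.isCtx {D : Clo S → Clo S} (hD : ControlCtx D) :
    IsCtx (fun _ => True) D := by
  induction hD with
  | hole => exact .hole
  | tryf f hC _ ih => exact ((hC.isCtx.mono fun _ _ => trivial).comp ih).cons .tryf [] [] [f]
  | label l hC _ ih => exact ((hC.isCtx.mono fun _ _ => trivial).comp ih).cons (.label l) [] [] []
  | tryc x h hC _ ih => exact ((hC.isCtx.mono fun _ _ => trivial).comp ih).cons (.tryc x) [] [] [h]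

theorem localCtx_iff {C : Clo S → Clo S} : LocalCtx C ↔ IsCtx Head.IsLocal C :=
  ⟨LocalCtx.isCtx, IsCtx.induction .hole fun hf _ hC => hC.plug_frame hf⟩

theorem EvalCtx.plug_frame {E : Clo S → Clo S} (hE : EvalCtx E) (f : Frame (Clo S)) :
    EvalCtx (fun t => f.plug (E t)) := by
  obtain @⟨C, D, hC, hD⟩ := hE
  by_cases hf : f.head.IsLocal
  · exact .mk (C := fun t => f.plug (C t)) (hC.plug_frame hf) hD
  · obtain ⟨l, -, hf⟩ | ⟨x, h, -, hf⟩ | ⟨g, -, hf⟩ := Frame.plug_eq_of_not_isLocal hf <;> rw [hf]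
    · exact .mk (C := fun t => t) .hole (.label l hC hD)
    · exact .mk .hole (.tryc x h hC hD)
    · exact .mk .hole (.tryf g hC hD)

theorem EvalCtx.isCtx {E : Clo S → Clo S} (hE : EvalCtx E) : IsCtx (fun _ => True) E := by
  obtain ⟨hC, hD⟩ := hE
  exact (hC.isCtx.mono fun _ _ => trivial).comp hD.isCtx

theorem evalCtx_iff {E : Clo S → Clo S} : EvalCtx E ↔ IsCtx (fun _ => True) E :=
  ⟨EvalCtx.isCtx, IsCtx.induction (.mk .hole .hole) fun _ _ hE => hE.plug_frame _⟩

end Rho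

end ContextGrammars

/-! ## Free variables and substitution -/

section Substitution

variable {S : Domains}

theorem Expr.sizeOf_lt_of_mem_parts {e a : Expr S} {p : Parts S (Expr S)} (h : e.parts = some p)
    (ha : a ∈ p.strict ∨ a ∈ p.delayed) : sizeOf a < sizeOf e := by
  have fields {fs : List (S.Str × Expr S)} (ha : a ∈ fs.map Prod.snd) : sizeOf a < sizeOf fs := by
    obtain ⟨⟨s, _⟩, hmem, rfl⟩ := List.mem_map.1 ha
    have := List.sizeOf_lt_of_mem hmem
    simp only [Prod.mk.sizeOf_spec] at this
    lia
  have args {as : List (Expr S)} (ha : a ∈ as) : sizeOf a < sizeOf as := List.sizeOf_lt_of_mem ha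
  cases e <;> cases h <;>
    simp only [List.mem_cons, List.not_mem_nil, or_false, false_or] at ha <;> grind

theorem Expr.parts_induction {motive : Expr S → Prop} (var : ∀ x, motive (.var x))
    (const : ∀ k, motive (.const k)) (func : ∀ xs e, motive e → motive (.func xs e))
    (compound : ∀ e p, e.parts = some p → (∀ a ∈ p.strict, motive a) →
      (∀ d ∈ p.delayed, motive d) → motive e) (e : Expr S) : motive e := by
  induction h : sizeOf e using Nat.strong_induction_on generalizing e with
  | _ n ih =>
    subst h
    cases hp : e.parts with
    | some p =>
      exact compound e p hp
        (fun a ha => ih _ (sizeOf_lt_of_mem_parts hp (.inl ha)) a rfl)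
        (fun d hd => ih _ (sizeOf_lt_of_mem_parts hp (.inr hd)) d rfl)
    | none =>
      match e, hp with
      | .var x, _ => exact var x
      | .const k, _ => exact const k
      | .func xs e, _ => exact func xs e (ih _ (by simp) e rfl)

theorem Expr.fvList_eq (es : List (Expr S)) : Expr.fvList es = ⋃ e ∈ es, e.fv := by
  induction es with
  | nil => simp [fvList]
  | cons e es ih => simp [fvList, ih]

theorem Expr.fvFields_eq (fs : List (S.Str × Expr S)) :
    Expr.fvFields fs = ⋃ e ∈ fs.map Prod.snd, e.fv := by
  induction fs with
  | nil => simp [fvFields]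
  | cons p fs ih => simp [fvFields, ih]

theorem Expr.fv_eq_of_parts {e : Expr S} {p : Parts S (Expr S)} (h : e.parts = some p) :
    e.fv = (⋃ a ∈ p.strict, a.fv) ∪ ⋃ d ∈ p.delayed, d.fv \ {x | x ∈ p.head.binder} := by
  cases e <;> cases h <;>
    simp [fv, fvList_eq, fvFields_eq, Head.binder, Set.union_assoc]

theorem Expr.substList_eq (θ : S.Var → Option (Expr S)) (es : List (Expr S)) :
    Expr.substList θ es = es.map (Expr.subst θ) := by
  induction es with
  | nil => rfl
  | cons e es ih => simp [substList, ih]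

theorem Expr.substFields_eq (θ : S.Var → Option (Expr S)) (fs : List (S.Str × Expr S)) :
    Expr.substFields θ fs = fs.map fun p => (p.1, p.2.subst θ) := by
  induction fs with
  | nil => rfl
  | cons p fs ih => simp [substFields, ih]

@[simp]
theorem hide_nil (θ : S.Var → Option (Expr S)) : hide θ [] = θ := by
  funext x
  simp [hide]

theorem Expr.parts_subst {e : Expr S} {p : Parts S (Expr S)} (h : e.parts = some p)
    (θ : S.Var → Option (Expr S)) :
    (e.subst θ).parts = some ⟨p.head, p.strict.map (Expr.subst θ),
      p.delayed.map (Expr.subst (hide θ p.head.binder))⟩ := by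
  cases e <;> cases h <;>
    simp [subst, parts, substList_eq, substFields_eq, Head.binder, Function.comp_def]

theorem Expr.subst_none (e : Expr S) : e.subst (fun _ => none) = e := by
  have hide_none (xs : List S.Var) : hide (fun _ => none (α := Expr S)) xs = fun _ => none := by
    funext x
    simp [hide]
  induction e using Expr.parts_induction with
  | var x => rfl
  | const k => rfl
  | func xs e ih => simp [subst, hide_none, ih]
  | compound e p hp hstrict hdelayed =>
    refine Term.parts_inj ((parts_subst hp _).trans ?_) hp
    rw [hide_none, List.map_congr_left (g := id) hstrict, List.map_congr_left (g := id) hdelayed,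
      List.map_id, List.map_id]

theorem Expr.subst_subst {e : Expr S} {θ η ζ : S.Var → Option (Expr S)}
    (hθ : ∀ x t, θ x = some t → ∀ η', t.subst η' = t)
    (hζ : ∀ x ∈ e.fv, ζ x = (θ x).or (η x)) : (e.subst θ).subst η = e.subst ζ := by
  have hide_or {b : Expr S} {θ η ζ : S.Var → Option (Expr S)} (xs : List S.Var)
      (h : ∀ x ∈ b.fv \ {x | x ∈ xs}, ζ x = (θ x).or (η x)) :
      ∀ x ∈ b.fv, hide ζ xs x = (hide θ xs x).or (hide η xs x) := by
    intro x hx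
    by_cases hxs : x ∈ xs
    · simp [hide, hxs]
    · simpa [hide, hxs] using h x ⟨hx, hxs⟩
  have hide_inv {θ : S.Var → Option (Expr S)} (xs : List S.Var)
      (h : ∀ x t, θ x = some t → ∀ η', t.subst η' = t) :
      ∀ x t, hide θ xs x = some t → ∀ η', t.subst η' = t := by
    intro x t hx
    by_cases hxs : x ∈ xs
    · simp [hide, hxs] at hx
    · exact h x t (by simpa [hide, hxs] using hx)
  induction e using Expr.parts_induction generalizing θ η ζ with
  | var x =>
    have hx := hζ x (by simp [fv])
    cases hθx : θ x with
    | none => simp_all [subst]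
    | some t => simpa [subst, hx, hθx] using hθ x t hθx η
  | const k => rfl
  | func xs e ih =>
    simp only [subst, ih (hide_inv xs hθ) (hide_or xs hζ)]
  | compound e p hp hstrict hdelayed =>
    rw [fv_eq_of_parts hp] at hζ
    refine Term.parts_inj ((parts_subst (parts_subst hp θ) η).trans ?_) (parts_subst hp ζ)
    simp only [List.map_map, Option.some.injEq, Parts.mk.injEq, List.map_inj_left, true_and,
      Function.comp_apply]
    refine ⟨fun a ha => hstrict a ha hθ fun x hx => hζ x ?_, fun d hd => hdelayed d hd
      (hide_inv _ hθ) (hide_or _ fun x hx => hζ x ?_)⟩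
    · exact .inl (Set.mem_biUnion ha hx)
    · exact .inr (Set.mem_biUnion hd hx)

end Substitution

/-! ## Denotation of closures -/

section Denoting

variable {S : Domains}

theorem Clo.forceEnv_eq (ρ : Env S) : Clo.forceEnv ρ = ρ.map fun p => (p.1, p.2.force) := by
  induction ρ with
  | nil => rfl
  | cons p ρ ih => simp [forceEnv, ih]

theorem Clo.forceFields_eq (fs : List (S.Str × Clo S)) :
    Clo.forceFields fs = fs.map fun p => (p.1, p.2.force) := by
  induction fs with
  | nil => rfl
  | cons p fs ih => simp [forceFields, ih]

/-- The substitution that an environment delays. -/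
def Env.subst (ρ : Env S) : S.Var → Option (Expr S) := assoc (Clo.forceEnv ρ)

theorem Env.subst_apply (ρ : Env S) (x : S.Var) : Env.subst ρ x = (ρ.lookup x).map Clo.force := by
  rw [Env.subst, assoc, Clo.forceEnv_eq]
  induction ρ with
  | nil => rfl
  | cons p ρ ih =>
    obtain ⟨y, v⟩ := p
    grind

theorem Env.lookup_eq_none_iff {ρ : Env S} {x : S.Var} : ρ.lookup x = none ↔ ∀ p ∈ ρ, p.1 ≠ x := by
  grind [List.lookup_eq_none_iff]

theorem Env.mem_of_lookup_eq_some {ρ : Env S} {x : S.Var} {v : Clo S} (h : ρ.lookup x = some v) :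
    (x, v) ∈ ρ := by
  obtain ⟨l₁, l₂, rfl, -⟩ := List.lookup_eq_some_iff.1 h
  simp

/-- The environment `ρ` consists of closed values and binds all variables that are free in `e`
apart from `xs`. -/
structure Env.Closes (ρ : Env S) (xs : List S.Var) (e : Expr S) : Prop where
  isClosedValue : ∀ p ∈ ρ, p.2.IsClosedValue
  exists_mem : ∀ x ∈ e.fv, x ∉ xs → ∃ p ∈ ρ, p.1 = x

theorem Clo.IsClosedValue.isValue {v : Clo S} (hv : v.IsClosedValue) : v.IsValue := by
  induction hv with
  | const k => exact .const k
  | func xs e ρ _ _ ih => exact .func xs e ρ ih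
  | record fs _ ih => exact .record fs ih

theorem Clo.isClosedValue_func_iff {xs : List S.Var} {e : Expr S} {ρ : Env S} :
    (Clo.clos (.func xs e) ρ).IsClosedValue ↔ Env.Closes ρ [] (.func xs e) :=
  ⟨fun | .func _ _ _ hdom h => ⟨h, fun x hx _ => hdom x hx⟩,
    fun h => .func xs e ρ (fun x hx => h.exists_mem x hx List.not_mem_nil) h.isClosedValue⟩

theorem Clo.IsClosedValue.subst_force {v : Clo S} (hv : v.IsClosedValue)
    (η : S.Var → Option (Expr S)) : v.force.subst η = v.force := by
  induction hv generalizing η with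
  | const k => rfl
  | func xs e ρ hdom _ ih =>
    refine Expr.subst_subst (fun x t hx η' => ?_) fun x hx => ?_
    · obtain ⟨v, hv, rfl⟩ := Option.map_eq_some_iff.1 ((Env.subst_apply ρ x).symm.trans hx)
      exact ih _ (Env.mem_of_lookup_eq_some hv) η'
    · obtain ⟨p, hp, rfl⟩ := hdom x hx
      change Env.subst ρ p.1 = (Env.subst ρ p.1).or (η p.1)
      cases h : ρ.lookup p.1 with
      | none => exact absurd rfl (Env.lookup_eq_none_iff.1 h p hp)
      | some v => simp [Env.subst_apply, h]
  | record fs _ ih =>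
    simpa [force, forceFields_eq, Expr.subst, Expr.substFields_eq] using
      fun s v hmem => ih (s, v) hmem η

theorem Env.Closes.subst_subst {ρ : Env S} {xs : List S.Var} {e : Expr S} (h : ρ.Closes xs e)
    {η ζ : S.Var → Option (Expr S)} (hζ : ∀ x ∈ e.fv, ζ x = (hide (Env.subst ρ) xs x).or (η x)) :
    (e.subst (hide (Env.subst ρ) xs)).subst η = e.subst ζ := by
  refine Expr.subst_subst (fun x t hx η' => ?_) hζ
  have hx : Env.subst ρ x = some t := by grind [hide]
  obtain ⟨v, hv, rfl⟩ := Option.map_eq_some_iff.1 ((Env.subst_apply ρ x).symm.trans hx)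
  exact (h.isClosedValue _ (Env.mem_of_lookup_eq_some hv)).subst_force η'

/-- `DenotesUnder xs c e`: the closure `c`, which stands in the scope of binders for `xs`,
becomes `e` when all substitutions delayed in it are carried out. Moreover all these substitutions
are by closed values and leave no variable free but `xs`. -/
inductive Clo.DenotesUnder : List S.Var → Clo S → Expr S → Prop
  | const (k : S.Const) : DenotesUnder [] (.const k) (.const k)
  | clos {xs : List S.Var} {e : Expr S} {ρ : Env S} (h : Env.Closes ρ xs e) :
      DenotesUnder xs (.clos e ρ) (e.subst (hide (Env.subst ρ) xs))
  | compound {c : Clo S} {e : Expr S} {p : Parts S (Clo S)} {q : Parts S (Expr S)}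
      (hc : c.parts = some p) (he : e.parts = some q) (hhead : p.head = q.head)
      (hstrict_length : p.strict.length = q.strict.length)
      (hstrict : ∀ r ∈ p.strict.zip q.strict, DenotesUnder [] r.1 r.2)
      (hdelayed_length : p.delayed.length = q.delayed.length)
      (hdelayed : ∀ r ∈ p.delayed.zip q.delayed, DenotesUnder p.head.binder r.1 r.2) :
      DenotesUnder [] c e

/-- The closure `c` becomes the expression `e` when all delayed substitutions are carried out. -/
abbrev Clo.Denotes : Clo S → Expr S → Prop := Clo.DenotesUnder []

/-- Denotation of compound terms, part by part. -/
structure Parts.Denotes (p : Parts S (Clo S)) (q : Parts S (Expr S)) : Prop where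
  head : p.head = q.head
  strict : List.Forall₂ Clo.Denotes p.strict q.strict
  delayed : List.Forall₂ (Clo.DenotesUnder p.head.binder) p.delayed q.delayed

theorem Parts.Denotes.of_parts {p : Parts S (Clo S)} {q : Parts S (Expr S)} (h : p.Denotes q)
    {c : Clo S} {e : Expr S} (hc : c.parts = some p) (he : e.parts = some q) : c.Denotes e :=
  .compound hc he h.head h.strict.length_eq (fun _ hr => (List.forall₂_iff_zip.1 h.strict).2 hr)
    h.delayed.length_eq (fun _ hr => (List.forall₂_iff_zip.1 h.delayed).2 hr)

theorem Clo.Denotes.exists_parts {c : Clo S} {e : Expr S} (h : c.Denotes e)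
    {p : Parts S (Clo S)} (hc : c.parts = some p) : ∃ q, e.parts = some q ∧ p.Denotes q := by
  cases h with
  | const k => cases hc
  | clos h => cases hc
  | compound hc' he hhead hlen hstrict hlen' hdelayed =>
    obtain rfl := Option.some.inj (hc'.symm.trans hc)
    exact ⟨_, he, hhead, List.forall₂_iff_zip.2 ⟨hlen, fun hr => hstrict _ hr⟩,
      List.forall₂_iff_zip.2 ⟨hlen', fun hr => hdelayed _ hr⟩⟩

theorem Clo.denotes_clos_iff {e t : Expr S} {ρ : Env S} :
    (Clo.clos e ρ).Denotes t ↔ Env.Closes ρ [] e ∧ t = e.subst (Env.subst ρ) := by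
  constructor
  · intro h
    cases h with
    | clos h => exact ⟨h, by rw [hide_nil]⟩
    | compound hc => cases hc
  · rintro ⟨h, rfl⟩
    simpa only [hide_nil] using DenotesUnder.clos h

theorem Clo.denotes_const_iff {k : S.Const} {t : Expr S} :
    (Clo.const k).Denotes t ↔ t = .const k := by
  refine ⟨fun h => ?_, fun h => h ▸ .const k⟩
  cases h with
  | const => rfl
  | compound hc => cases hc

theorem Clo.DenotesUnder.bind {xs : List S.Var} {e t : Expr S} {ρ : Env S}
    (h : DenotesUnder xs (.clos e ρ) t) {vs : List (Clo S)} (hvs : ∀ v ∈ vs, v.IsClosedValue)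
    (hlen : xs.length = vs.length) :
    (Clo.clos e (xs.zip vs ++ ρ)).Denotes (t.subst (assoc (xs.zip (vs.map force)))) := by
  have hclosed : Env.Closes ρ xs e ∧ t = e.subst (hide (Env.subst ρ) xs) := by
    cases h with
    | clos h => exact ⟨h, rfl⟩
    | compound hc => cases hc
  obtain ⟨hρ, rfl⟩ := hclosed
  have hmem : ∀ x ∈ xs, ∃ v, (x, v) ∈ xs.zip vs := by
    intro x hx
    obtain ⟨i, hi, rfl⟩ := List.getElem_of_mem hx
    exact ⟨vs[i], List.mem_iff_getElem.2 ⟨i, by simp; lia, by simp⟩⟩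
  refine denotes_clos_iff.2 ⟨⟨fun p hp => ?_, fun x hx _ => ?_⟩, hρ.subst_subst fun x _ => ?_⟩
  · exact (List.mem_append.1 hp).elim (fun h => hvs _ (List.of_mem_zip h).2)
      (hρ.isClosedValue p)
  · by_cases hxs : x ∈ xs
    · obtain ⟨v, hv⟩ := hmem x hxs
      exact ⟨_, List.mem_append_left _ hv, rfl⟩
    · obtain ⟨p, hp, hpx⟩ := hρ.exists_mem x hx hxs
      exact ⟨p, List.mem_append_right _ hp, hpx⟩
  · have hassoc : assoc (xs.zip (vs.map force)) x = ((xs.zip vs).lookup x).map force := by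
      rw [← Env.subst_apply, Env.subst, forceEnv_eq, List.zip_map_right]
      rfl
    simp only [hassoc, hide, Env.subst_apply, List.lookup_append]
    cases hx : (xs.zip vs).lookup x with
    | none =>
      have hxs : x ∉ xs := fun hxs =>
        (hmem x hxs).elim fun _ hv => Env.lookup_eq_none_iff.1 hx _ hv rfl
      simp [hxs]
    | some v =>
      have hxs : x ∈ xs := (List.of_mem_zip (Env.mem_of_lookup_eq_some hx)).1
      simp [hxs]

theorem Clo.IsClosedValue.denotes_force {v : Clo S} (hv : v.IsClosedValue) :
    v.Denotes v.force := by
  induction hv with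
  | const k => exact .const k
  | func xs e ρ hdom h =>
    exact denotes_clos_iff.2 ⟨isClosedValue_func_iff.1 (.func xs e ρ hdom h), rfl⟩
  | record fs _ ih =>
    refine Parts.Denotes.of_parts (c := .record fs) ⟨?_, ?_, .nil⟩ rfl rfl <;>
      simp only [forceFields_eq, List.map_map, List.forall₂_map_left_iff,
        List.forall₂_map_right_iff, List.forall₂_same]
    · rfl
    · exact ih

theorem forall₂_eq_map {α β : Type*} {R : α → β → Prop} {P : α → Prop} {f : α → β} {as : List α}
    {bs : List β} (h : List.Forall₂ R as bs) (hR : ∀ a ∈ as, ∀ b, R a b → P a ∧ b = f a) :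
    (∀ a ∈ as, P a) ∧ bs = as.map f := by
  induction h with
  | nil => simp
  | cons hab _ ih =>
    obtain ⟨ha, has⟩ := List.forall_mem_cons.1 hR
    obtain ⟨hPa, rfl⟩ := ha _ hab
    obtain ⟨hPas, rfl⟩ := ih has
    exact ⟨List.forall_mem_cons.2 ⟨hPa, hPas⟩, rfl⟩

theorem Clo.Denotes.isClosedValue_and_eq {v : Clo S} {w : Expr S} (hv : v.IsValue)
    (h : v.Denotes w) : v.IsClosedValue ∧ w = v.force := by
  induction hv generalizing w with
  | const k => exact ⟨.const k, denotes_const_iff.1 h⟩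
  | func xs e ρ =>
    obtain ⟨hρ, rfl⟩ := denotes_clos_iff.1 h
    exact ⟨isClosedValue_func_iff.2 hρ, rfl⟩
  | record fs _ ih =>
    obtain ⟨⟨_, ws, _⟩, hw, ⟨rfl, hstrict, -⟩⟩ := h.exists_parts rfl
    obtain ⟨hclosed, rfl⟩ := forall₂_eq_map hstrict (List.forall_mem_map.2 fun p hp w => ih p hp)
    obtain ⟨-, rfl⟩ := Expr.parts_eq_some_iff.1 hw
    exact ⟨.record fs (List.forall_mem_map.1 hclosed), by
      simp [Expr.ofParts, force, forceFields_eq, List.zip_map']⟩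

theorem Clo.IsValue.isValue_force {v : Clo S} (hv : v.IsValue) : v.force.IsValue := by
  induction hv with
  | const k => exact .const k
  | func xs e ρ => exact .func xs _
  | record fs _ ih => exact .record _ (by rw [forceFields_eq]; exact List.forall_mem_map.2 ih)

theorem Clo.forall₂_denotes_map_force {vs : List (Clo S)} (hvs : ∀ v ∈ vs, v.IsClosedValue) :
    List.Forall₂ Denotes vs (vs.map force) := by
  simpa using fun v hv => (hvs v hv).denotes_force

theorem Clo.forall₂_denotes_values {vs : List (Clo S)} {ws : List (Expr S)}
    (h : List.Forall₂ Denotes vs ws) (hvs : ∀ v ∈ vs, v.IsValue) :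
    (∀ v ∈ vs, v.IsClosedValue) ∧ ws = vs.map force :=
  forall₂_eq_map h fun v hv _ => Denotes.isClosedValue_and_eq (hvs v hv)

end Denoting

section DenotationOfContexts

variable {S : Domains}

theorem exists_append_of_forall₂_append {α β : Type*} {R : α → β → Prop} {l₁ l₂ : List α}
    {l : List β} (h : List.Forall₂ R (l₁ ++ l₂) l) :
    ∃ m₁ m₂, l = m₁ ++ m₂ ∧ List.Forall₂ R l₁ m₁ ∧ List.Forall₂ R l₂ m₂ :=
  ⟨l.take l₁.length, l.drop l₁.length, (List.take_append_drop _ _).symm,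
    (List.forall₂_take_append l l₁ l₂ h.flip).flip, (List.forall₂_drop_append l l₁ l₂ h.flip).flip⟩

theorem Frame.denotes_plug {f : Frame (Clo S)} {g : Frame (Expr S)} (hhead : f.head = g.head)
    (hbefore : List.Forall₂ Clo.Denotes f.before g.before)
    (hafter : List.Forall₂ Clo.Denotes f.after g.after)
    (hdelayed : List.Forall₂ (Clo.DenotesUnder f.head.binder) f.delayed g.delayed)
    {c : Clo S} {e : Expr S} (h : c.Denotes e) : (f.plug c).Denotes (g.plug e) :=
  Parts.Denotes.of_parts ⟨hhead, List.rel_append hbefore (.cons h hafter), hdelayed⟩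
    (f.parts_plug c) (g.parts_plug e)

theorem Clo.Denotes.exists_plug {f : Frame (Clo S)} {c : Clo S} {t : Expr S}
    (h : (f.plug c).Denotes t) :
    ∃ (g : Frame (Expr S)) (e : Expr S), g.head = f.head ∧ t = g.plug e ∧ c.Denotes e ∧
      ∀ d u, d.Denotes u → (f.plug d).Denotes (g.plug u) := by
  obtain ⟨⟨_, _, _⟩, hq, rfl, hstrict, hdelayed⟩ := h.exists_parts (f.parts_plug c)
  obtain ⟨ws, _, rfl, hbefore, hrest⟩ := exists_append_of_forall₂_append hstrict
  obtain ⟨e, as, hce, hafter, rfl⟩ := List.forall₂_cons_left_iff.1 hrest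
  obtain ⟨hclosed, rfl⟩ := forall₂_denotes_values hbefore f.isValue_before
  obtain ⟨g, hg, hgb, hga, hgd, rfl⟩ := Frame.exists_plug_eq hq
    (List.forall_mem_map (P := Expr.IsValue).2 fun v hv => (hclosed v hv).isValue.isValue_force)
  refine ⟨g, e, hg, rfl, hce, fun d u hdu => Frame.denotes_plug hg.symm ?_ ?_ ?_ hdu⟩
  · exact hgb ▸ hbefore
  · exact hga ▸ hafter
  · exact hgd ▸ hdelayed

theorem Clo.Denotes.exists_ctx {P : Head S → Prop} {E : Clo S → Clo S} (hE : IsCtx P E)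
    {c : Clo S} {t : Expr S} (h : (E c).Denotes t) :
    ∃ (E' : Expr S → Expr S) (e : Expr S), IsCtx P E' ∧ t = E' e ∧ c.Denotes e ∧
      ∀ d u, d.Denotes u → (E d).Denotes (E' u) := by
  induction hE using IsCtx.induction generalizing t with
  | hole => exact ⟨fun e => e, t, .hole, rfl, h, fun _ _ => id⟩
  | @plug f E hf _ ih =>
    obtain ⟨g, _, hg, rfl, hc, hplug⟩ := h.exists_plug
    obtain ⟨E', e, hE', rfl, hce, hE⟩ := ih hc
    exact ⟨fun t => g.plug (E' t), e, hE'.plug_frame (hg ▸ hf), rfl, hce,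
      fun d u hdu => hplug _ _ (hE d u hdu)⟩

end DenotationOfContexts

section Skipping

variable {S : Domains}

theorem IsCtx.inj_of_isCore {T : Type} [Term S T] {P Q : Head S → Prop} {E E' : T → T}
    (hE : IsCtx P E) (hE' : IsCtx Q E') {t u : T} (ht : IsCore t) (hu : IsCore u)
    (h : E t = E' u) : E = E' ∧ t = u := by
  obtain ⟨K, -, rfl⟩ := hE
  obtain ⟨L, -, rfl⟩ := hE'
  obtain ⟨rfl, rfl⟩ := ht.plug_inj hu h
  exact ⟨rfl, rfl⟩

theorem IsCtx.through {T : Type} [Term S T] {P : Head S → Prop} {E : T → T} (hE : IsCtx P E)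
    (h : Head S) (as ds : List T)
    (harity : h.Arity (as.length + 1) ds.length := by simp [Head.Arity]) :
    IsCtx (fun _ => True) (fun t => Term.ofParts ⟨h, E t :: as, ds⟩) :=
  (hE.mono fun _ _ => trivial).cons h [] as ds trivial (by simp) (by simpa using harity)

namespace JS

theorem isCore_of_parts {e : Expr S} {p : Parts S (Expr S)} (he : e.parts = some p)
    (hhead : ¬ p.head.IsRecord) (hstrict : ∀ v ∈ p.strict, v.IsValue) : IsCore e :=
  ⟨fun hv => hhead ((Expr.isValue_iff_of_parts he).1 hv).1, fun q hq => by
    obtain rfl := Option.some.inj (he.symm.trans hq)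
    exact hstrict⟩

theorem isCore_raised (s : Signal S) {v : Expr S} (hv : v.IsValue) : IsCore (s.raised v) := by
  cases s <;> exact isCore_of_parts rfl id (List.forall_mem_singleton.2 hv)

theorem Red.isCore {δ : S.Op → List (Expr S) → Option (Expr S)} {e e' : Expr S}
    (h : Red δ e e') : IsCore e := by
  cases h <;> refine isCore_of_parts rfl id ?_ <;>
    simp_all [Expr.IsValue.const, Expr.IsValue.func]

theorem Red.ne_raised {δ : S.Op → List (Expr S) → Option (Expr S)} {e e' : Expr S}
    (h : Red δ e e') (s : Signal S) (v : Expr S) : s.raised v ≠ e := by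
  cases s <;> cases h <;> exact nofun

/-- The rules that deliver a signal to its handler skip the contexts `F` and `G`. -/
theorem Step.skip {δ : S.Op → List (Expr S) → Option (Expr S)} {s : Signal S}
    {E N : Expr S → Expr S} (hE : EvalCtx E) (hN : IsCtx s.Passes N) {v : Expr S}
    (hv : v.IsValue) {σ : Store S (Expr S)} {t : State S (Expr S)}
    (h : Step δ (σ, .run (E (s.raised v))) t) : Step δ (σ, .run (E (N (s.raised v)))) t := by
  have inj {E' : Expr S → Expr S} {u : Expr S} {P : Head S → Prop} (hE' : IsCtx P E')
      (hu : IsCore u) (heq : E (s.raised v) = E' u) : E = E' ∧ s.raised v = u :=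
    hE.isCtx.inj_of_isCore hE' (isCore_raised s hv) hu heq
  generalize hx : E (s.raised v) = x at h
  cases h with
  | ctx σ hE' hred => exact absurd (inj hE'.isCtx hred.isCore hx).2 (hred.ne_raised s v)
  | alloc σ hE' | deref σ hE' | derefDangling σ hE' | assign σ hE' =>
    cases s <;>
      cases (inj hE'.isCtx (isCore_of_parts rfl id (by simp_all [Expr.IsValue.const])) hx).2
  | uncaught σ hF w hw =>
    obtain ⟨rfl, hs⟩ := inj hF.isCtx (isCore_raised .throw hw) hx
    cases s <;> cases hs
    exact .uncaught σ (labelCtx_iff.2 (hF.isCtx.comp hN)) v hv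
  | throwCatch σ hE' hF w hw y e =>
    obtain ⟨rfl, hs⟩ := inj (hE'.isCtx.comp (hF.isCtx.through (.tryc y) [] [e]))
      (isCore_raised .throw hw) hx
    cases s <;> cases hs
    exact .throwCatch σ hE' (labelCtx_iff.2 (hF.isCtx.comp hN)) v hv y e
  | throwFinally σ hE' hF w hw e =>
    obtain ⟨rfl, hs⟩ := inj (hE'.isCtx.comp (hF.isCtx.through .tryf [] [e]))
      (isCore_raised .throw hw) hx
    cases s <;> cases hs
    exact .throwFinally σ hE' (labelCtx_iff.2 (hF.isCtx.comp hN)) v hv e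
  | breakFinally σ hE' hG l w hw e =>
    obtain ⟨rfl, hs⟩ := inj (hE'.isCtx.comp ((hG.isCtx l).through .tryf [] [e]))
      (isCore_raised (.brk l) hw) hx
    cases s <;> cases hs
    exact .breakFinally σ hE' ((handlerCtx_iff l).2 ((hG.isCtx l).comp hN)) l v hv e
  | breakLabel σ hE' hG l w hw =>
    obtain ⟨rfl, hs⟩ := inj (hE'.isCtx.comp ((hG.isCtx l).through (.label l) [] []))
      (isCore_raised (.brk l) hw) hx
    cases s <;> cases hs
    exact .breakLabel σ hE' ((handlerCtx_iff l).2 ((hG.isCtx l).comp hN)) l v hv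
  | breakOther σ hE' hG l l' hl w hw =>
    obtain ⟨rfl, hs⟩ := inj (hE'.isCtx.comp ((hG.isCtx l).through (.label l') [] []))
      (isCore_raised (.brk l) hw) hx
    cases s <;> cases hs
    exact .breakOther σ hE' ((handlerCtx_iff l).2 ((hG.isCtx l).comp hN)) l l' hl v hv
  | breakUnbound σ hG l w hw =>
    obtain ⟨rfl, hs⟩ := inj (hG.isCtx l) (isCore_raised (.brk l) hw) hx
    cases s <;> cases hs
    exact .breakUnbound σ ((handlerCtx_iff l).2 ((hG.isCtx l).comp hN)) l v hv

end JS

end Skipping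

/-! ## Matching reductions -/

section MatchingReductions

variable {S : Domains}

theorem Env.Closes.denotesUnder_body {ρ : Env S} {xs : List S.Var} {e : Expr S}
    (h : Env.Closes ρ [] (.func xs e)) :
    Clo.DenotesUnder xs (.clos e ρ) (e.subst (hide (Env.subst ρ) xs)) :=
  .clos ⟨h.isClosedValue, fun x hx hxs => h.exists_mem x ⟨hx, hxs⟩ List.not_mem_nil⟩

namespace Clo

theorem map_fst_forceFields (fs : List (S.Str × Clo S)) :
    (forceFields fs).map Prod.fst = fs.map Prod.fst := by
  simp [forceFields_eq]

theorem force_record_append_cons (fs gs : List (S.Str × Clo S)) (s : S.Str) (v : Clo S) :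
    (Clo.record (fs ++ (s, v) :: gs)).force =
      .record (forceFields fs ++ (s, v.force) :: forceFields gs) := by
  simp [force, forceFields_eq]

namespace IsValue

theorem force_eq_const_iff {v : Clo S} (hv : v.IsValue) {k : S.Const} :
    v.force = .const k ↔ v = .const k := by
  cases hv <;> simp [force, Expr.subst]

theorem force_eq_record_iff {v : Clo S} (hv : v.IsValue) {fs : List (S.Str × Expr S)} :
    v.force = .record fs ↔ ∃ gs, v = .record gs ∧ forceFields gs = fs := by
  cases hv <;> simp [force, Expr.subst]

theorem exists_of_force_eq_record_append_cons {v : Clo S} (hv : v.IsValue)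
    {fs gs : List (S.Str × Expr S)} {s : S.Str} {w : Expr S}
    (h : v.force = .record (fs ++ (s, w) :: gs)) :
    ∃ fs' u gs', v = .record (fs' ++ (s, u) :: gs') ∧ forceFields fs' = fs ∧ u.force = w ∧
      forceFields gs' = gs := by
  obtain ⟨hs, rfl, hhs⟩ := hv.force_eq_record_iff.1 h
  simp only [forceFields_eq] at hhs ⊢
  obtain ⟨fs', _, rfl, rfl, hgs⟩ := List.map_eq_append_iff.1 hhs
  obtain ⟨⟨_, u⟩, gs', rfl, hu, rfl⟩ := List.map_eq_cons_iff.1 hgs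
  cases hu
  exact ⟨fs', u, gs', rfl, rfl, rfl, rfl⟩

theorem force_eq_func_iff {v : Clo S} (hv : v.IsValue) {xs : List S.Var} {e : Expr S} :
    v.force = .func xs e ↔
      ∃ b ρ, v = .clos (.func xs b) ρ ∧ b.subst (hide (Env.subst ρ) xs) = e := by
  cases hv <;> simp [force, Expr.subst, Env.subst]
  grind

theorem force_eq_record_and_const_iff {o k : Clo S} (ho : o.IsValue) (hk : k.IsValue) :
    (∃ fs s, o.force = .record fs ∧ k.force = .const (.str s)) ↔
      ∃ fs s, o = .record fs ∧ k = .const (.str s) := by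
  simp only [ho.force_eq_record_iff, hk.force_eq_const_iff]
  grind

end IsValue

theorem isClosedValue_record_iff {fs : List (S.Str × Clo S)} :
    (Clo.record fs).IsClosedValue ↔ ∀ p ∈ fs, p.2.IsClosedValue :=
  ⟨fun | .record _ h => h, .record fs⟩

theorem isClosedValue_record_append_cons_iff {fs gs : List (S.Str × Clo S)} {s : S.Str}
    {v : Clo S} : (Clo.record (fs ++ (s, v) :: gs)).IsClosedValue ↔
      (∀ p ∈ fs, p.2.IsClosedValue) ∧ v.IsClosedValue ∧ ∀ p ∈ gs, p.2.IsClosedValue := by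
  rw [isClosedValue_record_iff, List.forall_mem_append, List.forall_mem_cons]

theorem denotes_record_append {fs gs : List (S.Str × Clo S)} (hfs : ∀ p ∈ fs, p.2.IsClosedValue)
    (hgs : ∀ p ∈ gs, p.2.IsClosedValue) :
    (Clo.record (fs ++ gs)).Denotes (.record (forceFields fs ++ forceFields gs)) := by
  have h := (isClosedValue_record_iff.2 (List.forall_mem_append.2 ⟨hfs, hgs⟩)).denotes_force
  simpa only [force, forceFields_eq, List.map_append] using h

theorem denotes_raise (r : RuntimeError) : (Rho.raise r : Clo S).Denotes (JS.raise r) :=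
  Parts.Denotes.of_parts ⟨rfl, .cons (.const _) .nil, .nil⟩ rfl rfl

theorem Denotes.ite {c t f : Clo S} {c' t' f' : Expr S} (hc : c.Denotes c') (ht : t.Denotes t')
    (hf : f.Denotes f') : (Clo.ite c t f).Denotes (.ite c' t' f') :=
  Parts.Denotes.of_parts (p := ⟨.ite, _, _⟩) (q := ⟨.ite, _, _⟩)
    ⟨rfl, .cons hc .nil, .cons ht (.cons hf .nil)⟩ rfl rfl

theorem Denotes.seq {a b : Clo S} {a' b' : Expr S} (ha : a.Denotes a') (hb : b.Denotes b') :
    (Clo.seq a b).Denotes (.seq a' b') :=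
  Parts.Denotes.of_parts (p := ⟨.seq, _, _⟩) (q := ⟨.seq, _, _⟩)
    ⟨rfl, .cons ha .nil, .cons hb .nil⟩ rfl rfl

theorem Denotes.whl {a b : Clo S} {a' b' : Expr S} (ha : a.Denotes a') (hb : b.Denotes b') :
    (Clo.whl a b).Denotes (.whl a' b') :=
  Parts.Denotes.of_parts (p := ⟨.whl, _, _⟩) (q := ⟨.whl, _, _⟩)
    ⟨rfl, .nil, .cons ha (.cons hb .nil)⟩ rfl rfl

end Clo

/-- The two interpretations of the primitive operations agree up to forcing on closed values, where
they yield closed values. -/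
structure PrimsAgree (δ : S.Op → List (Expr S) → Option (Expr S))
    (δρ : S.Op → List (Clo S) → Option (Clo S)) : Prop where
  map_force {op : S.Op} {vs : List (Clo S)} (hvs : ∀ v ∈ vs, v.IsClosedValue) :
    δ op (vs.map Clo.force) = (δρ op vs).map Clo.force
  isClosedValue {op : S.Op} {vs : List (Clo S)} {v : Clo S} (hvs : ∀ v ∈ vs, v.IsClosedValue)
    (hv : δρ op vs = some v) : v.IsClosedValue

/-- The store-insensitive reductions of `c` and of `e` match each other up to denotation. -/
structure RedMatch (δ : S.Op → List (Expr S) → Option (Expr S))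
    (δρ : S.Op → List (Clo S) → Option (Clo S)) (c : Clo S) (e : Expr S) : Prop where
  forth {c' : Clo S} (h : Rho.Red δρ c c') : ∃ e', JS.Red δ e e' ∧ c'.Denotes e'
  back {e' : Expr S} (h : JS.Red δ e e') : ∃ c', Rho.Red δρ c c' ∧ c'.Denotes e'

namespace RedMatch

variable {δ : S.Op → List (Expr S) → Option (Expr S)} {δρ : S.Op → List (Clo S) → Option (Clo S)}

theorem letin (x : S.Var) {v b : Clo S} {t : Expr S} (hv : v.IsClosedValue)
    (hb : Clo.DenotesUnder [x] b t) : RedMatch δ δρ (.letin x v b) (.letin x v.force t) where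
  forth := by
    rintro _ (_ | ⟨_, _, e, ρ, hv'⟩)
    exact ⟨_, .letin x _ t hv.isValue.isValue_force,
      hb.bind (vs := [v]) (List.forall_mem_singleton.2 hv) rfl⟩
  back := by
    rintro _ (_ | _)
    cases hb with
    | @clos _ e ρ hρ =>
      exact ⟨_, .letin x v e ρ hv.isValue,
        (Clo.DenotesUnder.clos hρ).bind (vs := [v]) (List.forall_mem_singleton.2 hv) rfl⟩

theorem app {f : Clo S} {vs : List (Clo S)} (hf : f.IsClosedValue)
    (hvs : ∀ v ∈ vs, v.IsClosedValue) :
    RedMatch δ δρ (.app f vs) (.app f.force (vs.map Clo.force)) where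
  forth {c'} h := by
    have hws : ∀ w ∈ vs.map Clo.force, w.IsValue :=
      List.forall_mem_map.2 fun v hv => (hvs v hv).isValue.isValue_force
    cases h with
    | app xs e ρ _ _ hlen =>
      exact ⟨_, .app xs _ _ hws (by simpa using hlen),
        (Clo.isClosedValue_func_iff.1 hf).denotesUnder_body.bind hvs hlen⟩
    | badCall _ _ _ _ hbad =>
      refine ⟨_, .badCall _ _ hf.isValue.isValue_force hws ?_, Clo.denotes_raise _⟩
      rintro ⟨xs, e, hforce, hlen⟩
      obtain ⟨b, ρ, rfl, -⟩ := hf.isValue.force_eq_func_iff.1 hforce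
      exact hbad ⟨xs, b, ρ, rfl, by simpa using hlen⟩
  back {e'} h := by
    generalize hf' : f.force = f' at h
    cases h with
    | app xs _ _ _ hlen =>
      obtain ⟨b, ρ, rfl, rfl⟩ := hf.isValue.force_eq_func_iff.1 hf'
      rw [List.length_map] at hlen
      exact ⟨_, .app xs b ρ vs (fun v hv => (hvs v hv).isValue) hlen,
        (Clo.isClosedValue_func_iff.1 hf).denotesUnder_body.bind hvs hlen⟩
    | badCall _ _ _ _ hbad =>
      refine ⟨_, .badCall f vs hf.isValue (fun v hv => (hvs v hv).isValue) ?_, Clo.denotes_raise _⟩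
      rintro ⟨xs, b, ρ, rfl, hlen⟩
      exact hbad ⟨xs, _, hf'.symm, by simpa using hlen⟩

theorem get {o k : Clo S} (ho : o.IsClosedValue) (hk : k.IsClosedValue) :
    RedMatch δ δρ (.get o k) (.get o.force k.force) where
  forth {c'} h := by
    have ho' := ho.isValue.isValue_force
    cases h with
    | getHit fs gs s v =>
      obtain ⟨-, hv, -⟩ := Clo.isClosedValue_record_append_cons_iff.1 ho
      rw [Clo.force_record_append_cons] at ho' ⊢
      exact ⟨_, .getHit _ _ s _ ho', hv.denotes_force⟩
    | getMiss fs s _ hs =>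
      exact ⟨_, .getMiss _ s ho' (Clo.map_fst_forceFields fs ▸ hs), .const _⟩
    | badIndex _ _ _ hkv hbad =>
      exact ⟨_, .badIndex _ _ ho' hkv.isValue_force
        (mt (Clo.IsValue.force_eq_record_and_const_iff ho.isValue hkv).1 hbad), Clo.denotes_raise _⟩
  back {e'} h := by
    generalize ho' : o.force = o' at h
    generalize hk' : k.force = k' at h
    cases h with
    | getHit =>
      obtain ⟨fs, v, gs, rfl, rfl, rfl, rfl⟩ := ho.isValue.exists_of_force_eq_record_append_cons ho'
      obtain rfl := hk.isValue.force_eq_const_iff.1 hk'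
      obtain ⟨-, hv, -⟩ := Clo.isClosedValue_record_append_cons_iff.1 ho
      exact ⟨v, .getHit fs gs _ v ho.isValue, hv.denotes_force⟩
    | getMiss _ s _ hs =>
      obtain ⟨fs, rfl, rfl⟩ := ho.isValue.force_eq_record_iff.1 ho'
      obtain rfl := hk.isValue.force_eq_const_iff.1 hk'
      exact ⟨_, .getMiss fs s ho.isValue (Clo.map_fst_forceFields fs ▸ hs), .const _⟩
    | badIndex _ _ _ _ hbad =>
      subst ho' hk'
      exact ⟨_, .badIndex o k ho.isValue hk.isValue
        (mt (ho.isValue.force_eq_record_and_const_iff hk.isValue).2 hbad), Clo.denotes_raise _⟩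

theorem put {o k v : Clo S} (ho : o.IsClosedValue) (hk : k.IsClosedValue)
    (hv : v.IsClosedValue) : RedMatch δ δρ (.put o k v) (.put o.force k.force v.force) where
  forth {c'} h := by
    have ho' := ho.isValue.isValue_force
    have hv' := hv.isValue.isValue_force
    cases h with
    | putHit fs gs s u =>
      obtain ⟨hfs, -, hgs⟩ := Clo.isClosedValue_record_append_cons_iff.1 ho
      have h := (Clo.isClosedValue_record_append_cons_iff (s := s).2 ⟨hfs, hv, hgs⟩).denotes_force
      rw [Clo.force_record_append_cons] at ho' h ⊢
      exact ⟨_, .putHit _ _ s _ _ ho' hv', h⟩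
    | putMiss fs s _ _ _ hs =>
      exact ⟨_, .putMiss _ s _ ho' hv' (Clo.map_fst_forceFields fs ▸ hs),
        (Clo.isClosedValue_record_append_cons_iff (fs := []).2
          ⟨by simp, hv, Clo.isClosedValue_record_iff.1 ho⟩).denotes_force⟩
    | badUpdate _ _ _ _ hkv _ hbad =>
      exact ⟨_, .badUpdate _ _ _ ho' hkv.isValue_force hv'
        (mt (ho.isValue.force_eq_record_and_const_iff hkv).1 hbad), Clo.denotes_raise _⟩
  back {e'} h := by
    generalize ho' : o.force = o' at h
    generalize hk' : k.force = k' at h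
    cases h with
    | putHit =>
      obtain ⟨fs, v, gs, rfl, rfl, rfl, rfl⟩ := ho.isValue.exists_of_force_eq_record_append_cons ho'
      obtain rfl := hk.isValue.force_eq_const_iff.1 hk'
      obtain ⟨hfs, -, hgs⟩ := Clo.isClosedValue_record_append_cons_iff.1 ho
      exact ⟨_, .putHit fs gs _ _ _ ho.isValue hv.isValue, Clo.force_record_append_cons _ _ _ _ ▸
        (Clo.isClosedValue_record_append_cons_iff.2 ⟨hfs, hv, hgs⟩).denotes_force⟩
    | putMiss _ s _ _ _ hs =>
      obtain ⟨fs, rfl, rfl⟩ := ho.isValue.force_eq_record_iff.1 ho'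
      obtain rfl := hk.isValue.force_eq_const_iff.1 hk'
      exact ⟨_, .putMiss fs s v ho.isValue hv.isValue (Clo.map_fst_forceFields fs ▸ hs),
        (Clo.isClosedValue_record_append_cons_iff (fs := []).2
          ⟨by simp, hv, Clo.isClosedValue_record_iff.1 ho⟩).denotes_force⟩
    | badUpdate _ _ _ _ _ _ hbad =>
      subst ho' hk'
      exact ⟨_, .badUpdate o k v ho.isValue hk.isValue hv.isValue
        (mt (ho.isValue.force_eq_record_and_const_iff hk.isValue).2 hbad), Clo.denotes_raise _⟩

theorem del {o k : Clo S} (ho : o.IsClosedValue) (hk : k.IsClosedValue) :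
    RedMatch δ δρ (.del o k) (.del o.force k.force) where
  forth {c'} h := by
    have ho' := ho.isValue.isValue_force
    cases h with
    | delHit fs gs s v =>
      obtain ⟨hfs, -, hgs⟩ := Clo.isClosedValue_record_append_cons_iff.1 ho
      rw [Clo.force_record_append_cons] at ho' ⊢
      exact ⟨_, .delHit _ _ s _ ho', Clo.denotes_record_append hfs hgs⟩
    | delMiss fs s _ hs =>
      exact ⟨_, .delMiss _ s ho' (Clo.map_fst_forceFields fs ▸ hs), ho.denotes_force⟩
    | badDelete _ _ _ hkv hbad =>
      exact ⟨_, .badDelete _ _ ho' hkv.isValue_force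
        (mt (Clo.IsValue.force_eq_record_and_const_iff ho.isValue hkv).1 hbad), Clo.denotes_raise _⟩
  back {e'} h := by
    generalize ho' : o.force = o' at h
    generalize hk' : k.force = k' at h
    cases h with
    | delHit =>
      obtain ⟨fs, v, gs, rfl, rfl, rfl, rfl⟩ := ho.isValue.exists_of_force_eq_record_append_cons ho'
      obtain rfl := hk.isValue.force_eq_const_iff.1 hk'
      obtain ⟨hfs, -, hgs⟩ := Clo.isClosedValue_record_append_cons_iff.1 ho
      exact ⟨_, .delHit fs gs _ v ho.isValue, Clo.denotes_record_append hfs hgs⟩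
    | delMiss _ s _ hs =>
      obtain ⟨fs, rfl, rfl⟩ := ho.isValue.force_eq_record_iff.1 ho'
      obtain rfl := hk.isValue.force_eq_const_iff.1 hk'
      exact ⟨_, .delMiss fs s ho.isValue (Clo.map_fst_forceFields fs ▸ hs), ho.denotes_force⟩
    | badDelete _ _ _ _ hbad =>
      subst ho' hk'
      exact ⟨_, .badDelete o k ho.isValue hk.isValue
        (mt (ho.isValue.force_eq_record_and_const_iff hk.isValue).2 hbad), Clo.denotes_raise _⟩

theorem ite {v a b : Clo S} {a' b' : Expr S} (hv : v.IsClosedValue) (ha : a.Denotes a')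
    (hb : b.Denotes b') : RedMatch δ δρ (.ite v a b) (.ite v.force a' b') where
  forth {c'} h := by
    cases h with
    | iteTrue => exact ⟨a', .iteTrue a' b', ha⟩
    | iteFalse => exact ⟨b', .iteFalse a' b', hb⟩
    | badCondition _ _ _ _ hbad =>
      exact ⟨_, .badCondition _ a' b' hv.isValue.isValue_force
        (by simpa only [hv.isValue.force_eq_const_iff] using hbad), Clo.denotes_raise _⟩
  back {e'} h := by
    generalize hv' : v.force = v' at h
    cases h with
    | iteTrue =>
      obtain rfl := hv.isValue.force_eq_const_iff.1 hv'
      exact ⟨a, .iteTrue a b, ha⟩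
    | iteFalse =>
      obtain rfl := hv.isValue.force_eq_const_iff.1 hv'
      exact ⟨b, .iteFalse a b, hb⟩
    | badCondition _ _ _ _ hbad =>
      subst hv'
      exact ⟨_, .badCondition v a b hv.isValue
        (by simpa only [hv.isValue.force_eq_const_iff] using hbad), Clo.denotes_raise _⟩

theorem seq {v b : Clo S} {b' : Expr S} (hv : v.IsClosedValue) (hb : b.Denotes b') :
    RedMatch δ δρ (.seq v b) (.seq v.force b') where
  forth := by
    rintro _ (_ | _)
    exact ⟨b', .seq _ b' hv.isValue.isValue_force, hb⟩
  back := by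
    rintro _ (_ | _)
    exact ⟨b, .seq v b hv.isValue, hb⟩

theorem whl {a b : Clo S} {a' b' : Expr S} (ha : a.Denotes a') (hb : b.Denotes b') :
    RedMatch δ δρ (.whl a b) (.whl a' b') where
  forth := by
    rintro _ (_ | _)
    exact ⟨_, .whl a' b', ha.ite (hb.seq (ha.whl hb)) (.const _)⟩
  back := by
    rintro _ (_ | _)
    exact ⟨_, .whl a b, ha.ite (hb.seq (ha.whl hb)) (.const _)⟩

theorem tryc {v : Clo S} (x : S.Var) (b : Clo S) (b' : Expr S) (hv : v.IsClosedValue) :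
    RedMatch δ δρ (.tryc v x b) (.tryc v.force x b') where
  forth := by
    rintro _ (_ | _)
    exact ⟨_, .tryc _ x b' hv.isValue.isValue_force, hv.denotes_force⟩
  back := by
    rintro _ (_ | _)
    exact ⟨v, .tryc v x b hv.isValue, hv.denotes_force⟩

theorem tryf {v b : Clo S} {b' : Expr S} (hv : v.IsClosedValue) (hb : b.Denotes b') :
    RedMatch δ δρ (.tryf v b) (.tryf v.force b') where
  forth := by
    rintro _ (_ | _)
    exact ⟨_, .tryf _ b' hv.isValue.isValue_force, hb.seq hv.denotes_force⟩
  back := by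
    rintro _ (_ | _)
    exact ⟨_, .tryf v b hv.isValue, hb.seq hv.denotes_force⟩

theorem label (l : S.Label) {v : Clo S} (hv : v.IsClosedValue) :
    RedMatch δ δρ (.label l v) (.label l v.force) where
  forth := by
    rintro _ (_ | _)
    exact ⟨_, .label l _ hv.isValue.isValue_force, hv.denotes_force⟩
  back := by
    rintro _ (_ | _)
    exact ⟨v, .label l v hv.isValue, hv.denotes_force⟩

theorem prim (hδ : PrimsAgree δ δρ) (op : S.Op) {vs : List (Clo S)}
    (hvs : ∀ v ∈ vs, v.IsClosedValue) :
    RedMatch δ δρ (.prim op vs) (.prim op (vs.map Clo.force)) where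
  forth {c'} h := by
    have hws : ∀ w ∈ vs.map Clo.force, w.IsValue :=
      List.forall_mem_map.2 fun v hv => (hvs v hv).isValue.isValue_force
    cases h with
    | prim _ _ _ _ hv =>
      exact ⟨c'.force, .prim op _ _ hws (by simp [hδ.map_force hvs, hv]),
        (hδ.isClosedValue hvs hv).denotes_force⟩
    | badPrim _ _ _ hv =>
      exact ⟨_, .badPrim op _ hws (by simp [hδ.map_force hvs, hv]), Clo.denotes_raise _⟩
  back {e'} h := by
    have hvs' : ∀ v ∈ vs, v.IsValue := fun v hv => (hvs v hv).isValue
    cases h with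
    | prim _ _ w _ hw =>
      obtain ⟨v, hv, rfl⟩ := Option.map_eq_some_iff.1 ((hδ.map_force hvs).symm.trans hw)
      exact ⟨v, .prim op vs v hvs' hv, (hδ.isClosedValue hvs hv).denotes_force⟩
    | badPrim _ _ _ hw =>
      exact ⟨_, .badPrim op vs hvs' (Option.map_eq_none_iff.1 ((hδ.map_force hvs).symm.trans hw)),
        Clo.denotes_raise _⟩

theorem deref {v : Clo S} (hv : v.IsClosedValue) :
    RedMatch δ δρ (.deref v) (.deref v.force) where
  forth {c'} h := by
    cases h with
    | badDeref _ _ hbad =>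
      exact ⟨_, .badDeref _ hv.isValue.isValue_force
        (by simpa only [hv.isValue.force_eq_const_iff] using hbad), Clo.denotes_raise _⟩
  back {e'} h := by
    cases h with
    | badDeref _ _ hbad =>
      exact ⟨_, .badDeref v hv.isValue
        (by simpa only [hv.isValue.force_eq_const_iff] using hbad), Clo.denotes_raise _⟩

theorem assign {u v : Clo S} (hu : u.IsClosedValue) (hv : v.IsClosedValue) :
    RedMatch δ δρ (.assign u v) (.assign u.force v.force) where
  forth {c'} h := by
    cases h with
    | badAssign _ _ _ _ hbad =>
      exact ⟨_, .badAssign _ _ hu.isValue.isValue_force hv.isValue.isValue_force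
        (by simpa only [hu.isValue.force_eq_const_iff] using hbad), Clo.denotes_raise _⟩
  back {e'} h := by
    cases h with
    | badAssign _ _ _ _ hbad =>
      exact ⟨_, .badAssign u v hu.isValue hv.isValue
        (by simpa only [hu.isValue.force_eq_const_iff] using hbad), Clo.denotes_raise _⟩

theorem of_denotes (hδ : PrimsAgree δ δρ) {c : Clo S} {e : Expr S} {p : Parts S (Clo S)}
    (hc : c.parts = some p) (hp : ∀ v ∈ p.strict, v.IsValue) (h : c.Denotes e) :
    RedMatch δ δρ c e := by
  obtain ⟨⟨_, ws, ds⟩, he, rfl, hstrict, hdelayed⟩ := h.exists_parts hc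
  obtain ⟨hclosed, rfl⟩ := Clo.forall₂_denotes_values hstrict hp
  obtain ⟨-, rfl⟩ := Expr.parts_eq_some_iff.1 he
  clear h hstrict he hp
  cases c <;> cases hc <;>
    simp only [List.forall_mem_cons, List.not_mem_nil, false_implies, implies_true, and_true]
      at hclosed
  case record | alloc | brk | throw => exact ⟨nofun, nofun⟩
  case letin => rcases hdelayed with _ | ⟨hb, ⟨⟩⟩; exact letin _ hclosed hb
  case app => exact app hclosed.1 hclosed.2
  case get => exact get hclosed.1 hclosed.2
  case put => exact put hclosed.1 hclosed.2.1 hclosed.2.2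
  case del => exact del hclosed.1 hclosed.2
  case assign => exact assign hclosed.1 hclosed.2
  case deref => exact deref hclosed
  case ite => rcases hdelayed with _ | ⟨ha, _ | ⟨hb, ⟨⟩⟩⟩; exact ite hclosed ha hb
  case seq => rcases hdelayed with _ | ⟨hb, ⟨⟩⟩; exact seq hclosed hb
  case whl => rcases hdelayed with _ | ⟨ha, _ | ⟨hb, ⟨⟩⟩⟩; exact whl ha hb
  case label => exact label _ hclosed
  case tryc => rcases hdelayed with _ | ⟨-, ⟨⟩⟩; exact tryc _ _ _ hclosed
  case tryf => rcases hdelayed with _ | ⟨hb, ⟨⟩⟩; exact tryf hclosed hb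
  case prim => exact prim hδ _ hclosed

end RedMatch

end MatchingReductions

/-! ## From `λρ_JS` to `λ_JS` -/

section Forth

variable {S : Domains}

/-- Propagation of an environment to the immediate subterms. -/
def Parts.delay (ρ : Env S) (p : Parts S (Expr S)) : Parts S (Clo S) :=
  ⟨p.head, p.strict.map (.clos · ρ), p.delayed.map (.clos · ρ)⟩

theorem Env.Closes.denotes_of_parts {ρ : Env S} {e : Expr S} (hρ : Env.Closes ρ [] e)
    {p : Parts S (Expr S)} (he : e.parts = some p) {c : Clo S}
    (hc : c.parts = some (p.delay ρ)) : c.Denotes (e.subst (Env.subst ρ)) := by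
  have mem_fv {x : S.Var} : x ∈ e.fv ↔
      (∃ a ∈ p.strict, x ∈ a.fv) ∨ ∃ d ∈ p.delayed, x ∈ d.fv ∧ x ∉ p.head.binder := by
    simp [Expr.fv_eq_of_parts he, and_left_comm]
  refine Parts.Denotes.of_parts ⟨rfl, ?_, ?_⟩ hc (Expr.parts_subst he _) <;>
    simp only [Parts.delay, List.forall₂_map_left_iff, List.forall₂_map_right_iff,
      List.forall₂_same]
  · exact fun a ha => Clo.denotes_clos_iff.2 ⟨⟨hρ.isClosedValue, fun x hx =>
      hρ.exists_mem x (mem_fv.2 (.inl ⟨a, ha, hx⟩))⟩, rfl⟩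
  · exact fun d hd => .clos ⟨hρ.isClosedValue, fun x hx hxs =>
      hρ.exists_mem x (mem_fv.2 (.inr ⟨d, hd, hx, hxs⟩)) List.not_mem_nil⟩

theorem Rho.Propagate.exists_parts {c c' : Clo S} (h : Propagate c c') :
    (∃ k ρ, c = .clos (.const k) ρ ∧ c' = .const k) ∨
      ∃ e ρ p, c = .clos e ρ ∧ e.parts = some p ∧ c'.parts = some (p.delay ρ) := by
  cases h with
  | const k ρ => exact .inl ⟨k, ρ, rfl, rfl⟩
  | _ => exact .inr ⟨_, _, _, rfl, rfl, by simp [Clo.parts, Parts.delay, Function.comp_def]⟩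

theorem Rho.Propagate.denotes {c c' : Clo S} (h : Propagate c c') {t : Expr S}
    (ht : c.Denotes t) : c'.Denotes t := by
  obtain ⟨k, ρ, rfl, rfl⟩ | ⟨e, ρ, p, rfl, he, hc'⟩ := h.exists_parts
  · obtain ⟨-, rfl⟩ := Clo.denotes_clos_iff.1 ht
    exact .const k
  · obtain ⟨hρ, rfl⟩ := Clo.denotes_clos_iff.1 ht
    exact hρ.denotes_of_parts he hc'

theorem Clo.denotes_of_lookup {x : S.Var} {ρ : Env S} {v : Clo S} (hx : ρ.lookup x = some v)
    {t : Expr S} (h : (Clo.clos (.var x) ρ).Denotes t) : v.Denotes t := by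
  obtain ⟨hρ, rfl⟩ := denotes_clos_iff.1 h
  simpa [Expr.subst, Env.subst_apply, hx] using
    (hρ.isClosedValue _ (Env.mem_of_lookup_eq_some hx)).denotes_force

theorem Rho.Red.exists_denotes {δ : S.Op → List (Expr S) → Option (Expr S)}
    {δρ : S.Op → List (Clo S) → Option (Clo S)} (hδ : PrimsAgree δ δρ) {c c' : Clo S}
    (h : Red δρ c c') {t : Expr S} (ht : c.Denotes t) :
    ∃ t', c'.Denotes t' ∧ (t' = t ∨ JS.Red δ t t') := by
  have strict {p : Parts S (Clo S)} (hc : c.parts = some p) (hp : ∀ v ∈ p.strict, v.IsValue) :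
      ∃ t', c'.Denotes t' ∧ (t' = t ∨ JS.Red δ t t') := by
    obtain ⟨t', hred, ht'⟩ := (RedMatch.of_denotes hδ hc hp ht).forth h
    exact ⟨t', ht', .inr hred⟩
  cases h with
  | var x ρ v hx => exact ⟨t, Clo.denotes_of_lookup hx ht, .inl rfl⟩
  | app xs e ρ vs hvs =>
    obtain ⟨_, -, -, hstrict, -⟩ := ht.exists_parts rfl
    obtain ⟨_, _, hf, -, -⟩ := List.forall₂_cons_left_iff.1 hstrict
    have hf := Clo.isClosedValue_func_iff.2 (Clo.denotes_clos_iff.1 hf).1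
    exact strict rfl (List.forall_mem_cons.2 ⟨hf.isValue, hvs⟩)
  | _ => exact strict rfl (by simp_all [Clo.IsValue.const])

/-- Forcing of all values in a store. -/
def Store.force (σ : Store S (Clo S)) : Store S (Expr S) := fun a => (σ a).map Clo.force

/-- A store all of whose values are closed. -/
def Store.IsClosed (σ : Store S (Clo S)) : Prop := ∀ a v, σ a = some v → v.IsClosedValue

theorem Store.IsClosed.update {σ : Store S (Clo S)} (hσ : Store.IsClosed σ) (a : S.Addr)
    {v : Clo S} (hv : v.IsClosedValue) : Store.IsClosed (Function.update σ a (some v)) := by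
  intro b w hw
  by_cases hb : b = a
  · subst hb
    simp_all
  · exact hσ b w (by simpa [hb] using hw)

theorem Store.force_update (σ : Store S (Clo S)) (a : S.Addr) (v : Clo S) :
    Store.force (Function.update σ a (some v)) =
      Function.update (Store.force σ) a (some v.force) := by
  funext b
  by_cases hb : b = a
  · subst hb
    simp [force]
  · simp [force, hb]

/-- The state `t` of `λ_JS` arises from the state `s` of `λρ_JS` by carrying out all delayed
substitutions. -/
inductive StateDenotes : State S (Clo S) → State S (Expr S) → Prop
  | run {σ : Store S (Clo S)} {c : Clo S} {e : Expr S} (hσ : Store.IsClosed σ)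
      (h : c.Denotes e) : StateDenotes (σ, .run c) (Store.force σ, .run e)
  | err {σ : Store S (Clo S)} {v : Clo S} (hσ : Store.IsClosed σ) (hv : v.IsClosedValue) :
      StateDenotes (σ, .err v) (Store.force σ, .err v.force)

namespace JS

variable {δ : S.Op → List (Expr S) → Option (Expr S)}

/-- The state `t` reaches all answers that the state `u` reaches. -/
def Covers (δ : S.Op → List (Expr S) → Option (Expr S)) (t u : State S (Expr S)) : Prop :=
  ∀ A, IsAnswer Expr.IsValue A → Relation.ReflTransGen (Step δ) u A →
    Relation.ReflTransGen (Step δ) t A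

theorem Step.covers {t u : State S (Expr S)} (h : Step δ t u) : Covers δ t u :=
  fun _ _ => .head h

theorem covers_skip {s : Signal S} {E N : Expr S → Expr S} (hE : IsCtx (fun _ => True) E)
    (hN : IsCtx s.Passes N) {v : Expr S} (hv : v.IsValue) (σ : Store S (Expr S)) :
    Covers δ (σ, .run (E (N (s.raised v)))) (σ, .run (E (s.raised v))) := by
  intro A hA h
  obtain rfl | ⟨t, hstep, ht⟩ := h.cases_head
  · obtain ⟨K, -, rfl⟩ := hE
    obtain ⟨-, -, w, hw, h | h⟩ := hA <;> cases h
    exact absurd hw (not_isValue_plug (isCore_raised s hv).1)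
  · exact .head (hstep.skip (evalCtx_iff.2 hE) hN hv) ht

end JS

theorem Signal.parts_raised {T : Type} [Term S T] (s : Signal S) (v : T) :
    Term.parts (s.raised v) = some ⟨s.head, [v], []⟩ :=
  Term.parts_eq_some_iff.2 ⟨by cases s <;> exact ⟨rfl, rfl⟩, rfl⟩

theorem Clo.IsClosedValue.denotes_raised {v : Clo S} (hv : v.IsClosedValue) (s : Signal S) :
    (s.raised v).Denotes (s.raised v.force) :=
  Parts.Denotes.of_parts ⟨rfl, .cons hv.denotes_force .nil, .nil⟩ (s.parts_raised v)
    (s.parts_raised v.force)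

theorem Clo.Denotes.eq_raised {s : Signal S} {v : Clo S} (hv : v.IsValue) {t : Expr S}
    (h : (s.raised v).Denotes t) : v.IsClosedValue ∧ t = s.raised v.force := by
  obtain ⟨⟨_, _, _⟩, hq, rfl, hstrict, ⟨⟩⟩ := h.exists_parts (s.parts_raised v)
  obtain ⟨hclosed, rfl⟩ := Clo.forall₂_denotes_values hstrict (List.forall_mem_singleton.2 hv)
  exact ⟨List.forall_mem_singleton.1 hclosed, Term.parts_inj hq (s.parts_raised _)⟩

theorem Clo.Denotes.exists_ctx_raised {s : Signal S} {P : Head S → Prop} {C : Clo S → Clo S}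
    (hC : IsCtx P C) {v : Clo S} (hv : v.IsValue) {t : Expr S}
    (h : (C (s.raised v)).Denotes t) :
    ∃ C', IsCtx P C' ∧ t = C' (s.raised v.force) ∧ v.IsClosedValue := by
  obtain ⟨C', _, hC', rfl, hraised, -⟩ := h.exists_ctx hC
  obtain ⟨hv, rfl⟩ := hraised.eq_raised hv
  exact ⟨C', hC', rfl, hv⟩

theorem Clo.Denotes.exists_evalCtx {E : Clo S → Clo S} (hE : Rho.EvalCtx E) {c : Clo S}
    {t : Expr S} (h : (E c).Denotes t) :
    ∃ E' e, JS.EvalCtx E' ∧ t = E' e ∧ c.Denotes e ∧ ∀ d u, d.Denotes u → (E d).Denotes (E' u) := by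
  obtain ⟨E', e, hE', ht, hc, hEE'⟩ := h.exists_ctx hE.isCtx
  exact ⟨E', e, JS.evalCtx_iff.2 hE', ht, hc, hEE'⟩

theorem Clo.Denotes.exists_localCtx_raised {s : Signal S} {C : Clo S → Clo S}
    (hC : Rho.LocalCtx C) {v : Clo S} (hv : v.IsValue) {t : Expr S}
    (h : (C (s.raised v)).Denotes t) :
    ∃ C', JS.LocalCtx C' ∧ t = C' (s.raised v.force) ∧ v.IsClosedValue := by
  obtain ⟨C', hC', ht, hv⟩ := h.exists_ctx_raised hC.isCtx hv
  exact ⟨C', JS.localCtx_iff.2 hC', ht, hv⟩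

theorem Clo.Denotes.exists_label {s : Signal S} {E C : Clo S → Clo S} (hE : Rho.EvalCtx E)
    (hC : Rho.LocalCtx C) {v : Clo S} (hv : v.IsValue) {l : S.Label} {t : Expr S}
    (h : (E (.label l (C (s.raised v)))).Denotes t) :
    ∃ E' C', JS.EvalCtx E' ∧ JS.LocalCtx C' ∧ v.IsClosedValue ∧
      t = E' (.label l (C' (s.raised v.force))) ∧ ∀ d u, d.Denotes u → (E d).Denotes (E' u) := by
  obtain ⟨E', _, hE', rfl, hlabel, hEE'⟩ := h.exists_evalCtx hE
  obtain ⟨⟨_, _, _⟩, hq, rfl, _ | ⟨hbody, ⟨⟩⟩, ⟨⟩⟩ := hlabel.exists_parts rfl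
  obtain ⟨C', hC', rfl, hv⟩ := hbody.exists_localCtx_raised hC hv
  obtain ⟨-, rfl⟩ := Expr.parts_eq_some_iff.1 hq
  exact ⟨E', C', hE', hC', hv, rfl, hEE'⟩

theorem Clo.Denotes.exists_tryc {s : Signal S} {E C : Clo S → Clo S} (hE : Rho.EvalCtx E)
    (hC : Rho.LocalCtx C) {v : Clo S} (hv : v.IsValue) {x : S.Var} {b : Clo S} {t : Expr S}
    (h : (E (.tryc (C (s.raised v)) x b)).Denotes t) :
    ∃ E' C' f, JS.EvalCtx E' ∧ JS.LocalCtx C' ∧ v.IsClosedValue ∧ DenotesUnder [x] b f ∧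
      t = E' (.tryc (C' (s.raised v.force)) x f) ∧ ∀ d u, d.Denotes u → (E d).Denotes (E' u) := by
  obtain ⟨E', _, hE', rfl, htry, hEE'⟩ := h.exists_evalCtx hE
  obtain ⟨⟨_, _, _⟩, hq, rfl, _ | ⟨hbody, ⟨⟩⟩, _ | ⟨hb, ⟨⟩⟩⟩ := htry.exists_parts rfl
  obtain ⟨C', hC', rfl, hv⟩ := hbody.exists_localCtx_raised hC hv
  obtain ⟨-, rfl⟩ := Expr.parts_eq_some_iff.1 hq
  exact ⟨E', C', _, hE', hC', hv, hb, rfl, hEE'⟩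

theorem Clo.Denotes.exists_tryf {s : Signal S} {E C : Clo S → Clo S} (hE : Rho.EvalCtx E)
    (hC : Rho.LocalCtx C) {v : Clo S} (hv : v.IsValue) {b : Clo S} {t : Expr S}
    (h : (E (.tryf (C (s.raised v)) b)).Denotes t) :
    ∃ E' C' f, JS.EvalCtx E' ∧ JS.LocalCtx C' ∧ v.IsClosedValue ∧
      t = E' (.tryf (C' (s.raised v.force)) f) ∧
      (E (.seq b (s.raised v))).Denotes (E' (.seq f (s.raised v.force))) := by
  obtain ⟨E', _, hE', rfl, htry, hEE'⟩ := h.exists_evalCtx hE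
  obtain ⟨⟨_, _, _⟩, hq, rfl, _ | ⟨hbody, ⟨⟩⟩, _ | ⟨hb, ⟨⟩⟩⟩ := htry.exists_parts rfl
  obtain ⟨C', hC', rfl, hv⟩ := hbody.exists_localCtx_raised hC hv
  obtain ⟨-, rfl⟩ := Expr.parts_eq_some_iff.1 hq
  exact ⟨E', C', _, hE', hC', hv, rfl, hEE' _ _ (Denotes.seq hb (hv.denotes_raised s))⟩

theorem Clo.Denotes.exists_redex {E : Clo S → Clo S} (hE : Rho.EvalCtx E) {c : Clo S} {h : Head S}
    {vs : List (Clo S)} (hc : c.parts = some ⟨h, vs, []⟩) (hvs : ∀ v ∈ vs, v.IsValue) {t : Expr S}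
    (ht : (E c).Denotes t) :
    ∃ E', JS.EvalCtx E' ∧ (∀ v ∈ vs, v.IsClosedValue) ∧
      t = E' (Expr.ofParts ⟨h, vs.map force, []⟩) ∧
      ∀ d u, d.Denotes u → (E d).Denotes (E' u) := by
  obtain ⟨E', _, hE', rfl, hct, hEE'⟩ := ht.exists_evalCtx hE
  obtain ⟨⟨_, _, _⟩, hq, rfl, hstrict, ⟨⟩⟩ := hct.exists_parts hc
  obtain ⟨hclosed, rfl⟩ := forall₂_denotes_values hstrict hvs
  obtain ⟨-, rfl⟩ := Expr.parts_eq_some_iff.1 hq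
  exact ⟨E', hE', hclosed, rfl, hEE'⟩

section

variable {δ : S.Op → List (Expr S) → Option (Expr S)} {δρ : S.Op → List (Clo S) → Option (Clo S)}

theorem Clo.Denotes.exists_covers_skip {s : Signal S} {E N : Clo S → Clo S} (hE : Rho.EvalCtx E)
    (hN : IsCtx s.Passes N) {v : Clo S} (hv : v.IsValue) {t : Expr S}
    (h : (E (N (s.raised v))).Denotes t) (σ : Store S (Expr S)) :
    ∃ t', (E (s.raised v)).Denotes t' ∧ JS.Covers δ (σ, .run t) (σ, .run t') := by
  obtain ⟨E', _, hE', rfl, hpass, hEE'⟩ := h.exists_ctx hE.isCtx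
  obtain ⟨N', hN', rfl, hv⟩ := hpass.exists_ctx_raised hN hv
  exact ⟨_, hEE' _ _ (hv.denotes_raised s),
    JS.covers_skip hE' hN' hv.isValue.isValue_force σ⟩

theorem Clo.Denotes.exists_covers_tryf {s : Signal S} {E C : Clo S → Clo S} (hE : Rho.EvalCtx E)
    (hC : Rho.LocalCtx C) {v : Clo S} (hv : v.IsValue) {b : Clo S} {t : Expr S}
    (h : (E (.tryf (C (s.raised v)) b)).Denotes t) (σ : Store S (Expr S)) :
    ∃ t', (E (.seq b (s.raised v))).Denotes t' ∧ JS.Covers δ (σ, .run t) (σ, .run t') := by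
  obtain ⟨E', C', f, hE', hC', hv, rfl, ht'⟩ := h.exists_tryf hE hC hv
  refine ⟨_, ht', ?_⟩
  cases s with
  | throw => exact (JS.Step.throwFinally σ hE' (.loc hC') _ hv.isValue.isValue_force f).covers
  | brk l => exact (JS.Step.breakFinally σ hE' (.loc hC') l _ hv.isValue.isValue_force f).covers

theorem Rho.Step.exists_covers (hδ : PrimsAgree δ δρ) {s s' : State S (Clo S)}
    {t : State S (Expr S)} (h : Rho.Step δρ s s') (hs : StateDenotes s t) :
    ∃ t', StateDenotes s' t' ∧ JS.Covers δ t t' := by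
  rcases hs with @⟨σ, _, _, hσ, hct⟩ | ⟨-, -⟩
  swap; · cases h
  cases h with
  | ctx _ hE hred =>
    obtain ⟨E', t, hE', rfl, hct, hEE'⟩ := hct.exists_evalCtx hE
    obtain ⟨t', ht', rfl | hred'⟩ := hred.exists_denotes hδ hct
    · exact ⟨_, .run hσ (hEE' _ _ ht'), fun _ _ => id⟩
    · exact ⟨_, .run hσ (hEE' _ _ ht'), (JS.Step.ctx _ hE' hred').covers⟩
  | propagate _ hE hprop =>
    obtain ⟨E', t, -, rfl, hct, hEE'⟩ := hct.exists_evalCtx hE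
    exact ⟨_, .run hσ (hEE' _ _ (hprop.denotes hct)), fun _ _ => id⟩
  | alloc _ hE v hv a ha =>
    obtain ⟨E', hE', hvs, rfl, hEE'⟩ := hct.exists_redex hE rfl (List.forall_mem_singleton.2 hv)
    have hv := List.forall_mem_singleton.1 hvs
    exact ⟨_, .run (hσ.update a hv) (hEE' _ _ (.const _)), Store.force_update σ a v ▸
      (JS.Step.alloc _ hE' _ hv.isValue.isValue_force a (by simp [Store.force, ha])).covers⟩
  | deref _ hE a v ha =>
    obtain ⟨E', hE', -, rfl, hEE'⟩ :=
      hct.exists_redex hE rfl (List.forall_mem_singleton.2 (.const _))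
    exact ⟨_, .run hσ (hEE' _ _ (hσ a v ha).denotes_force),
      (JS.Step.deref _ hE' a _ (by simp [Store.force, ha])).covers⟩
  | derefDangling _ hE a ha =>
    obtain ⟨E', hE', -, rfl, hEE'⟩ :=
      hct.exists_redex hE rfl (List.forall_mem_singleton.2 (.const _))
    exact ⟨_, .run hσ (hEE' _ _ (Clo.denotes_raise _)),
      (JS.Step.derefDangling _ hE' a (by simp [Store.force, ha])).covers⟩
  | assign _ hE a v hv =>
    obtain ⟨E', hE', hvs, rfl, hEE'⟩ :=
      hct.exists_redex hE rfl (List.forall_mem_cons.2 ⟨.const _, List.forall_mem_singleton.2 hv⟩)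
    have hv := hvs v (by simp)
    exact ⟨_, .run (hσ.update a hv) (hEE' _ _ hv.denotes_force), Store.force_update σ a v ▸
      (JS.Step.assign _ hE' a _ hv.isValue.isValue_force).covers⟩
  | uncaught _ hC v hv =>
    obtain ⟨C', hC', rfl, hv⟩ := hct.exists_localCtx_raised (s := .throw) hC hv
    exact ⟨_, .err hσ hv, (JS.Step.uncaught _ (.loc hC') _ hv.isValue.isValue_force).covers⟩
  | throwCatch _ hE hC v hv x e ρ =>
    obtain ⟨E', C', f, hE', hC', hv, hf, rfl, hEE'⟩ := hct.exists_tryc (s := .throw) hE hC hv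
    exact ⟨_, .run hσ (hEE' _ _ (hf.bind (vs := [v]) (List.forall_mem_singleton.2 hv) rfl)),
      (JS.Step.throwCatch _ hE' (.loc hC') _ hv.isValue.isValue_force x f).covers⟩
  | throwFinally _ hE hC v hv b =>
    obtain ⟨t', ht', hcov⟩ := hct.exists_covers_tryf (s := .throw) hE hC hv (Store.force σ)
    exact ⟨_, .run hσ ht', hcov⟩
  | throwLabel _ hE hC v hv l =>
    obtain ⟨t', ht', hcov⟩ := hct.exists_covers_skip (s := .throw) hE
      ((hC.isCtx.mono fun _ h => h.passes .throw).cons (.label l) [] [] []) hv (Store.force σ)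
    exact ⟨_, .run hσ ht', hcov⟩
  | breakCatch _ hE hC l v hv x b =>
    obtain ⟨t', ht', hcov⟩ := hct.exists_covers_skip (s := .brk l) hE
      ((hC.isCtx.mono fun _ h => h.passes (.brk l)).cons (.tryc x) [] [] [b]) hv (Store.force σ)
    exact ⟨_, .run hσ ht', hcov⟩
  | breakFinally _ hE hC l v hv b =>
    obtain ⟨t', ht', hcov⟩ := hct.exists_covers_tryf (s := .brk l) hE hC hv (Store.force σ)
    exact ⟨_, .run hσ ht', hcov⟩
  | breakLabel _ hE hC l v hv =>
    obtain ⟨E', C', hE', hC', hv, rfl, hEE'⟩ := hct.exists_label (s := .brk l) hE hC hv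
    exact ⟨_, .run hσ (hEE' _ _ hv.denotes_force),
      (JS.Step.breakLabel _ hE' (.loc hC') l _ hv.isValue.isValue_force).covers⟩
  | breakOther _ hE hC l l' hl v hv =>
    obtain ⟨E', C', hE', hC', hv, rfl, hEE'⟩ := hct.exists_label (s := .brk l) hE hC hv
    exact ⟨_, .run hσ (hEE' _ _ (hv.denotes_raised (.brk l))),
      (JS.Step.breakOther _ hE' (.loc hC') l l' hl _ hv.isValue.isValue_force).covers⟩
  | breakUnbound _ hC l v hv =>
    obtain ⟨C', hC', rfl, hv⟩ := hct.exists_localCtx_raised (s := .brk l) hC hv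
    exact ⟨_, .run hσ (Clo.denotes_raise _),
      (JS.Step.breakUnbound _ (.loc hC') l _ hv.isValue.isValue_force).covers⟩

theorem StateDenotes.eq_forceState {A : State S (Clo S)} {t : State S (Expr S)}
    (h : StateDenotes A t) (hA : IsAnswer Clo.IsValue A) : t = forceState A := by
  cases h with
  | run hσ h =>
    obtain ⟨-, -, v, hv, hrun | herr⟩ := hA
    · cases hrun
      exact congrArg (fun e => (_, Outcome.run e)) (h.isClosedValue_and_eq hv).2
    · cases herr
  | err hσ hv => rfl

theorem isAnswer_forceState {A : State S (Clo S)} (hA : IsAnswer Clo.IsValue A) :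
    IsAnswer Expr.IsValue (forceState A) := by
  obtain ⟨σ, r⟩ := A
  obtain ⟨hfin, hσ, v, hv, rfl | rfl⟩ := hA <;>
    refine ⟨by simpa [forceState] using hfin, ?_, v.force, hv.isValue_force,
      by simp [forceState]⟩ <;>
    simp only [forceState, Option.map_eq_some_iff] <;>
    exact fun a _ ⟨w, hw, he⟩ => he ▸ (hσ a w hw).isValue_force

theorem StateDenotes.reaches_forceState (hδ : PrimsAgree δ δρ) {s A : State S (Clo S)}
    {t : State S (Expr S)} (hs : StateDenotes s t)
    (h : Relation.ReflTransGen (Rho.Step δρ) s A) (hA : IsAnswer Clo.IsValue A) :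
    Relation.ReflTransGen (JS.Step δ) t (forceState A) := by
  induction h using Relation.ReflTransGen.head_induction_on generalizing t with
  | refl => rw [hs.eq_forceState hA]
  | head hstep _ ih =>
    obtain ⟨t', hs', hcov⟩ := hstep.exists_covers hδ hs
    exact hcov _ (isAnswer_forceState hA) (ih hs')

end

end Forth

/-! ## From `λ_JS` to `λρ_JS` -/

section Back

variable {S : Domains} {δ : S.Op → List (Expr S) → Option (Expr S)}
  {δρ : S.Op → List (Clo S) → Option (Clo S)}

namespace Rho

/-- The closure `c` reduces to `c'` in every evaluation context, without touching the store. -/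
def Reduces (δρ : S.Op → List (Clo S) → Option (Clo S)) (c c' : Clo S) : Prop :=
  ∀ (σ : Store S (Clo S)) (E : Clo S → Clo S), EvalCtx E →
    Relation.ReflTransGen (Step δρ) (σ, .run (E c)) (σ, .run (E c'))

theorem Reduces.refl (c : Clo S) : Reduces δρ c c := fun _ _ _ => .refl

theorem Reduces.trans {c c' c'' : Clo S} (h : Reduces δρ c c') (h' : Reduces δρ c' c'') :
    Reduces δρ c c'' := fun σ E hE => (h σ E hE).trans (h' σ E hE)

theorem Reduces.ctx {P : Head S → Prop} {E : Clo S → Clo S} (hE : IsCtx P E) {c c' : Clo S}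
    (h : Reduces δρ c c') : Reduces δρ (E c) (E c') := fun σ E' hE' =>
  h σ (fun t => E' (E t)) (evalCtx_iff.2 (hE'.isCtx.comp (hE.mono fun _ _ => trivial)))

theorem Reduces.plug (f : Frame (Clo S)) {c c' : Clo S} (h : Reduces δρ c c') :
    Reduces δρ (f.plug c) (f.plug c') :=
  h.ctx (IsCtx.hole.plug_frame (P := fun _ => True) trivial)

theorem Red.reduces {c c' : Clo S} (h : Red δρ c c') : Reduces δρ c c' :=
  fun σ _ hE => .single (.ctx σ hE h)

theorem Propagate.reduces {c c' : Clo S} (h : Propagate c c') : Reduces δρ c c' :=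
  fun σ _ hE => .single (.propagate σ hE h)

theorem exists_propagate {e : Expr S} {p : Parts S (Expr S)} (he : e.parts = some p) (ρ : Env S) :
    ∃ c, Propagate (.clos e ρ) c ∧ c.parts = some (p.delay ρ) := by
  cases e <;> cases he <;>
    exact ⟨_, by constructor, by simp [Clo.parts, Parts.delay, Function.comp_def]⟩

/-- The closure `c` reduces to a closed value that becomes `w` when its delayed substitutions are
carried out. -/
def Evaluates (δρ : S.Op → List (Clo S) → Option (Clo S)) (c : Clo S) (w : Expr S) : Prop :=
  ∃ v, Reduces δρ c v ∧ v.IsClosedValue ∧ v.force = w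

theorem Evaluates.exists_reduces_strict {cs : List (Clo S)} {ws : List (Expr S)}
    (h : List.Forall₂ (Evaluates δρ) cs ws) {c : Clo S} {hd : Head S} {vs as ds : List (Clo S)}
    (hc : c.parts = some ⟨hd, vs ++ (cs ++ as), ds⟩) (hvs : ∀ v ∈ vs, v.IsValue) :
    ∃ c' us, Reduces δρ c c' ∧ c'.parts = some ⟨hd, vs ++ (us ++ as), ds⟩ ∧
      (∀ u ∈ us, u.IsClosedValue) ∧ us.map Clo.force = ws := by
  induction h generalizing c vs with
  | nil => exact ⟨c, [], .refl c, hc, by simp⟩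
  | @cons b _ bs _ hb _ ih =>
    obtain ⟨v, hred, hv, rfl⟩ := hb
    obtain ⟨f, rfl, rfl, hafter, rfl, rfl⟩ := Frame.exists_plug_eq (as := bs ++ as) hc hvs
    obtain ⟨c', us, hred', hc', hus, rfl⟩ := ih (c := f.plug v) (vs := f.before ++ [v])
      ((f.parts_plug v).trans (by simp [hafter]))
      (List.forall_mem_append.2 ⟨hvs, List.forall_mem_singleton.2 hv.isValue⟩)
    exact ⟨c', v :: us, (hred.plug f).trans hred', by simpa using hc',
      List.forall_mem_cons.2 ⟨hv, hus⟩, rfl⟩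

end Rho

namespace Clo

open Rho

theorem Denotes.exists_resolved {c : Clo S} {e : Expr S} (h : c.Denotes e) :
    ∃ c', Reduces δρ c c' ∧ c'.Denotes e ∧ (c'.IsClosedValue ∨ ∃ p, c'.parts = some p) := by
  have hce := h
  cases h with
  | const k => exact ⟨_, .refl _, hce, .inl (.const k)⟩
  | compound hc => exact ⟨_, .refl _, hce, .inr ⟨_, hc⟩⟩
  | @clos _ t ρ hρ =>
    cases ht : t.parts with
    | some p =>
      obtain ⟨c', hprop, hc'⟩ := exists_propagate ht ρ
      exact ⟨c', hprop.reduces, hprop.denotes hce, .inr ⟨_, hc'⟩⟩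
    | none =>
      cases t <;> cases ht
      case var.refl x =>
        obtain ⟨q, hq, rfl⟩ := hρ.exists_mem x rfl List.not_mem_nil
        cases hx : ρ.lookup q.1 with
        | none => exact absurd rfl (Env.lookup_eq_none_iff.1 hx q hq)
        | some v => exact ⟨v, (Red.var _ ρ v hx).reduces, denotes_of_lookup hx hce,
            .inl (hρ.isClosedValue _ (Env.mem_of_lookup_eq_some hx))⟩
      case const.refl k =>
        exact ⟨_, (Propagate.const k ρ).reduces, .const k, .inl (.const k)⟩
      case func.refl xs b =>
        exact ⟨_, .refl _, hce, .inl (isClosedValue_func_iff.2 hρ)⟩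

theorem Denotes.exists_reduces_parts {c : Clo S} {e : Expr S} (h : c.Denotes e)
    {q : Parts S (Expr S)} (he : e.parts = some q) :
    ∃ c' p, Reduces δρ c c' ∧ c'.parts = some p ∧ p.Denotes q := by
  obtain ⟨c', hred, hc'e, hv | ⟨p, hp⟩⟩ := h.exists_resolved (δρ := δρ)
  · cases hv with
    | const k =>
      obtain rfl := denotes_const_iff.1 hc'e
      cases he
    | func xs b ρ =>
      obtain ⟨-, rfl⟩ := denotes_clos_iff.1 hc'e
      cases he
    | record fs =>
      obtain ⟨q', hq', hpq⟩ := hc'e.exists_parts rfl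
      obtain rfl := Option.some.inj (hq'.symm.trans he)
      exact ⟨_, _, hred, rfl, hpq⟩
  · obtain ⟨q', hq', hpq⟩ := hc'e.exists_parts hp
    obtain rfl := Option.some.inj (hq'.symm.trans he)
    exact ⟨c', p, hred, hp, hpq⟩

theorem Denotes.evaluates {w : Expr S} (hw : w.IsValue) {c : Clo S} (h : c.Denotes w) :
    Evaluates δρ c w := by
  have of_atom {w : Expr S} {c : Clo S} (hw : w.parts = none) (h : c.Denotes w) :
      Evaluates δρ c w := by
    obtain ⟨c', hred, hc'w, hv | ⟨p, hp⟩⟩ := h.exists_resolved (δρ := δρ)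
    · exact ⟨c', hred, hv, (hc'w.isClosedValue_and_eq hv.isValue).2.symm⟩
    · obtain ⟨q, hq, -⟩ := hc'w.exists_parts hp
      cases hw.symm.trans hq
  induction hw generalizing c with
  | const k => exact of_atom rfl h
  | func xs b => exact of_atom rfl h
  | record fs _ ih =>
    obtain ⟨c₁, ⟨_, cs, _⟩, hred, hc₁, rfl, hstrict, ⟨⟩⟩ :=
      h.exists_reduces_parts (δρ := δρ) rfl
    have hcs : List.Forall₂ (Evaluates δρ) cs (fs.map Prod.snd) := by
      obtain ⟨hlen, hzip⟩ := List.forall₂_iff_zip.1 hstrict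
      refine List.forall₂_iff_zip.2 ⟨hlen, fun {b w} hbw => ?_⟩
      obtain ⟨p, hp, rfl⟩ := List.mem_map.1 (List.of_mem_zip hbw).2
      exact ih p hp (hzip hbw)
    obtain ⟨v, us, hred', hparts, hus, hforce⟩ :=
      Evaluates.exists_reduces_strict hcs (vs := []) (as := []) (by simpa using hc₁) (by simp)
    rw [List.nil_append, List.append_nil] at hparts
    have hv : v.IsValue :=
      (isValue_iff_of_parts hparts).2 ⟨trivial, fun u hu => (hus u hu).isValue⟩
    have hvw : v.Denotes (.record fs) := Parts.Denotes.of_parts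
      ⟨rfl, hforce ▸ forall₂_denotes_map_force hus, .nil⟩ hparts rfl
    obtain ⟨hv, hvw⟩ := hvw.isClosedValue_and_eq hv
    exact ⟨v, hred.trans hred', hv, hvw.symm⟩

theorem Denotes.exists_reduces_node {c : Clo S} {e : Expr S} (h : c.Denotes e) {hd : Head S}
    {ws es fs : List (Expr S)} (he : e.parts = some ⟨hd, ws ++ es, fs⟩)
    (hws : ∀ w ∈ ws, w.IsValue) :
    ∃ c' vs cs ds, Reduces δρ c c' ∧ c'.parts = some ⟨hd, vs ++ cs, ds⟩ ∧
      ((∀ v ∈ vs, v.IsClosedValue) ∧ vs.map force = ws) ∧ List.Forall₂ Denotes cs es ∧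
      List.Forall₂ (DenotesUnder hd.binder) ds fs := by
  obtain ⟨c₁, ⟨_, bs, ds⟩, hred, hc₁, rfl, hstrict, hdelayed⟩ :=
    h.exists_reduces_parts (δρ := δρ) he
  obtain ⟨as, cs, rfl, has, hcs⟩ := exists_append_of_forall₂_append hstrict.flip
  have heval : List.Forall₂ (Evaluates δρ) as ws := by
    obtain ⟨hlen, hzip⟩ := List.forall₂_iff_zip.1 has.flip
    exact List.forall₂_iff_zip.2
      ⟨hlen, fun haw => Denotes.evaluates (hws _ (List.of_mem_zip haw).2) (hzip haw)⟩
  obtain ⟨c', vs, hred', hc', hvs⟩ :=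
    Evaluates.exists_reduces_strict heval (vs := []) hc₁ (by simp)
  exact ⟨c', vs, cs, ds, hred.trans hred', hc', hvs, hcs.flip, hdelayed⟩

theorem Denotes.exists_reduces_plug {c : Clo S} {g : Frame (Expr S)} {e : Expr S}
    (h : c.Denotes (g.plug e)) :
    ∃ (f : Frame (Clo S)) (a : Clo S), f.head = g.head ∧ Reduces δρ c (f.plug a) ∧ a.Denotes e ∧
      ∀ d u, d.Denotes u → (f.plug d).Denotes (g.plug u) := by
  obtain ⟨_, vs, _, ds, hred, hparts, ⟨hvs, hforce⟩, hrest, hdelayed⟩ :=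
    h.exists_reduces_node (δρ := δρ) (g.parts_plug e) g.isValue_before
  obtain ⟨a, as, hae, hafter, rfl⟩ := List.forall₂_cons_right_iff.1 hrest
  obtain ⟨f, hf, rfl, rfl, rfl, rfl⟩ := Frame.exists_plug_eq hparts fun v hv => (hvs v hv).isValue
  exact ⟨f, a, hf, hred, hae, fun d u => Frame.denotes_plug hf
    (hforce ▸ forall₂_denotes_map_force hvs) hafter (hf ▸ hdelayed)⟩

theorem Denotes.exists_reduces_ctx {P : Head S → Prop} {E' : Expr S → Expr S} (hE' : IsCtx P E')
    {c : Clo S} {e : Expr S} (h : c.Denotes (E' e)) :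
    ∃ (E : Clo S → Clo S) (a : Clo S), IsCtx P E ∧ Reduces δρ c (E a) ∧ a.Denotes e ∧
      ∀ d u, d.Denotes u → (E d).Denotes (E' u) := by
  induction hE' using IsCtx.induction generalizing c with
  | hole => exact ⟨fun c => c, c, .hole, .refl c, h, fun _ _ => id⟩
  | @plug g E' hg _ ih =>
    obtain ⟨f, b, hf, hred, hb, hplug⟩ := h.exists_reduces_plug (δρ := δρ)
    obtain ⟨E, a, hE, hred', ha, hEE'⟩ := ih hb
    exact ⟨fun t => f.plug (E t), a, hE.plug_frame (hf ▸ hg), hred.trans (hred'.plug f), ha,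
      fun d u hdu => hplug _ _ (hEE' d u hdu)⟩

theorem Denotes.exists_reduces_core {c : Clo S} {e : Expr S} (h : c.Denotes e) {hd : Head S}
    {ws fs : List (Expr S)} (he : e.parts = some ⟨hd, ws, fs⟩) (hws : ∀ w ∈ ws, w.IsValue) :
    ∃ c' vs ds, Reduces δρ c c' ∧ c'.parts = some ⟨hd, vs, ds⟩ ∧
      ((∀ v ∈ vs, v.IsClosedValue) ∧ vs.map force = ws) ∧
      List.Forall₂ (DenotesUnder hd.binder) ds fs := by
  obtain ⟨c', vs, _, ds, hred, hc', hvs, ⟨⟩, hds⟩ :=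
    h.exists_reduces_node (δρ := δρ) (es := []) (by simpa using he) hws
  exact ⟨c', vs, ds, hred, by simpa using hc', hvs, hds⟩

theorem Denotes.exists_reduces_raised {c : Clo S} {s : Signal S} {w : Expr S} (hw : w.IsValue)
    (h : c.Denotes (s.raised w)) :
    ∃ v, Reduces δρ c (s.raised v) ∧ v.IsClosedValue ∧ v.force = w := by
  obtain ⟨c', vs, _, hred, hc', ⟨hvs, hforce⟩, ⟨⟩⟩ := h.exists_reduces_core (δρ := δρ)
    (s.parts_raised w) (List.forall_mem_singleton.2 hw)
  obtain ⟨v, rfl, rfl⟩ := List.map_eq_singleton_iff.1 hforce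
  obtain rfl := Term.parts_inj hc' (s.parts_raised v)
  exact ⟨v, hred, List.forall_mem_singleton.1 hvs, rfl⟩

end Clo

namespace Rho

/-- What the rules of `λ_JS` skip in one step, `λρ_JS` discards frame by frame. -/
theorem exists_reduces_localCtx {s : Signal S} {E : Clo S → Clo S} (hE : IsCtx s.Passes E)
    {v : Clo S} (hv : v.IsValue) :
    ∃ C, LocalCtx C ∧ Reduces δρ (E (s.raised v)) (C (s.raised v)) := by
  induction hE using IsCtx.induction with
  | hole => exact ⟨_, .hole, .refl _⟩
  | @plug f E hf _ ih =>
    obtain ⟨C, hC, hred⟩ := ih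
    replace hred := hred.plug f
    by_cases hlocal : f.head.IsLocal
    · exact ⟨_, hC.plug_frame hlocal, hred⟩
    suffices h : Reduces δρ (f.plug (C (s.raised v))) (s.raised v) from
      ⟨_, .hole, hred.trans h⟩
    obtain ⟨l, hhead, hplug⟩ | ⟨x, b, hhead, hplug⟩ | ⟨b, hhead, -⟩ :=
      Frame.plug_eq_of_not_isLocal hlocal <;>
      rw [hhead] at hf <;> cases s <;> try exact hf.elim
    · exact hplug ▸ fun σ E hE => .single (.throwLabel σ hE hC v hv l)
    · exact hplug ▸ fun σ E hE => .single (.breakCatch σ hE hC _ v hv x b)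

end Rho

namespace Clo

open Rho

theorem Denotes.exists_reduces_passed {s : Signal S} {N : Expr S → Expr S}
    (hN : IsCtx s.Passes N) {w : Expr S} (hw : w.IsValue) {c : Clo S}
    (h : c.Denotes (N (s.raised w))) :
    ∃ C v, LocalCtx C ∧ v.IsClosedValue ∧ v.force = w ∧ Reduces δρ c (C (s.raised v)) := by
  obtain ⟨N', a, hN', hred, ha, -⟩ := h.exists_reduces_ctx (δρ := δρ) hN
  obtain ⟨v, hred_raised, hv, rfl⟩ := ha.exists_reduces_raised (δρ := δρ) hw
  obtain ⟨C, hC, hred_local⟩ := exists_reduces_localCtx (δρ := δρ) hN' hv.isValue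
  exact ⟨C, v, hC, hv, rfl, (hred.trans (hred_raised.ctx hN')).trans hred_local⟩

end Clo

end Back

section Back

variable {S : Domains} {δ : S.Op → List (Expr S) → Option (Expr S)}
  {δρ : S.Op → List (Clo S) → Option (Clo S)}

open Rho

theorem JS.Red.exists_parts {e e' : Expr S} (h : JS.Red δ e e') : ∃ q, e.parts = some q := by
  cases h <;> exact ⟨_, rfl⟩

theorem Clo.Denotes.exists_reduces_of_red (hδ : PrimsAgree δ δρ) {e e' : Expr S}
    (hred : JS.Red δ e e') {c : Clo S} (h : c.Denotes e) :
    ∃ c', Reduces δρ c c' ∧ c'.Denotes e' := by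
  obtain ⟨q, hq⟩ := hred.exists_parts
  obtain ⟨c₁, vs, ds, hc₁, hparts, ⟨hvs, hforce⟩, hds⟩ :=
    h.exists_reduces_core (δρ := δρ) hq (hred.isCore.2 q hq)
  have hc₁e : c₁.Denotes e :=
    Parts.Denotes.of_parts ⟨rfl, hforce ▸ forall₂_denotes_map_force hvs, hds⟩ hparts hq
  obtain ⟨c', hstep, hc'⟩ :=
    (RedMatch.of_denotes hδ hparts (fun v hv => (hvs v hv).isValue) hc₁e).back hred
  exact ⟨c', hc₁.trans hstep.reduces, hc'⟩

theorem Clo.Denotes.exists_reduces_handler {s : Signal S} {E' N : Expr S → Expr S}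
    (hE' : JS.EvalCtx E') (hN : IsCtx s.Passes N) {w : Expr S} (hw : w.IsValue) {t : Expr S}
    {hd : Head S} {fs : List (Expr S)} (ht : t.parts = some ⟨hd, [N (s.raised w)], fs⟩)
    {c : Clo S} (h : c.Denotes (E' t)) :
    ∃ E C v ds, EvalCtx E ∧ LocalCtx C ∧ (v.IsClosedValue ∧ v.force = w) ∧
      Reduces δρ c (E (Clo.ofParts ⟨hd, [C (s.raised v)], ds⟩)) ∧
      List.Forall₂ (DenotesUnder hd.binder) ds fs ∧
      ∀ d u, d.Denotes u → (E d).Denotes (E' u) := by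
  obtain ⟨E, a, hE, hred, ha, hEE'⟩ := h.exists_reduces_ctx (δρ := δρ) hE'.isCtx
  obtain ⟨b, p, hred_node, hb, rfl, hstrict, hds⟩ := ha.exists_reduces_parts (δρ := δρ) ht
  obtain ⟨_, bs, ds⟩ := p
  obtain ⟨a', _, ha', ⟨⟩, rfl⟩ := List.forall₂_cons_right_iff.1 hstrict
  obtain ⟨f, rfl, hbefore, hafter, rfl, rfl⟩ :=
    Frame.exists_plug_eq (vs := []) (as := []) (a := a') hb (by simp)
  obtain ⟨C, v, hC, hv, rfl, hred_body⟩ := ha'.exists_reduces_passed (δρ := δρ) hN hw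
  have hplug : f.plug (C (s.raised v)) = Clo.ofParts ⟨f.head, [C (s.raised v)], f.delayed⟩ := by
    simpa [hbefore, hafter] using
      (Clo.parts_eq_some_iff.1 (f.parts_plug (C (s.raised v)))).2.symm
  exact ⟨E, C, v, f.delayed, evalCtx_iff.2 hE, hC, ⟨hv, rfl⟩,
    hplug ▸ hred.trans ((hred_node.trans (hred_body.plug f)).ctx hE), hds, hEE'⟩

theorem Clo.Denotes.exists_reduces_redex {E' : Expr S → Expr S} (hE' : JS.EvalCtx E') {t : Expr S}
    {hd : Head S} {ws fs : List (Expr S)} (ht : t.parts = some ⟨hd, ws, fs⟩)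
    (hws : ∀ w ∈ ws, w.IsValue) {c : Clo S} (h : c.Denotes (E' t)) :
    ∃ E vs ds, EvalCtx E ∧ ((∀ v ∈ vs, v.IsClosedValue) ∧ vs.map force = ws) ∧
      Reduces δρ c (E (Clo.ofParts ⟨hd, vs, ds⟩)) ∧
      ∀ d u, d.Denotes u → (E d).Denotes (E' u) := by
  obtain ⟨E, a, hE, hred, ha, hEE'⟩ := h.exists_reduces_ctx (δρ := δρ) hE'.isCtx
  obtain ⟨b, vs, ds, hred_core, hb, hvs, -⟩ := ha.exists_reduces_core (δρ := δρ) ht hws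
  obtain ⟨-, rfl⟩ := Clo.parts_eq_some_iff.1 hb
  exact ⟨E, vs, ds, evalCtx_iff.2 hE, hvs, hred.trans (hred_core.ctx hE), hEE'⟩

theorem Clo.Denotes.exists_reduces_alloc {E' : Expr S → Expr S} (hE' : JS.EvalCtx E')
    {w : Expr S} (hw : w.IsValue) {c : Clo S} (h : c.Denotes (E' (.alloc w))) :
    ∃ E v, EvalCtx E ∧ (v.IsClosedValue ∧ v.force = w) ∧ Reduces δρ c (E (.alloc v)) ∧
      ∀ d u, d.Denotes u → (E d).Denotes (E' u) := by
  obtain ⟨E, _, _, hE, ⟨hvs, hforce⟩, hred, hEE'⟩ :=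
    h.exists_reduces_redex (δρ := δρ) hE' (hd := .alloc) rfl (List.forall_mem_singleton.2 hw)
  obtain ⟨v, rfl, hvw⟩ := List.map_eq_singleton_iff.1 hforce
  exact ⟨E, v, hE, ⟨List.forall_mem_singleton.1 hvs, hvw⟩, hred, hEE'⟩

theorem Clo.Denotes.exists_reduces_deref {E' : Expr S → Expr S} (hE' : JS.EvalCtx E')
    {k : S.Const} {c : Clo S} (h : c.Denotes (E' (.deref (.const k)))) :
    ∃ E, EvalCtx E ∧ Reduces δρ c (E (.deref (.const k))) ∧
      ∀ d u, d.Denotes u → (E d).Denotes (E' u) := by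
  obtain ⟨E, _, _, hE, ⟨hvs, hforce⟩, hred, hEE'⟩ :=
    h.exists_reduces_redex (δρ := δρ) hE' (hd := .deref) rfl
      (List.forall_mem_singleton.2 (.const k))
  obtain ⟨v, rfl, hv⟩ := List.map_eq_singleton_iff.1 hforce
  obtain rfl := (List.forall_mem_singleton.1 hvs).isValue.force_eq_const_iff.1 hv
  exact ⟨E, hE, hred, hEE'⟩

theorem Clo.Denotes.exists_reduces_assign {E' : Expr S → Expr S} (hE' : JS.EvalCtx E')
    {k : S.Const} {w : Expr S} (hw : w.IsValue) {c : Clo S}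
    (h : c.Denotes (E' (.assign (.const k) w))) :
    ∃ E v, EvalCtx E ∧ (v.IsClosedValue ∧ v.force = w) ∧
      Reduces δρ c (E (.assign (.const k) v)) ∧ ∀ d u, d.Denotes u → (E d).Denotes (E' u) := by
  obtain ⟨E, _, _, hE, ⟨hvs, hforce⟩, hred, hEE'⟩ :=
    h.exists_reduces_redex (δρ := δρ) hE' (hd := .assign) rfl
      (List.forall_mem_cons.2 ⟨.const k, List.forall_mem_singleton.2 hw⟩)
  obtain ⟨u, _, rfl, hu, htail⟩ := List.map_eq_cons_iff.1 hforce
  obtain ⟨v, rfl, hvw⟩ := List.map_eq_singleton_iff.1 htail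
  obtain rfl := (hvs u (by simp)).isValue.force_eq_const_iff.1 hu
  exact ⟨E, v, hE, ⟨hvs v (by simp), hvw⟩, hred, hEE'⟩

theorem Clo.Denotes.exists_reduces_tryc {s : Signal S} {E' N : Expr S → Expr S}
    (hE' : JS.EvalCtx E') (hN : IsCtx s.Passes N) {w : Expr S} (hw : w.IsValue) {x : S.Var}
    {f : Expr S} {c : Clo S} (h : c.Denotes (E' (.tryc (N (s.raised w)) x f))) :
    ∃ E C v e ρ, EvalCtx E ∧ LocalCtx C ∧ (v.IsClosedValue ∧ v.force = w) ∧
      Reduces δρ c (E (.tryc (C (s.raised v)) x (.clos e ρ))) ∧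
      DenotesUnder [x] (.clos e ρ) f ∧ ∀ d u, d.Denotes u → (E d).Denotes (E' u) := by
  obtain ⟨E, C, v, ds, hE, hC, hv, hred, hds, hEE'⟩ :=
    h.exists_reduces_handler (δρ := δρ) hE' hN hw (hd := .tryc x) rfl
  obtain ⟨b, _, hb, ⟨⟩, rfl⟩ := List.forall₂_cons_right_iff.1 hds
  obtain ⟨e, ρ, rfl⟩ : ∃ e ρ, b = .clos e ρ := by
    cases hb
    exact ⟨_, _, rfl⟩
  exact ⟨E, C, v, e, ρ, hE, hC, hv, hred, hb, hEE'⟩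

theorem Clo.Denotes.exists_reduces_tryf {s : Signal S} {E' N : Expr S → Expr S}
    (hE' : JS.EvalCtx E') (hN : IsCtx s.Passes N) {w : Expr S} (hw : w.IsValue)
    {f : Expr S} {c : Clo S} (h : c.Denotes (E' (.tryf (N (s.raised w)) f))) :
    ∃ E C v b, EvalCtx E ∧ LocalCtx C ∧ (v.IsClosedValue ∧ v.force = w) ∧
      Reduces δρ c (E (.tryf (C (s.raised v)) b)) ∧
      (E (.seq b (s.raised v))).Denotes (E' (.seq f (s.raised w))) := by
  obtain ⟨E, C, v, ds, hE, hC, ⟨hv, rfl⟩, hred, hds, hEE'⟩ :=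
    h.exists_reduces_handler (δρ := δρ) hE' hN hw (hd := .tryf) rfl
  obtain ⟨b, _, hb, ⟨⟩, rfl⟩ := List.forall₂_cons_right_iff.1 hds
  exact ⟨E, C, v, b, hE, hC, ⟨hv, rfl⟩, hred, hEE' _ _ (Denotes.seq hb (hv.denotes_raised s))⟩

theorem Clo.Denotes.exists_reduces_label {s : Signal S} {E' N : Expr S → Expr S}
    (hE' : JS.EvalCtx E') (hN : IsCtx s.Passes N) {w : Expr S} (hw : w.IsValue) {l : S.Label}
    {c : Clo S} (h : c.Denotes (E' (.label l (N (s.raised w))))) :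
    ∃ E C v, EvalCtx E ∧ LocalCtx C ∧ (v.IsClosedValue ∧ v.force = w) ∧
      Reduces δρ c (E (.label l (C (s.raised v)))) ∧
      ∀ d u, d.Denotes u → (E d).Denotes (E' u) := by
  obtain ⟨E, C, v, _, hE, hC, hv, hred, -, hEE'⟩ :=
    h.exists_reduces_handler (δρ := δρ) hE' hN hw (hd := .label l) rfl
  exact ⟨E, C, v, hE, hC, hv, hred, hEE'⟩

/-- The state `t` is denoted by a state that `s` reaches. -/
def Rho.ReachesDenoting (δρ : S.Op → List (Clo S) → Option (Clo S)) (s : State S (Clo S))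
    (t : State S (Expr S)) : Prop :=
  ∃ s', Relation.ReflTransGen (Step δρ) s s' ∧ StateDenotes s' t

theorem Rho.Reduces.reachesDenoting {c c' : Clo S} (h : Reduces δρ c c') {σ : Store S (Clo S)}
    {s' : State S (Clo S)} (hstep : Step δρ (σ, .run c') s') {t : State S (Expr S)}
    (ht : StateDenotes s' t) : ReachesDenoting δρ (σ, .run c) t :=
  ⟨s', (h σ _ (.mk .hole .hole)).tail hstep, ht⟩

theorem Clo.Denotes.reachesDenoting (hδ : PrimsAgree δ δρ) {σ : Store S (Clo S)}
    (hσ : Store.IsClosed σ) {c : Clo S} {e : Expr S} (h : c.Denotes e) {t : State S (Expr S)}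
    (hstep : JS.Step δ (Store.force σ, .run e) t) : ReachesDenoting δρ (σ, .run c) t := by
  generalize hτ : Store.force σ = τ at hstep
  cases hstep <;> subst hτ
  case ctx hE e e' hred =>
    obtain ⟨E, a, hE, hred_ctx, ha, hEE'⟩ := h.exists_reduces_ctx (δρ := δρ) hE.isCtx
    obtain ⟨a', hred_red, ha'⟩ := ha.exists_reduces_of_red hδ hred
    exact ⟨_, (hred_ctx.trans (hred_red.ctx hE)) σ _ (.mk .hole .hole), .run hσ (hEE' _ _ ha')⟩
  case alloc hE _ hw a ha =>
    obtain ⟨E, v, hE, ⟨hv, rfl⟩, hred, hEE'⟩ := h.exists_reduces_alloc hE hw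
    rw [← Store.force_update]
    exact hred.reachesDenoting (.alloc σ hE v hv.isValue a (by simpa [Store.force] using ha))
      (.run (hσ.update a hv) (hEE' _ _ (.const _)))
  case deref hE a w ha =>
    obtain ⟨E, hE, hred, hEE'⟩ := h.exists_reduces_deref hE
    obtain ⟨v, hv, rfl⟩ := Option.map_eq_some_iff.1 ha
    exact hred.reachesDenoting (.deref σ hE a v hv) (.run hσ (hEE' _ _ (hσ a v hv).denotes_force))
  case derefDangling hE a ha =>
    obtain ⟨E, hE, hred, hEE'⟩ := h.exists_reduces_deref hE
    exact hred.reachesDenoting (.derefDangling σ hE a (Option.map_eq_none_iff.1 ha))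
      (.run hσ (hEE' _ _ (denotes_raise _)))
  case assign hE a _ hw =>
    obtain ⟨E, v, hE, ⟨hv, rfl⟩, hred, hEE'⟩ := h.exists_reduces_assign hE hw
    rw [← Store.force_update]
    exact hred.reachesDenoting (.assign σ hE a v hv.isValue)
      (.run (hσ.update a hv) (hEE' _ _ hv.denotes_force))
  case uncaught hF w hw =>
    obtain ⟨C, v, hC, hv, rfl, hred⟩ := h.exists_reduces_passed (s := .throw) hF.isCtx hw
    exact hred.reachesDenoting (.uncaught σ hC v hv.isValue) (.err hσ hv)
  case throwCatch hE hF w hw x f =>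
    obtain ⟨E, C, v, b, ρ, hE, hC, ⟨hv, rfl⟩, hred, hb, hEE'⟩ :=
      h.exists_reduces_tryc (s := .throw) hE hF.isCtx hw
    exact hred.reachesDenoting (.throwCatch σ hE hC v hv.isValue x b ρ)
      (.run hσ (hEE' _ _ (hb.bind (vs := [v]) (List.forall_mem_singleton.2 hv) rfl)))
  case throwFinally hE hF w hw f =>
    obtain ⟨E, C, v, b, hE, hC, ⟨hv, rfl⟩, hred, hEE'⟩ :=
      h.exists_reduces_tryf (s := .throw) hE hF.isCtx hw
    exact hred.reachesDenoting (.throwFinally σ hE hC v hv.isValue b) (.run hσ hEE')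
  case breakFinally hE hG l w hw f =>
    obtain ⟨E, C, v, b, hE, hC, ⟨hv, rfl⟩, hred, hEE'⟩ :=
      h.exists_reduces_tryf (s := .brk l) hE (hG.isCtx l) hw
    exact hred.reachesDenoting (.breakFinally σ hE hC l v hv.isValue b) (.run hσ hEE')
  case breakLabel hE hG l w hw =>
    obtain ⟨E, C, v, hE, hC, ⟨hv, rfl⟩, hred, hEE'⟩ :=
      h.exists_reduces_label (s := .brk l) hE (hG.isCtx l) hw
    exact hred.reachesDenoting (.breakLabel σ hE hC l v hv.isValue)
      (.run hσ (hEE' _ _ hv.denotes_force))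
  case breakOther hE hG l l' hl w hw =>
    obtain ⟨E, C, v, hE, hC, ⟨hv, rfl⟩, hred, hEE'⟩ :=
      h.exists_reduces_label (s := .brk l) hE (hG.isCtx l) hw
    exact hred.reachesDenoting (.breakOther σ hE hC l l' hl v hv.isValue)
      (.run hσ (hEE' _ _ (hv.denotes_raised (.brk l))))
  case breakUnbound hG l w hw =>
    obtain ⟨C, v, hC, hv, rfl, hred⟩ := h.exists_reduces_passed (s := .brk l) (hG.isCtx l) hw
    exact hred.reachesDenoting (.breakUnbound σ hC l v hv.isValue) (.run hσ (denotes_raise _))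

theorem StateDenotes.reachesDenoting (hδ : PrimsAgree δ δρ) {s : State S (Clo S)}
    {t u : State S (Expr S)} (hs : StateDenotes s t)
    (h : Relation.ReflTransGen (JS.Step δ) t u) : ReachesDenoting δρ s u := by
  induction h with
  | refl => exact ⟨s, .refl, hs⟩
  | tail _ hstep ih =>
    obtain ⟨s', hreach, hs'⟩ := ih
    cases hs' with
    | run hσ h =>
      obtain ⟨s'', hreach', hs''⟩ := h.reachesDenoting hδ hσ hstep
      exact ⟨s'', hreach.trans hreach', hs''⟩
    | err => cases hstep

theorem Store.isAnswer_of_force {σ : Store S (Clo S)} (hσ : Store.IsClosed σ)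
    (hfin : {a | Store.force σ a ≠ none}.Finite) {v : Clo S} (hv : v.IsValue) {r : Outcome (Clo S)}
    (hr : r = .run v ∨ r = .err v) : IsAnswer Clo.IsValue (σ, r) :=
  ⟨by simpa [Store.force] using hfin, fun a w hw => (hσ a w hw).isValue, v, hv, hr⟩

theorem StateDenotes.exists_isAnswer {s : State S (Clo S)} {A : State S (Expr S)}
    (hs : StateDenotes s A) (hA : IsAnswer Expr.IsValue A) :
    ∃ A', IsAnswer Clo.IsValue A' ∧ Relation.ReflTransGen (Step δρ) s A' ∧ A = forceState A' := by
  obtain ⟨hfin, -, w, hw, hr⟩ := hA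
  cases hs with
  | @run σ c e hσ h =>
    obtain rfl : e = w := by simpa using hr
    obtain ⟨v, hred, hv, rfl⟩ := h.evaluates (δρ := δρ) hw
    exact ⟨_, Store.isAnswer_of_force hσ hfin hv.isValue (.inl rfl),
      hred σ _ (.mk .hole .hole), rfl⟩
  | err hσ hv => exact ⟨_, Store.isAnswer_of_force hσ hfin hv.isValue (.inr rfl), .refl, rfl⟩

theorem StateDenotes.reflTransGen_iff (hδ : PrimsAgree δ δρ) {s : State S (Clo S)}
    {t : State S (Expr S)} (hs : StateDenotes s t) {A : State S (Expr S)}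
    (hA : IsAnswer Expr.IsValue A) :
    Relation.ReflTransGen (JS.Step δ) t A ↔
      ∃ A', IsAnswer Clo.IsValue A' ∧ Relation.ReflTransGen (Step δρ) s A' ∧
        A = forceState A' := by
  constructor
  · intro h
    obtain ⟨s', hreach, hs'⟩ := hs.reachesDenoting (δρ := δρ) hδ h
    obtain ⟨A', hA', hreach', hforce⟩ := hs'.exists_isAnswer (δρ := δρ) hA
    exact ⟨A', hA', hreach.trans hreach', hforce⟩
  · rintro ⟨A', hA', hreach, rfl⟩
    exact hs.reaches_forceState hδ hreach hA'

theorem Expr.Closed.denotes {e : Expr S} (he : e.Closed) : (Clo.clos e []).Denotes e :=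
  Clo.denotes_clos_iff.2 ⟨⟨by simp, fun x hx => absurd (he ▸ hx) (Set.notMem_empty x)⟩,
    e.subst_none.symm⟩

theorem Expr.Closed.stateDenotes_inj {e : Expr S} (he : e.Closed) :
    StateDenotes (Rho.inj e) (emptyStore, .run e) :=
  StateDenotes.run (σ := emptyStore) (by simp [Store.IsClosed, emptyStore]) he.denotes

end Back

end LambdaJS

/-- Correspondence of `λ_JS` and `λρ_JS`. The primitive operations are interpreted by `δ` on syntactic
values and by `δρ` on values with environments (`none`: undefined, a run-time error); they are
the same operations up to forcing of environments, and yield closed values. -/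
theorem mainTheorem4 (S : LambdaJS.Domains)
    (δ : S.Op → List (LambdaJS.Expr S) → Option (LambdaJS.Expr S))
    (δρ : S.Op → List (LambdaJS.Clo S) → Option (LambdaJS.Clo S))
    (hδ : ∀ (op : S.Op) (vs : List (LambdaJS.Clo S)), (∀ v ∈ vs, v.IsClosedValue) →
      δ op (vs.map LambdaJS.Clo.force) = (δρ op vs).map LambdaJS.Clo.force)
    (hclosed : ∀ (op : S.Op) (vs : List (LambdaJS.Clo S)) (v : LambdaJS.Clo S),
      (∀ v ∈ vs, v.IsClosedValue) → δρ op vs = some v → v.IsClosedValue)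
    (e : LambdaJS.Expr S) (he : e.Closed)
    (A : LambdaJS.State S (LambdaJS.Expr S)) (hA : LambdaJS.IsAnswer LambdaJS.Expr.IsValue A) :
    Relation.ReflTransGen (LambdaJS.JS.Step δ) (LambdaJS.emptyStore, .run e) A ↔
      ∃ A' : LambdaJS.State S (LambdaJS.Clo S),
        LambdaJS.IsAnswer LambdaJS.Clo.IsValue A' ∧
        Relation.ReflTransGen (LambdaJS.Rho.Step δρ) (LambdaJS.Rho.inj e) A' ∧
        A = LambdaJS.forceState A' := by
  exact he.stateDenotes_inj.reflTransGen_iff ⟨hδ _ _, hclosed _ _ _⟩ hA
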